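/- Let $n \ge 1$ and let $V \in C^\infty(\mathbb R^n;\mathbb R)$ be $\mathbb Z^n$-periodic. Suppose that there is a fundamental domain $F$ of $\mathbb Z^n$ (that is, a set $F \subset \mathbb R^n$ such that the translates $\overline F + \gamma$, $\gamma\in\mathbb Z^n$, cover $\mathbb R^n$ and the translates of the interior of $F$ are pairwise disjoint) with $V(x) > \min_{\mathbb R^n} V$ for every $x \in \partial F$. For $h > 0$ let $P_{\rm d}(h)$ be the bounded operator on $\ell^2(\mathbb Z^n)$ (complex valued) given by $$ (P_{\rm d}(h) v)(\gamma) = \sum_{j=1}^n \bigl( 2 v(\gamma) - v(\gamma+e_j) - v(\gamma - e_j) \bigr) + V(h\gamma)\, v(\gamma), \qquad \gamma\in\mathbb Z^n, $$ and let $P_{\rm c}(h)$ be the unbounded operator on $L^2(\mathbb R^n)$ (complex valued) with domain the Sobolev space $H^2(\mathbb R^n)$ given by $$ (P_{\rm c}(h) u)(x) = -\Delta u(x) + V(hx)\, u(x). $$ Then $$ \frac{\min \operatorname{Spec} P_{\rm d}(h)}{\min \operatorname{Spec} P_{\rm c}(h)} = 1 + \mathcal O(h) \qquad (h \to 0^+).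 $$ That is, there are constants $C$ and $h_0 > 0$ (depending on $n$ and $V$) such that for all $0<h<h_0$ both spectra are contained in $\mathbb R$ and have a smallest element, the smallest element of $\operatorname{Spec} P_{\rm c}(h)$ is not $0$, and $$ \left| \frac{\min \operatorname{Spec} P_{\rm d}(h)}{\min \operatorname{Spec} P_{\rm c}(h)} - 1 \right| \le C h . $$ -/

import Mathlib

open MeasureTheory Set
open scoped ENNReal NNReal ContDiff SchwartzMap Laplacian lp

noncomputable section

/-- The lattice point of `ℝⁿ` with integer coordinates `γ`. -/
def latticePt {n : ℕ} (γ : Fin n → ℤ) : EuclideanSpace ℝ (Fin n) :=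
  WithLp.toLp 2 (fun i => (γ i : ℝ))

/-- A smooth real potential on `ℝⁿ`, periodic with respect to `ℤⁿ`. -/
structure PeriodicPotential (n : ℕ) where
  /-- The underlying function. -/
  toFun : EuclideanSpace ℝ (Fin n) → ℝ
  smooth : ContDiff ℝ ∞ toFun
  periodic : ∀ (x : EuclideanSpace ℝ (Fin n)) (γ : Fin n → ℤ), toFun (x + latticePt γ) = toFun x

instance {n : ℕ} : CoeFun (PeriodicPotential n) (fun _ => EuclideanSpace ℝ (Fin n) → ℝ) :=
  ⟨PeriodicPotential.toFun⟩

/-- `F` is a fundamental domain of `ℤⁿ`: the translates of `F` tile `ℝⁿ`, up to what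
happens on boundaries. Exact sets of representatives of `ℝⁿ / ℤⁿ`, closed tiles and open tiles
are all covered by this notion. -/
structure IsLatticeFundamentalDomain {n : ℕ} (F : Set (EuclideanSpace ℝ (Fin n))) : Prop where
  covers : ∀ x : EuclideanSpace ℝ (Fin n), ∃ γ : Fin n → ℤ, x + latticePt γ ∈ closure F
  disjoint : ∀ (γ : Fin n → ℤ) (x : EuclideanSpace ℝ (Fin n)),
    x ∈ interior F → x + latticePt γ ∈ interior F → γ = 0

/-- `F` carries a barrier for `V`: on the boundary of `F`, `V` exceeds its minimum over `ℝⁿ`. -/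
def HasBarrier {n : ℕ} (V : PeriodicPotential n) (F : Set (EuclideanSpace ℝ (Fin n))) : Prop :=
  ∀ x ∈ frontier F, (⨅ y, V y) < V x

theorem PeriodicPotential.exists_bound {n : ℕ} (V : PeriodicPotential n) :
    ∃ C : ℝ, 0 ≤ C ∧ ∀ x, |V x| ≤ C := by
  obtain ⟨C, hC⟩ := (isCompact_closedBall (0 : EuclideanSpace ℝ (Fin n)) (Real.sqrt n)
    ).exists_bound_of_continuousOn (f := V) V.smooth.continuous.continuousOn
  refine ⟨C, (norm_nonneg _).trans (hC 0 (by simp)), fun x => ?_⟩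
  rw [← V.periodic x (fun i => -⌊x i⌋)]
  refine hC _ ?_
  rw [mem_closedBall_zero_iff, EuclideanSpace.norm_eq]
  refine Real.sqrt_le_sqrt ?_
  calc ∑ i, ‖(x + latticePt (fun i => -⌊x i⌋)) i‖ ^ 2 ≤ ∑ _i : Fin n, (1 : ℝ) := by
        refine Finset.sum_le_sum fun i _ => ?_
        have : (x + latticePt (fun i => -⌊x i⌋)) i = Int.fract (x i) := by
          simp [latticePt, Int.fract, sub_eq_add_neg]
        rw [this, Real.norm_eq_abs, sq_abs]
        nlinarith [Int.fract_nonneg (x i), (Int.fract_lt_one (x i)).le]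
    _ = n := by simp

/-! ### The discrete operator -/

/-- `ℓ²(ℤⁿ)`. -/
abbrev DiscreteL2 (n : ℕ) : Type := lp (fun _ : Fin n → ℤ => ℂ) 2

/-- The value at `γ` of the discrete Schrödinger operator applied to `v : ℤⁿ → ℂ`. -/
def discreteFormula {n : ℕ} (V : PeriodicPotential n) (h : ℝ) (v : (Fin n → ℤ) → ℂ)
    (γ : Fin n → ℤ) : ℂ :=
  ∑ j : Fin n, (2 * v γ - v (γ + Pi.single j 1) - v (γ - Pi.single j 1)) +
    (V (h • latticePt γ) : ℂ) * v γ

/-- The operator `v ↦ (γ ↦ a γ * v (e γ))` on `ℓ²`, where `a` is bounded and `e` is a bijection. -/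
def weightedShift {ι : Type} (a : ι → ℂ) (C : ℝ) (hC : 0 ≤ C) (ha : ∀ i, ‖a i‖ ≤ C)
    (e : ι ≃ ι) : lp (fun _ : ι => ℂ) 2 →L[ℂ] lp (fun _ : ι => ℂ) 2 :=
  have key : ∀ (v : lp (fun _ : ι => ℂ) 2) (s : Finset ι),
      ∑ i ∈ s, ‖a i * v (e i)‖ ^ (2 : ℝ≥0∞).toReal ≤ (C * ‖v‖) ^ (2 : ℝ≥0∞).toReal := by
    intro v s
    have h2 := lp.sum_rpow_le_norm_rpow (p := 2) (by simp) v (s.map e.toEmbedding)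
    simp only [ENNReal.toReal_ofNat, Real.rpow_ofNat, Finset.sum_map,
      Equiv.coe_toEmbedding] at h2 ⊢
    calc ∑ i ∈ s, ‖a i * v (e i)‖ ^ 2 ≤ ∑ i ∈ s, C ^ 2 * ‖v (e i)‖ ^ 2 := by
          refine Finset.sum_le_sum fun i _ => ?_
          rw [norm_mul, mul_pow]
          gcongr
          exact ha i
      _ = C ^ 2 * ∑ i ∈ s, ‖v (e i)‖ ^ 2 := by rw [Finset.mul_sum]
      _ ≤ C ^ 2 * ‖v‖ ^ 2 := by gcongr
      _ = (C * ‖v‖) ^ 2 := by ring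
  LinearMap.mkContinuous
    { toFun := fun v => ⟨fun i => a i * v (e i), memℓp_gen' (key v)⟩
      map_add' := fun v w => by
        ext i
        exact mul_add _ _ _
      map_smul' := fun c v => by
        ext i
        exact mul_left_comm _ _ _ } C
    (fun v => lp.norm_le_of_forall_sum_le (by simp) (by positivity) (key v))

/-- The discrete Schrödinger operator `P_d(h)`, a bounded operator on `ℓ²(ℤⁿ)`. -/
def discreteOp {n : ℕ} (V : PeriodicPotential n) (h : ℝ) : DiscreteL2 n →L[ℂ] DiscreteL2 n :=
  ∑ j : Fin n, (2 • ContinuousLinearMap.id ℂ (DiscreteL2 n)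
      - weightedShift (fun _ => 1) 1 zero_le_one (by simp) (Equiv.addRight (Pi.single j 1))
      - weightedShift (fun _ => 1) 1 zero_le_one (by simp) (Equiv.subRight (Pi.single j 1)))
    + weightedShift (fun γ => (V (h • latticePt γ) : ℂ)) V.exists_bound.choose
        V.exists_bound.choose_spec.1
        (fun γ => by
          rw [Complex.norm_real]
          exact V.exists_bound.choose_spec.2 _) (Equiv.refl _)

/-- `P_d(h)` acts by the expected formula. -/
theorem discreteOp_apply {n : ℕ} (V : PeriodicPotential n) (h : ℝ) (v : DiscreteL2 n)
    (γ : Fin n → ℤ) : discreteOp V h v γ = discreteFormula V h v γ := by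
  simp only [discreteOp, discreteFormula, _root_.add_apply,
    _root_.sum_apply, _root_.sub_apply, lp.coeFn_add, Pi.add_apply,
    lp.coeFn_sum, Finset.sum_apply, lp.coeFn_sub, Pi.sub_apply]
  congr 1
  refine Finset.sum_congr rfl fun j _ => ?_
  congr 1
  · congr 1
    · simp [two_smul, two_mul]
    · exact one_mul _
  · exact one_mul _

/-! ### The continuous operator -/

/-- `L²(ℝⁿ)`, complex valued. -/
abbrev ContinuousL2 (n : ℕ) : Type :=
  Lp ℂ 2 (volume : Measure (EuclideanSpace ℝ (Fin n)))

/-- The Sobolev space `H²(ℝⁿ)` as a subspace of `L²(ℝⁿ)`. -/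
def sobolevH2 (n : ℕ) : Submodule ℂ (ContinuousL2 n) where
  carrier := {u | TemperedDistribution.MemSobolev 2 2
    (u : 𝓢'(EuclideanSpace ℝ (Fin n), ℂ))}
  add_mem' {u w} hu hw := by
    have := TemperedDistribution.MemSobolev.add hu hw
    simp only [← Lp.toTemperedDistributionCLM_apply, ← map_add] at this
    exact this
  zero_mem' := by
    have := TemperedDistribution.memSobolev_fun_zero (EuclideanSpace ℝ (Fin n)) ℂ 2 2
    rw [← map_zero (Lp.toTemperedDistributionCLM ℂ volume 2)] at this
    exact this
  smul_mem' c u hu := by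
    have := TemperedDistribution.MemSobolev.smul c hu
    simp only [← Lp.toTemperedDistributionCLM_apply, ← map_smul] at this
    exact this

theorem exists_laplacian {n : ℕ} (u : sobolevH2 n) : ∃ g : ContinuousL2 n,
    (g : 𝓢'(EuclideanSpace ℝ (Fin n), ℂ)) =
      Δ ((u : ContinuousL2 n) : 𝓢'(EuclideanSpace ℝ (Fin n), ℂ)) := by
  have h := TemperedDistribution.MemSobolev.laplacian u.2
  rw [sub_self, TemperedDistribution.memSobolev_zero_iff] at h
  obtain ⟨g, hg⟩ := h
  exact ⟨g, hg.symm⟩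

theorem toTemperedDistribution_injective {n : ℕ} :
    Function.Injective (Lp.toTemperedDistributionCLM ℂ
      (volume : Measure (EuclideanSpace ℝ (Fin n))) 2) :=
  LinearMap.ker_eq_bot.mp (Lp.ker_toTemperedDistributionCLM_eq_bot (p := 2))

/-- The Laplacian `H²(ℝⁿ) → L²(ℝⁿ)`: the element of `L²` which represents the distributional
Laplacian. -/
def laplacianH2 (n : ℕ) : sobolevH2 n →ₗ[ℂ] ContinuousL2 n where
  toFun u := (exists_laplacian u).choose
  map_add' u w := by
    apply toTemperedDistribution_injective
    rw [map_add]
    simp only [Lp.toTemperedDistributionCLM_apply, (exists_laplacian _).choose_spec]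
    simp only [← TemperedDistribution.laplacianCLM_apply, ← Lp.toTemperedDistributionCLM_apply,
      Submodule.coe_add, map_add]
  map_smul' c u := by
    apply toTemperedDistribution_injective
    rw [RingHom.id_apply, map_smul]
    simp only [Lp.toTemperedDistributionCLM_apply, (exists_laplacian _).choose_spec]
    simp only [← TemperedDistribution.laplacianCLM_apply, ← Lp.toTemperedDistributionCLM_apply,
      Submodule.coe_smul, map_smul]

theorem laplacianH2_spec {n : ℕ} (u : sobolevH2 n) :
    (laplacianH2 n u : 𝓢'(EuclideanSpace ℝ (Fin n), ℂ)) =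
      Δ ((u : ContinuousL2 n) : 𝓢'(EuclideanSpace ℝ (Fin n), ℂ)) :=
  (exists_laplacian u).choose_spec

theorem PeriodicPotential.memLp_top {n : ℕ} (V : PeriodicPotential n) (h : ℝ) :
    MemLp (fun x : EuclideanSpace ℝ (Fin n) => (V (h • x) : ℂ)) ∞ volume := by
  obtain ⟨C, -, hC⟩ := V.exists_bound
  refine memLp_top_of_bound ?_ C (Filter.Eventually.of_forall fun x => ?_)
  · have := V.smooth.continuous
    exact (Complex.continuous_ofReal.comp
      (this.comp (continuous_const_smul h))).aestronglyMeasurable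
  · rw [Complex.norm_real]
    exact hC _

/-- Multiplication by `x ↦ V (h x)` on `L²(ℝⁿ)`. -/
def potentialMul {n : ℕ} (V : PeriodicPotential n) (h : ℝ) :
    ContinuousL2 n →ₗ[ℂ] ContinuousL2 n where
  toFun u := (V.memLp_top h).toLp _ • u
  map_add' _ _ := Lp.add_smul _ _ _
  map_smul' c u := (Lp.smul_comm c _ u).symm

theorem potentialMul_coeFn {n : ℕ} (V : PeriodicPotential n) (h : ℝ) (u : ContinuousL2 n) :
    potentialMul V h u =ᵐ[volume] fun x => (V (h • x) : ℂ) * u x := by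
  filter_upwards [Lp.coeFn_lpSMul (r := 2) ((V.memLp_top h).toLp _) u,
    (V.memLp_top h).coeFn_toLp] with x hx hx2
  refine hx.trans ?_
  rw [Pi.smul_apply', hx2, smul_eq_mul]

/-- The continuous Schrödinger operator `P_c(h) u (x) = -Δ u (x) + V (h x) u (x)`, an unbounded
operator on `L²(ℝⁿ)` with domain `H²(ℝⁿ)`. -/
def continuousOp {n : ℕ} (V : PeriodicPotential n) (h : ℝ) :
    ContinuousL2 n →ₗ.[ℂ] ContinuousL2 n where
  domain := sobolevH2 n
  toFun := -laplacianH2 n + (potentialMul V h).comp (sobolevH2 n).subtype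

/-! ### Spectra -/

/-- The resolvent set of an unbounded operator `T`: those `z` for which `T - z` is a bijection of
the domain of `T` onto the whole space, with bounded inverse `R`. -/
def unboundedResolventSet {H : Type*} [NormedAddCommGroup H] [NormedSpace ℂ H]
    (T : H →ₗ.[ℂ] H) : Set ℂ :=
  {z | ∃ R : H →L[ℂ] H,
    (∀ u : T.domain, R (T u - z • (u : H)) = u) ∧
    (∀ f : H, ∃ hf : R f ∈ T.domain, T ⟨R f, hf⟩ - z • R f = f)}

/-- The spectrum of an unbounded operator. -/
def unboundedSpectrum {H : Type*} [NormedAddCommGroup H] [NormedSpace ℂ H]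
    (T : H →ₗ.[ℂ] H) : Set ℂ :=
  (unboundedResolventSet T)ᶜ

/-- `E = min S`, for a set `S` of complex numbers: `S` is contained in the real line, and `E` is
its smallest element. -/
def IsMinOfSpectrum (S : Set ℂ) (E : ℝ) : Prop :=
  (E : ℂ) ∈ S ∧ ∀ z ∈ S, z.im = 0 ∧ E ≤ z.re

end

/-! ### Bottom of the spectrum of bounded and unbounded self-adjoint operators -/

section AbstractSpectrum

variable {H : Type*} [NormedAddCommGroup H] [InnerProductSpace ℂ H]

/-! After subtracting min V from both operators one may take V ≥ 0 with a zero. The barrier is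
needed only to know that V is then not identically zero
(`IsLatticeFundamentalDomain.frontier_nonempty`). No harmonic approximation or tunnelling analysis
enters: the two ground state energies Ed and Ec are compared by turning almost eigenvectors of one
operator into trial functions for the other. Write K for the discrete or continuous kinetic operator
and W for multiplication by V(h·).

The bridge is band-limited interpolation, an isometry of ℓ²(ℤⁿ) onto the functions of L²(ℝⁿ) with
frequencies in the Brillouin zone. On the Fourier side K is multiplication by d(ξ) = ∑ (2 - 2 cos
2πξ_j), respectively k(ξ) = 4π²|ξ|². Everywhere d ≤ k, and k ≤ d + 7d² on the zone, so the kinetic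
energies differ by at most a multiple of ‖Kv‖². For the potential energy, V is expanded in its
Fourier series. Each mode translates frequencies by a multiple of h, and interpolation respects this
translation except for frequencies that wrap around the zone. This gives an error O(‖Kv‖² + h³‖v‖²)
(`exists_inner_potential_sub_le`).

It remains to bound ‖Ku‖² for a normalized almost eigenvector u of energy E. Since ‖(K + W)u‖ is
about E, this needs a lower bound for Re⟨Ku, Wu⟩. Writing K through second differences, the only
negative contribution comes from differences of V over small steps. A nonnegative smooth V satisfies
|∇V|² ≤ C V, so this contribution is at least -C h (E + h²)
(`exists_re_inner_discreteKinetic_discretePotential_ge`,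
`exists_re_inner_neg_laplacianH2_potentialMul_ge`). Hence ‖Ku‖² + ‖Wu‖² = O(E² + hE + h³).

Finally c h² ≤ Ec ≤ A h (`exists_sq_mul_norm_sq_le_energy`, `exists_energy_le`). The upper bound
turns E² into O(hE) and the lower bound turns h³ into O(hE), so |Ed - Ec| ≤ C h Ec
(`exists_abs_ground_energy_sub_le`). If min V = 0 this is the claim. Otherwise the original
denominator stays away from 0, and the difference is even O(h²). -/

/-- If `T` is symmetric and `T + c` has a bounded inverse and a nonnegative quadratic form, then
this inverse is positive. -/
theorem isPositive_inverse_of_symmetric {T : H →ₗ.[ℂ] H} {c : ℝ} {R : H →L[ℂ] H}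
    (hsymm : ∀ u w : T.domain, inner ℂ (T u) (w : H) = inner ℂ (u : H) (T w))
    (hpos : ∀ u : T.domain, 0 ≤ (inner ℂ (u : H) (T u)).re + c * ‖(u : H)‖ ^ 2)
    (hdom : ∀ f, R f ∈ T.domain) (hTR : ∀ f, T ⟨R f, hdom f⟩ + (c : ℂ) • R f = f) :
    R.IsPositive := by
  rw [ContinuousLinearMap.isPositive_def]
  constructor
  · intro f g
    change inner ℂ (R f) g = inner ℂ f (R g)
    conv_lhs => rw [← hTR g]
    conv_rhs => rw [← hTR f]
    have := hsymm ⟨R f, hdom f⟩ ⟨R g, hdom g⟩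
    rw [inner_add_left, inner_add_right, this, inner_smul_left, inner_smul_right,
      Complex.conj_ofReal]
  · intro f
    rw [ContinuousLinearMap.reApplyInnerSelf_apply]
    have h1 := hpos ⟨R f, hdom f⟩
    have h2 : RCLike.re (inner ℂ (R f) f) = (inner ℂ (R f) (T ⟨R f, hdom f⟩)).re
        + c * ‖R f‖ ^ 2 := by
      conv_lhs => rw [← hTR f]
      conv_lhs => rw [hTR f]
      conv_lhs => 
        arg 2
        arg 3
        rw [← hTR f]
      rw [inner_add_right, inner_smul_right, inner_self_eq_norm_sq_to_K]
      simp [← Complex.ofReal_pow]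
    rw [h2]
    exact h1

variable [CompleteSpace H]

/-- With B the square root of A, one has Au = B(Bu), ⟨u, Au⟩ = ‖Bu‖² and ‖A‖ = ‖B‖². This
Cauchy–Schwarz type inequality drives both the construction of almost eigenvectors and the form
bound for unbounded operators. -/
theorem norm_sq_apply_le_of_isPositive {A : H →L[ℂ] H} (hA : A.IsPositive) (u : H) :
    ‖A u‖ ^ 2 ≤ ‖A‖ * (inner ℂ u (A u)).re := by
  have h0 : (0 : H →L[ℂ] H) ≤ A := (ContinuousLinearMap.nonneg_iff_isPositive A).2 hA
  obtain ⟨B, hB, hBB⟩ : ∃ B : H →L[ℂ] H, IsSelfAdjoint B ∧ B * B = A :=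
    ⟨CFC.sqrt A, (CFC.sqrt_nonneg A).isSelfAdjoint, CFC.sqrt_mul_sqrt_self A h0⟩
  have h1 : ∀ x y, inner ℂ (B x) y = inner ℂ x (B y) := fun x y => hB.isSymmetric x y
  have h2 : (inner ℂ u (A u)).re = ‖B u‖ ^ 2 := by
    rw [← hBB, mul_apply_eq_comp, ← h1, inner_self_eq_norm_sq_to_K]
    norm_cast
  have h3 : ‖A‖ = ‖B‖ ^ 2 := by
    rw [← hBB, sq, ← CStarRing.norm_star_mul_self (x := B), hB.star_eq]
  rw [h2, h3, ← mul_pow]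
  have : A u = B (B u) := by rw [← hBB]; rfl
  rw [this]
  gcongr
  exact B.le_opNorm _

/-- A unit vector that nearly attains the operator norm works: by the preceding inequality, ‖Au -
‖A‖u‖² ≤ ‖A‖² - ‖Au‖². -/
theorem exists_almost_eigenvector_of_isPositive [Nontrivial H] {A : H →L[ℂ] H} (hA : A.IsPositive)
    {ε : ℝ} (hε : 0 < ε) : ∃ u : H, ‖u‖ = 1 ∧ ‖A u - (‖A‖ : ℂ) • u‖ ≤ ε := by
  obtain ⟨e, he⟩ := exists_ne (0 : H)
  set M := ‖A‖ with hM
  by_cases hM0 : M = 0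
  · refine ⟨((‖e‖⁻¹ : ℝ) : ℂ) • e, ?_, ?_⟩
    · rw [norm_smul, Complex.norm_real, norm_inv, norm_norm, inv_mul_cancel₀ (norm_ne_zero_iff.2 he)]
    · have : A = 0 := norm_eq_zero.1 (hM ▸ hM0)
      simp [hM0, this, hε.le]
  have hMpos : 0 < M := lt_of_le_of_ne (norm_nonneg _) (Ne.symm hM0)
  -- A level r below the norm, close enough that ‖Au‖ ≥ r makes M² - ‖Au‖² at most ε².
  obtain ⟨r, hr, hrM, hr0⟩ : ∃ r : ℝ, M ^ 2 - r ^ 2 ≤ ε ^ 2 ∧ r < M ∧ 0 ≤ r := by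
    refine ⟨max 0 (M - ε ^ 2 / (2 * M)), ?_, ?_, le_max_left _ _⟩
    · rcases le_total 0 (M - ε ^ 2 / (2 * M)) with h | h
      · rw [max_eq_right h]
        have : M * (ε ^ 2 / (2 * M)) = ε ^ 2 / 2 := by field_simp
        nlinarith [sq_nonneg (ε ^ 2 / (2 * M))]
      · rw [max_eq_left h]
        have : M * (ε ^ 2 / (2 * M)) = ε ^ 2 / 2 := by field_simp
        nlinarith [sq_nonneg ε]
    · exact max_lt hMpos (by have : 0 < ε ^ 2 / (2 * M) := by positivity
                             linarith)
  obtain ⟨x, hx⟩ : ∃ x : H, r * ‖x‖ < ‖A x‖ := by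
    by_contra! hcon
    exact absurd (A.opNorm_le_bound hr0 hcon) (not_le.2 hrM)
  have hx0 : x ≠ 0 := by
    rintro rfl
    simp at hx
  have hxn : 0 < ‖x‖ := norm_pos_iff.2 hx0
  set u : H := ((‖x‖⁻¹ : ℝ) : ℂ) • x with hu
  have hu1 : ‖u‖ = 1 := by
    rw [hu, norm_smul, Complex.norm_real, norm_inv, norm_norm, inv_mul_cancel₀ hxn.ne']
  have hru : r ≤ ‖A u‖ := by
    rw [hu, map_smul, norm_smul, Complex.norm_real, norm_inv, norm_norm, ← div_eq_inv_mul,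
      le_div_iff₀ hxn]
    exact hx.le
  refine ⟨u, hu1, ?_⟩
  refine le_of_sq_le_sq ?_ hε.le
  rw [@norm_sub_sq ℂ, inner_smul_right, norm_smul, Complex.norm_real, hu1, norm_norm]
  have h1 := norm_sq_apply_le_of_isPositive hA u
  have h2 : (inner ℂ u (A u)).re = (inner ℂ (A u) u).re := by
    rw [← inner_conj_symm, Complex.conj_re]
  have h3 : RCLike.re ((M : ℂ) * inner ℂ (A u) u) = M * (inner ℂ (A u) u).re := by
    simp
  rw [h3]
  nlinarith

open scoped ComplexOrder in
theorem mem_Icc_of_mem_spectrum_of_isPositive {A : H →L[ℂ] H} (hA : A.IsPositive)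
    {z : ℂ} (hz : z ∈ spectrum ℂ A) : z.im = 0 ∧ 0 ≤ z.re ∧ z.re ≤ ‖A‖ := by
  have h0 : (0 : H →L[ℂ] H) ≤ A := (ContinuousLinearMap.nonneg_iff_isPositive A).2 hA
  have h1 := spectrum_nonneg_of_nonneg h0 hz
  rw [Complex.le_def] at h1
  have h2 := spectrum.norm_le_norm_mul_of_mem hz
  have h3 : ‖(1 : H →L[ℂ] H)‖ ≤ 1 := ContinuousLinearMap.norm_id_le
  refine ⟨h1.2.symm, h1.1, (Complex.re_le_norm z).trans (h2.trans ?_)⟩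
  nlinarith [norm_nonneg A]

theorem norm_mem_spectrum_of_isPositive [Nontrivial H] {A : H →L[ℂ] H} (hA : A.IsPositive) :
    (‖A‖ : ℂ) ∈ spectrum ℂ A := by
  by_contra hcon
  rw [spectrum.notMem_iff] at hcon
  obtain ⟨S, hS⟩ := hcon.exists_left_inv
  have hpos : 0 < ‖S‖ + 1 := by positivity
  obtain ⟨u, hu1, hu⟩ := exists_almost_eigenvector_of_isPositive hA (ε := 1 / (2 * (‖S‖ + 1)))
    (by positivity)
  have h1 : S ((‖A‖ : ℂ) • u - A u) = u := by
    have := congrArg (fun T : H →L[ℂ] H => T u) hS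
    simpa [Algebra.algebraMap_eq_smul_one] using this
  have h2 := S.le_opNorm ((‖A‖ : ℂ) • u - A u)
  rw [h1, hu1, norm_sub_rev] at h2
  have h3 : ‖S‖ * ‖A u - (‖A‖ : ℂ) • u‖ ≤ (‖S‖ + 1) * (1 / (2 * (‖S‖ + 1))) := by
    gcongr
    linarith
  have h4 : (‖S‖ + 1) * (1 / (2 * (‖S‖ + 1))) = 1 / 2 := by field_simp
  linarith

/-- A bounded self-adjoint operator has a smallest spectral value; it is the infimum of the
quadratic form and admits almost eigenvectors. -/
theorem exists_isMinOfSpectrum_of_isSelfAdjoint [Nontrivial H] {P : H →L[ℂ] H}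
    (hP : IsSelfAdjoint P) : ∃ E : ℝ, IsMinOfSpectrum (spectrum ℂ P) E ∧
      (∀ u, E * ‖u‖ ^ 2 ≤ (inner ℂ u (P u)).re) ∧
      ∀ ε : ℝ, 0 < ε → ∃ u : H, ‖u‖ = 1 ∧ ‖P u - (E : ℂ) • u‖ ≤ ε := by
  -- Reflection makes the bottom of P the top of a positive operator, where the norm is a spectral
  -- value; the minimum is therefore ‖P‖ - ‖A‖.
  set A : H →L[ℂ] H := ((‖P‖ : ℝ) : ℂ) • 1 - P with hAdef
  have hform : ∀ u, (inner ℂ u (A u)).re = ‖P‖ * ‖u‖ ^ 2 - (inner ℂ u (P u)).re := by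
    intro u
    have : A u = ((‖P‖ : ℝ) : ℂ) • u - P u := rfl
    rw [this, inner_sub_right, inner_smul_right, inner_self_eq_norm_sq_to_K]
    simp [← Complex.ofReal_pow]
  have hA : A.IsPositive := by
    rw [ContinuousLinearMap.isPositive_def']
    constructor
    · refine IsSelfAdjoint.sub (IsSelfAdjoint.smul ?_ (.one _)) hP
      simp [IsSelfAdjoint]
    · intro u
      rw [ContinuousLinearMap.reApplyInnerSelf_apply, ← inner_conj_symm]
      have h1 : (inner ℂ u (P u)).re ≤ ‖P‖ * ‖u‖ ^ 2 := by
        calc _ ≤ ‖inner ℂ u (P u)‖ := Complex.re_le_norm _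
          _ ≤ ‖u‖ * ‖P u‖ := norm_inner_le_norm _ _
          _ ≤ ‖u‖ * (‖P‖ * ‖u‖) := by gcongr; exact P.le_opNorm u
          _ = _ := by ring
      have := hform u
      simp only [RCLike.conj_re]
      change 0 ≤ (inner ℂ u (A u)).re
      linarith
  have hspec : ∀ z : ℂ, z ∈ spectrum ℂ P ↔ ((‖P‖ : ℝ) : ℂ) - z ∈ spectrum ℂ A := by
    intro z
    rw [spectrum.mem_iff, spectrum.mem_iff, ← IsUnit.neg_iff]
    have : -(algebraMap ℂ (H →L[ℂ] H) z - P)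
        = algebraMap ℂ (H →L[ℂ] H) (((‖P‖ : ℝ) : ℂ) - z) - A := by
      rw [hAdef, Algebra.algebraMap_eq_smul_one, Algebra.algebraMap_eq_smul_one, sub_smul]
      abel
    rw [this]
  refine ⟨‖P‖ - ‖A‖, ⟨?_, ?_⟩, ?_, ?_⟩
  · rw [hspec]
    have := norm_mem_spectrum_of_isPositive hA
    simpa using this
  · intro z hz
    obtain ⟨h1, -, h3⟩ := mem_Icc_of_mem_spectrum_of_isPositive hA ((hspec z).1 hz)
    simp only [Complex.sub_im, Complex.ofReal_im, zero_sub, neg_eq_zero, Complex.sub_re,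
      Complex.ofReal_re] at h1 h3
    exact ⟨h1, by linarith⟩
  · intro u
    have h1 : (inner ℂ u (A u)).re ≤ ‖A‖ * ‖u‖ ^ 2 := by
        calc _ ≤ ‖inner ℂ u (A u)‖ := Complex.re_le_norm _
          _ ≤ ‖u‖ * ‖A u‖ := norm_inner_le_norm _ _
          _ ≤ ‖u‖ * (‖A‖ * ‖u‖) := by gcongr; exact A.le_opNorm u
          _ = _ := by ring
    have := hform u
    linarith
  · intro ε hε
    obtain ⟨u, hu1, hu⟩ := exists_almost_eigenvector_of_isPositive hA hε
    refine ⟨u, hu1, ?_⟩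
    have h1 : A u = ((‖P‖ : ℝ) : ℂ) • u - P u := rfl
    have h2 : P u - ((‖P‖ - ‖A‖ : ℝ) : ℂ) • u = -(A u - (‖A‖ : ℂ) • u) := by
      rw [h1, Complex.ofReal_sub, sub_smul]
      abel
    rw [h2, norm_neg]
    exact hu

/-- The same for an unbounded operator `T`, if `T + c` has a positive bounded inverse `R`. -/
theorem exists_isMinOfSpectrum_of_isPositive_inverse [Nontrivial H] {T : H →ₗ.[ℂ] H} {c : ℝ}
    {R : H →L[ℂ] H} (hR : R.IsPositive) (hR0 : ∀ u : T.domain, R (T u + (c : ℂ) • (u : H)) = u)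
    (hdom : ∀ f, R f ∈ T.domain) (hTR : ∀ f, T ⟨R f, hdom f⟩ + (c : ℂ) • R f = f) :
    ∃ E : ℝ, IsMinOfSpectrum (unboundedSpectrum T) E ∧
      (∀ u : T.domain, E * ‖(u : H)‖ ^ 2 ≤ (inner ℂ (u : H) (T u)).re) ∧
      ∀ ε : ℝ, 0 < ε → ∃ u : T.domain, ‖(u : H)‖ = 1 ∧ ‖T u - (E : ℂ) • (u : H)‖ ≤ ε := by
  have hRinj : ∀ f, R f = 0 → f = 0 := by
    intro f hf
    have h1 := hTR f
    have h2 : (⟨R f, hdom f⟩ : T.domain) = 0 := Subtype.ext hf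
    rw [h2, hf] at h1
    simpa using h1.symm
  set M := ‖R‖ with hM
  have hMpos : 0 < M := by
    refine lt_of_le_of_ne (norm_nonneg _) fun h0 => ?_
    obtain ⟨e, he⟩ := exists_ne (0 : H)
    have : R = 0 := norm_eq_zero.1 (by rw [← hM, ← h0])
    exact he (hRinj e (by simp [this]))
  have hMC : (M : ℂ) ≠ 0 := Complex.ofReal_ne_zero.2 hMpos.ne'
  have happrox : ∀ ε : ℝ, 0 < ε → ∃ u : T.domain, ‖(u : H)‖ = 1 ∧
      ‖T u - ((M⁻¹ - c : ℝ) : ℂ) • (u : H)‖ ≤ ε := by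
    intro ε hε
    -- The first tolerance keeps ‖R f‖ ≥ M / 2, so that R f can be normalized. The second is what
    -- remains of ε after dividing by M and by ‖R f‖.
    obtain ⟨f, hf1, hf⟩ := exists_almost_eigenvector_of_isPositive hR
      (ε := min (M / 2) (ε * M ^ 2 / 2)) (by positivity)
    rw [← hM] at hf
    have hnorm : M / 2 ≤ ‖R f‖ := by
      have h1 : ‖(M : ℂ) • f‖ ≤ ‖R f‖ + ‖R f - (M : ℂ) • f‖ := by
        rw [norm_sub_rev]
        exact norm_le_norm_add_norm_sub' _ _
      rw [norm_smul, Complex.norm_real, Real.norm_of_nonneg hMpos.le, hf1] at h1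
      have := hf.trans (min_le_left _ _)
      linarith
    have hpos : 0 < ‖R f‖ := by linarith [half_pos hMpos]
    refine ⟨((‖R f‖⁻¹ : ℝ) : ℂ) • ⟨R f, hdom f⟩, ?_, ?_⟩
    · rw [Submodule.coe_smul, norm_smul, Complex.norm_real, norm_inv, norm_norm,
        inv_mul_cancel₀ hpos.ne']
    · rw [LinearPMap.map_smul, Submodule.coe_smul, smul_comm, ← smul_sub, norm_smul,
        Complex.norm_real, norm_inv, norm_norm]
      have h1 : T ⟨R f, hdom f⟩ - ((M⁻¹ - c : ℝ) : ℂ) • R f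
          = -((M : ℂ)⁻¹ • (R f - (M : ℂ) • f)) := by
        have h2 : T ⟨R f, hdom f⟩ = f - (c : ℂ) • R f := eq_sub_of_add_eq (hTR f)
        rw [h2, smul_sub, smul_smul, inv_mul_cancel₀ hMC, one_smul]
        push_cast
        rw [sub_smul]
        abel
      change ‖R f‖⁻¹ * ‖T ⟨R f, hdom f⟩ - ((M⁻¹ - c : ℝ) : ℂ) • R f‖ ≤ ε
      rw [h1, norm_neg, norm_smul, norm_inv, Complex.norm_real, Real.norm_of_nonneg hMpos.le]
      calc ‖R f‖⁻¹ * (M⁻¹ * ‖R f - (M : ℂ) • f‖) ≤ (M / 2)⁻¹ * (M⁻¹ * (ε * M ^ 2 / 2)) := by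
            gcongr
            exact hf.trans (min_le_right _ _)
        _ = ε := by field_simp
  refine ⟨M⁻¹ - c, ⟨?_, ?_⟩, ?_, happrox⟩
  · rintro ⟨S, hS1, -⟩
    obtain ⟨u, hu1, hu⟩ := happrox (1 / (2 * (‖S‖ + 1))) (by positivity)
    have h2 := S.le_opNorm (T u - ((M⁻¹ - c : ℝ) : ℂ) • (u : H))
    rw [hS1, hu1] at h2
    have h3 : ‖S‖ * ‖T u - ((M⁻¹ - c : ℝ) : ℂ) • (u : H)‖
        ≤ (‖S‖ + 1) * (1 / (2 * (‖S‖ + 1))) := by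
      gcongr
      linarith
    have h4 : (‖S‖ + 1) * (1 / (2 * (‖S‖ + 1))) = 1 / 2 := by field_simp
    linarith
  · intro z hz
    by_contra hcon
    apply hz
    by_cases hzc : z + c = 0
    · have hzc' : z = -(c : ℂ) := eq_neg_of_add_eq_zero_left hzc
      refine ⟨R, fun u => ?_, fun f => ⟨hdom f, ?_⟩⟩
      · rw [hzc', neg_smul, sub_neg_eq_add, hR0]
      · rw [hzc', neg_smul, sub_neg_eq_add, hTR]
    -- Since T - z = (z + c)(w - R)(T + c) on the domain, the resolvent at z is w R (w - R)⁻¹ as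
    -- soon as w is not in the spectrum of R. That spectrum lies in [0, M], so w could only be a
    -- spectral value if z were real with z ≥ M⁻¹ - c.
    set w : ℂ := (z + c)⁻¹ with hw
    have hw0 : w ≠ 0 := inv_ne_zero hzc
    have hwspec : w ∉ spectrum ℂ R := by
      intro hmem
      obtain ⟨h1, h2, h3⟩ := mem_Icc_of_mem_spectrum_of_isPositive hR hmem
      have hwre : w = (w.re : ℂ) := by
        apply Complex.ext <;> simp [h1]
      have hwpos : 0 < w.re := by
        refine lt_of_le_of_ne h2 fun h => hw0 ?_
        rw [hwre, ← h, Complex.ofReal_zero]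
      have hzeq : z = ((w.re⁻¹ - c : ℝ) : ℂ) := by
        push_cast
        rw [← hwre, hw, inv_inv]
        ring
      apply hcon
      rw [hzeq]
      refine ⟨Complex.ofReal_im _, ?_⟩
      rw [Complex.ofReal_re]
      have := inv_anti₀ hwpos h3
      linarith
    rw [spectrum.notMem_iff] at hwspec
    obtain ⟨B, hB1⟩ := hwspec.exists_left_inv
    obtain ⟨B', hB2⟩ := hwspec.exists_right_inv
    have hBB : B = B' := left_inv_eq_right_inv hB1 hB2
    rw [← hBB] at hB2
    have hB1' : ∀ f, B (w • f - R f) = f := by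
      intro f
      have := congrArg (fun T : H →L[ℂ] H => T f) hB1
      simpa [Algebra.algebraMap_eq_smul_one] using this
    have hB2' : ∀ f, w • B f - R (B f) = f := by
      intro f
      have := congrArg (fun T : H →L[ℂ] H => T f) hB2
      simpa [Algebra.algebraMap_eq_smul_one] using this
    have hcomm : ∀ f, R (B f) = B (R f) := by
      intro f
      have h1 := hB1' (B f)
      have h2 := congrArg B (hB2' f)
      rw [map_sub, map_smul] at h1 h2
      have h3 := hB1' f
      rw [map_sub, map_smul] at h3
      have h4 := hB2' f
      have : w • B f - B (R f) = w • B f - R (B f) := h3.trans h4.symm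
      exact (sub_right_injective this).symm
    refine ⟨w • (R * B), fun u => ?_, fun f => ⟨?_, ?_⟩⟩
    · set g := T u + (c : ℂ) • (u : H) with hg
      have hgu : R g = u := hR0 u
      have h1 : T u - z • (u : H) = (z + c) • (w • g - R g) := by
        rw [smul_sub, smul_smul, hw, mul_inv_cancel₀ hzc, one_smul, hgu, hg, add_smul]
        abel
      change w • R (B (T u - z • (u : H))) = u
      rw [h1, map_smul, hB1', map_smul, hgu, smul_smul, hw, inv_mul_cancel₀ hzc, one_smul]
    · exact T.domain.smul_mem _ (hdom _)
    · have h1 : T ⟨w • R (B f), T.domain.smul_mem _ (hdom _)⟩ = w • T ⟨R (B f), hdom _⟩ :=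
        T.map_smul w ⟨R (B f), hdom _⟩
      change T ⟨w • R (B f), T.domain.smul_mem _ (hdom _)⟩ - z • w • R (B f) = f
      have h2 : T ⟨R (B f), hdom _⟩ = B f - (c : ℂ) • R (B f) := eq_sub_of_add_eq (hTR (B f))
      rw [h1, h2, smul_comm z w, ← smul_sub, sub_sub, ← add_smul, add_comm (c : ℂ), smul_sub,
        smul_smul, hw, inv_mul_cancel₀ hzc, one_smul]
      exact hB2' f
  · intro u
    set g := T u + (c : ℂ) • (u : H) with hg
    have hgu : R g = u := hR0 u
    have h1 := norm_sq_apply_le_of_isPositive hR g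
    rw [hgu] at h1
    have h2 : (inner ℂ g (u : H)).re = (inner ℂ (u : H) (T u)).re + c * ‖(u : H)‖ ^ 2 := by
      rw [← inner_conj_symm, Complex.conj_re, hg, inner_add_right, inner_smul_right,
        inner_self_eq_norm_sq_to_K]
      simp [← Complex.ofReal_pow]
    rw [h2, ← hM] at h1
    have h3 : M⁻¹ * ‖(u : H)‖ ^ 2 ≤ (inner ℂ (u : H) (T u)).re + c * ‖(u : H)‖ ^ 2 := by
      rw [inv_mul_le_iff₀ hMpos]
      exact h1
    linarith

end AbstractSpectrum

/-! ### Quantitative smoothness of periodic potentials -/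

section PeriodicFunctions

/-- `ℝⁿ` with its Euclidean structure. -/
abbrev Space (n : ℕ) : Type := EuclideanSpace ℝ (Fin n)

variable {n : ℕ}

theorem exists_norm_le_of_periodic {F : Type*} [NormedAddCommGroup F] {f : Space n → F}
    (hf : Continuous f) (hper : ∀ x (γ : Fin n → ℤ), f (x + latticePt γ) = f x) :
    ∃ C : ℝ, 0 ≤ C ∧ ∀ x, ‖f x‖ ≤ C := by
  obtain ⟨C, hC⟩ := (isCompact_closedBall (0 : Space n) (Real.sqrt n)
    ).exists_bound_of_continuousOn (f := f) hf.continuousOn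
  refine ⟨C, (norm_nonneg _).trans (hC 0 (by simp)), fun x => ?_⟩
  rw [← hper x (fun i => -⌊x i⌋)]
  refine hC _ ?_
  rw [mem_closedBall_zero_iff, EuclideanSpace.norm_eq]
  refine Real.sqrt_le_sqrt ?_
  calc ∑ i, ‖(x + latticePt (fun i => -⌊x i⌋)) i‖ ^ 2 ≤ ∑ _i : Fin n, (1 : ℝ) := by
        refine Finset.sum_le_sum fun i _ => ?_
        have : (x + latticePt (fun i => -⌊x i⌋)) i = Int.fract (x i) := by
          simp [latticePt, Int.fract, sub_eq_add_neg]
        rw [this, Real.norm_eq_abs, sq_abs]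
        nlinarith [Int.fract_nonneg (x i), (Int.fract_lt_one (x i)).le]
    _ = n := by simp

namespace PeriodicPotential

theorem fderiv_periodic (V : PeriodicPotential n) (x : Space n) (γ : Fin n → ℤ) :
    fderiv ℝ V (x + latticePt γ) = fderiv ℝ V x := by
  rw [← fderiv_comp_add_right]
  congr 1
  ext y
  exact V.periodic y γ

theorem contDiff_fderiv (V : PeriodicPotential n) : ContDiff ℝ ∞ (fderiv ℝ V) :=
  V.smooth.fderiv_right (by simp)

/-- The partial derivative of a periodic potential in the coordinate direction `i`. -/
noncomputable def partialDeriv (V : PeriodicPotential n) (i : Fin n) : PeriodicPotential n where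
  toFun x := fderiv ℝ V x (EuclideanSpace.single i 1)
  smooth := V.contDiff_fderiv.clm_apply contDiff_const
  periodic x γ := by rw [fderiv_periodic]

/-- Subtraction of a constant from a periodic potential. -/
noncomputable def subConst (V : PeriodicPotential n) (a : ℝ) : PeriodicPotential n where
  toFun x := V x - a
  smooth := V.smooth.sub contDiff_const
  periodic x γ := by rw [V.periodic]

theorem subConst_apply (V : PeriodicPotential n) (a : ℝ) (x : Space n) :
    V.subConst a x = V x - a := rfl

theorem exists_taylor_bound (V : PeriodicPotential n) :
    ∃ M : ℝ, 0 < M ∧ ∀ x y, |V (x + y) - V x - fderiv ℝ V x y| ≤ M * ‖y‖ ^ 2 := by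
  obtain ⟨M, hM0, hM⟩ := exists_norm_le_of_periodic (f := fderiv ℝ (fderiv ℝ V))
    (V.contDiff_fderiv.continuous_fderiv (by simp)) (fun x γ => by
      rw [← fderiv_comp_add_right]
      congr 1
      ext1 y
      exact V.fderiv_periodic y γ)
  refine ⟨M + 1, by positivity, fun x y => ?_⟩
  have hlip : ∀ z, ‖fderiv ℝ V z - fderiv ℝ V x‖ ≤ M * ‖z - x‖ := fun z =>
    convex_univ.norm_image_sub_le_of_norm_fderiv_le (𝕜 := ℝ) (f := fderiv ℝ V)
      (fun w _ => (V.contDiff_fderiv.differentiable (by simp)) w) (fun w _ => hM w)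
      (mem_univ x) (mem_univ z)
  have h1 : ‖V (x + y) - V x - fderiv ℝ V x ((x + y) - x)‖ ≤ M * ‖y‖ * ‖(x + y) - x‖ := by
    refine (convex_segment x (x + y)).norm_image_sub_le_of_norm_fderiv_le' (𝕜 := ℝ) (f := V)
      (fun w _ => (V.smooth.differentiable (by simp)) w) (fun w hw => ?_)
      (left_mem_segment ℝ _ _) (right_mem_segment ℝ _ _)
    refine (hlip w).trans ?_
    gcongr
    rw [segment_eq_image'] at hw
    obtain ⟨t, ht, rfl⟩ := hw
    simp only [add_sub_cancel_left]
    rw [norm_smul, Real.norm_of_nonneg ht.1]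
    exact mul_le_of_le_one_left (norm_nonneg _) ht.2
  rw [add_sub_cancel_left, Real.norm_eq_abs] at h1
  nlinarith [norm_nonneg y, sq_nonneg ‖y‖]

/-- By Taylor's bound, V ≥ 0 along the line x + t y makes a quadratic polynomial in t nonnegative,
so its discriminant is at most 0. This is the inequality |∇V|² ≤ C V for nonnegative functions, the
source of the good commutator bounds. -/
theorem fderiv_sq_le_of_nonneg {V : PeriodicPotential n} (hV : ∀ x, 0 ≤ V x) {M : ℝ}
    (hM : ∀ x y, |V (x + y) - V x - fderiv ℝ V x y| ≤ M * ‖y‖ ^ 2) (x y : Space n) :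
    (fderiv ℝ V x y) ^ 2 ≤ 4 * M * ‖y‖ ^ 2 * V x := by
  have h : ∀ t : ℝ, 0 ≤ (M * ‖y‖ ^ 2) * (t * t) + fderiv ℝ V x y * t + V x := by
    intro t
    have h1 := (abs_le.1 (hM x (t • y))).2
    rw [map_smul, smul_eq_mul, norm_smul, mul_pow, Real.norm_eq_abs, sq_abs] at h1
    have := hV (x + t • y)
    nlinarith
  have := discrim_le_zero h
  rw [discrim] at this
  nlinarith

/-- A nonnegative potential varies slowly where it is small. -/
theorem exists_sub_sq_le_of_nonneg {V : PeriodicPotential n} (hV : ∀ x, 0 ≤ V x) :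
    ∃ C : ℝ, 0 < C ∧ ∀ x y, (V (x + y) - V x) ^ 2 ≤ C * (‖y‖ ^ 2 * V x + ‖y‖ ^ 4) := by
  obtain ⟨M, hM0, hM⟩ := V.exists_taylor_bound
  refine ⟨8 * M + 2 * M ^ 2, by positivity, fun x y => ?_⟩
  have h1 := fderiv_sq_le_of_nonneg hV hM x y
  have h2 := hM x y
  have h3 : (V (x + y) - V x - fderiv ℝ V x y) ^ 2 ≤ (M * ‖y‖ ^ 2) ^ 2 := by
    rw [← sq_abs]
    gcongr
  have h4 : 0 ≤ M ^ 2 * (‖y‖ ^ 2 * V x) := by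
    have := hV x
    positivity
  have h5 : 0 ≤ M * ‖y‖ ^ 4 := by positivity
  nlinarith [sq_nonneg (V (x + y) - V x - 2 * fderiv ℝ V x y)]

theorem exists_le_norm_sq_of_zero {V : PeriodicPotential n} (hV : ∀ x, 0 ≤ V x) {x₀ : Space n}
    (hx₀ : V x₀ = 0) : ∃ M : ℝ, 0 < M ∧ ∀ x, V x ≤ M * ‖x - x₀‖ ^ 2 := by
  obtain ⟨M, hM0, hM⟩ := V.exists_taylor_bound
  refine ⟨M, hM0, fun x => ?_⟩
  have h1 := fderiv_sq_le_of_nonneg hV hM x₀ (x - x₀)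
  have h2 := hM x₀ (x - x₀)
  rw [hx₀, mul_zero] at h1
  have h3 : fderiv ℝ V x₀ (x - x₀) = 0 := by nlinarith
  rw [add_sub_cancel, hx₀, h3, sub_zero, sub_zero] at h2
  exact (le_abs_self _).trans h2

theorem exists_isMinOn (V : PeriodicPotential n) : ∃ x₀, ∀ x, V x₀ ≤ V x := by
  obtain ⟨x₀, -, hx₀⟩ := (isCompact_closedBall (0 : Space n) (Real.sqrt n)).exists_isMinOn
    ⟨0, by simp⟩ V.smooth.continuous.continuousOn
  refine ⟨x₀, fun x => ?_⟩
  rw [← V.periodic x (fun i => -⌊x i⌋)]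
  refine hx₀ ?_
  rw [mem_closedBall_zero_iff, EuclideanSpace.norm_eq]
  refine Real.sqrt_le_sqrt ?_
  calc ∑ i, ‖(x + latticePt (fun i => -⌊x i⌋)) i‖ ^ 2 ≤ ∑ _i : Fin n, (1 : ℝ) := by
        refine Finset.sum_le_sum fun i _ => ?_
        have : (x + latticePt (fun i => -⌊x i⌋)) i = Int.fract (x i) := by
          simp [latticePt, Int.fract, sub_eq_add_neg]
        rw [this, Real.norm_eq_abs, sq_abs]
        nlinarith [Int.fract_nonneg (x i), (Int.fract_lt_one (x i)).le]
    _ = n := by simp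

end PeriodicPotential

end PeriodicFunctions

/-! ### Plane waves and Fourier series -/

/-- The plane wave `x ↦ exp (2 π i b·x)`. -/
noncomputable def planeWave {n : ℕ} (b x : Space n) : ℂ := (Real.fourierChar (inner ℝ b x) : ℂ)

section PlaneWave

variable {n : ℕ}

theorem norm_planeWave (b x : Space n) : ‖planeWave b x‖ = 1 := Circle.norm_coe _

theorem planeWave_comm (b x : Space n) : planeWave b x = planeWave x b := by
  rw [planeWave, planeWave, real_inner_comm]

theorem planeWave_eq_exp (b x : Space n) :
    planeWave b x = Complex.exp ((2 * Real.pi * inner ℝ b x : ℝ) * Complex.I) :=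
  Real.fourierChar_apply _

theorem planeWave_add (b x y : Space n) :
    planeWave b (x + y) = planeWave b x * planeWave b y := by
  rw [planeWave, inner_add_right, AddChar.map_add_eq_mul, Circle.coe_mul]
  rfl

theorem planeWave_neg (b x : Space n) : planeWave b (-x) = starRingEnd ℂ (planeWave b x) := by
  rw [planeWave, inner_neg_right, AddChar.map_neg_eq_inv, Circle.coe_inv_eq_conj]
  rfl

theorem planeWave_smul_right (b x : Space n) (h : ℝ) :
    planeWave b (h • x) = planeWave (h • b) x := by
  rw [planeWave, planeWave, inner_smul_right, real_inner_smul_left]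

theorem continuous_planeWave (b : Space n) : Continuous (planeWave b) := by
  have : planeWave b = fun x => Complex.exp ((2 * Real.pi * inner ℝ b x : ℝ) * Complex.I) :=
    funext (planeWave_eq_exp b)
  rw [this]
  fun_prop

theorem norm_one_sub_planeWave_sq (b x : Space n) :
    ‖1 - planeWave b x‖ ^ 2 = 2 - 2 * Real.cos (2 * Real.pi * inner ℝ b x) := by
  rw [planeWave_eq_exp, Complex.exp_mul_I, ← Complex.normSq_eq_norm_sq, Complex.normSq_apply,
    ← Complex.ofReal_cos, ← Complex.ofReal_sin]
  simp only [Complex.sub_re, Complex.one_re, Complex.add_re, Complex.ofReal_re, Complex.mul_re,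
    Complex.I_re, mul_zero, Complex.ofReal_im, Complex.I_im, mul_one, sub_self, add_zero,
    Complex.sub_im, Complex.one_im, Complex.add_im, Complex.mul_im, zero_add, zero_sub]
  nlinarith [Real.sin_sq_add_cos_sq (2 * Real.pi * inner ℝ b x)]

end PlaneWave

/-! ### Fourier coefficients on the torus and their rapid decay -/

section FourierSeries

/-- The circle with its Haar probability measure. -/
noncomputable abbrev circleMeasureSpace : MeasureSpace UnitAddCircle := ⟨AddCircle.haarAddCircle⟩

attribute [local instance] circleMeasureSpace

theorem circle_isAddHaarMeasure : Measure.IsAddHaarMeasure (volume : Measure UnitAddCircle) :=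
  inferInstanceAs (Measure.IsAddHaarMeasure AddCircle.haarAddCircle)

theorem circle_isProbabilityMeasure : IsProbabilityMeasure (volume : Measure UnitAddCircle) :=
  inferInstanceAs (IsProbabilityMeasure AddCircle.haarAddCircle)

attribute [local instance] circle_isAddHaarMeasure circle_isProbabilityMeasure

variable {n : ℕ}

/-- The projection of `ℝⁿ` to the torus. -/
noncomputable def torusMk (x : Space n) : UnitAddTorus (Fin n) := fun i => (x i : UnitAddCircle)

/-- The representative in `(-1/2, 1/2]ⁿ` of a point of the torus. -/
noncomputable def torusRep (t : UnitAddTorus (Fin n)) : Space n :=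
  WithLp.toLp 2 fun i => ((AddCircle.equivIoc 1 (-1 / 2) (t i) : ℝ))

theorem torusMk_torusRep (t : UnitAddTorus (Fin n)) : torusMk (torusRep t) = t := by
  ext i
  exact AddCircle.coe_equivIoc

theorem torusMk_add (x y : Space n) : torusMk (x + y) = torusMk x + torusMk y := rfl

theorem exists_eq_add_latticePt_of_torusMk_eq {x y : Space n} (h : torusMk x = torusMk y) :
    ∃ γ : Fin n → ℤ, y = x + latticePt γ := by
  have : ∀ i, ∃ m : ℤ, m • (1 : ℝ) = y i - x i := by
    intro i
    rw [← AddCircle.coe_eq_zero_iff, AddCircle.coe_sub, sub_eq_zero]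
    exact (congrFun h i).symm
  choose γ hγ using this
  refine ⟨γ, ?_⟩
  ext i
  have := hγ i
  simp only [zsmul_eq_mul, mul_one] at this
  simp [latticePt, this]

theorem continuous_torusMk : Continuous (torusMk (n := n)) := by
  unfold torusMk
  refine continuous_pi fun i => ?_
  exact (AddCircle.continuous_mk' 1).comp (by fun_prop)

theorem isQuotientMap_torusMk : Topology.IsQuotientMap (torusMk (n := n)) := by
  have h1 : IsOpenQuotientMap (Pi.map fun _ : Fin n => ((↑) : ℝ → UnitAddCircle)) :=
    IsOpenQuotientMap.piMap fun _ => QuotientAddGroup.isOpenQuotientMap_mk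
  exact h1.isQuotientMap.comp (EuclideanSpace.equiv (Fin n) ℝ).toHomeomorph.isQuotientMap

theorem mFourier_torusMk (k : Fin n → ℤ) (x : Space n) :
    UnitAddTorus.mFourier k (torusMk x) = planeWave (latticePt k) x := by
  rw [planeWave_eq_exp]
  change ∏ i, fourier (k i) ((x i : ℝ) : UnitAddCircle) = _
  simp_rw [fourier_coe_apply]
  rw [← Complex.exp_sum]
  congr 1
  simp only [PiLp.inner_apply, latticePt]
  push_cast
  rw [Finset.mul_sum, Finset.sum_mul]
  refine Finset.sum_congr rfl fun i _ => ?_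
  simp
  ring

namespace PeriodicPotential

variable (V : PeriodicPotential n)

/-- A periodic potential as a function on the torus. -/
noncomputable def torusLift : C(UnitAddTorus (Fin n), ℂ) where
  toFun t := (V (torusRep t) : ℂ)
  continuous_toFun := by
    rw [isQuotientMap_torusMk.continuous_iff]
    have : (fun t => (V (torusRep t) : ℂ)) ∘ torusMk = fun x => (V x : ℂ) := by
      ext x
      obtain ⟨γ, hγ⟩ := exists_eq_add_latticePt_of_torusMk_eq (torusMk_torusRep (torusMk x)).symm
      simp only [Function.comp_apply]
      rw [hγ, V.periodic]
    rw [this]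
    exact Complex.continuous_ofReal.comp V.smooth.continuous

theorem torusLift_torusMk (x : Space n) : V.torusLift (torusMk x) = V x := by
  obtain ⟨γ, hγ⟩ := exists_eq_add_latticePt_of_torusMk_eq (torusMk_torusRep (torusMk x)).symm
  change ((V (torusRep (torusMk x)) : ℝ) : ℂ) = _
  rw [hγ, V.periodic]

/-- The k-th coefficient of the translate of V by s e_i is differentiated at s = 0 in two ways:
under the integral sign, and after a translation-invariant change of variables that leaves only the
factor exp(2πi k_i s). This replaces integration by parts on the torus. -/
theorem mFourierCoeff_partialDeriv (i : Fin n) (k : Fin n → ℤ) :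
    UnitAddTorus.mFourierCoeff (V.partialDeriv i).torusLift k =
      (2 * Real.pi * Complex.I * k i) * UnitAddTorus.mFourierCoeff V.torusLift k := by
  set e : Space n := EuclideanSpace.single i 1 with he
  obtain ⟨C, hC0, hC⟩ := (V.partialDeriv i).exists_bound
  have htrans : ∀ (W : PeriodicPotential n) (s : ℝ) t,
      W.torusLift (t + torusMk (s • e)) = (W (torusRep t + s • e) : ℂ) := by
    intro W s t
    rw [← torusLift_torusMk, torusMk_add, torusMk_torusRep]
  have hmem : ∀ (W : PeriodicPotential n) (s : ℝ), Continuous fun t =>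
      UnitAddTorus.mFourier (-k) t • W.torusLift (t + torusMk (s • e)) := by
    intro W s
    fun_prop
  have hd := hasDerivAt_integral_of_dominated_loc_of_deriv_le (𝕜 := ℝ) (x₀ := 0) (s := univ)
    (μ := (volume : Measure (UnitAddTorus (Fin n))))
    (F := fun s t => UnitAddTorus.mFourier (-k) t • V.torusLift (t + torusMk (s • e)))
    (F' := fun s t => UnitAddTorus.mFourier (-k) t •
      (V.partialDeriv i).torusLift (t + torusMk (s • e)))
    (bound := fun _ => C) Filter.univ_mem
    (Filter.Eventually.of_forall fun s => (hmem V s).aestronglyMeasurable)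
    ((hmem V 0).integrable_of_hasCompactSupport (HasCompactSupport.of_compactSpace _))
    (hmem (V.partialDeriv i) 0).aestronglyMeasurable
    (Filter.Eventually.of_forall fun t s _ => by
      rw [norm_smul, htrans, Complex.norm_real]
      have h1 : ‖UnitAddTorus.mFourier (-k) t‖ ≤ 1 :=
        (ContinuousMap.norm_coe_le_norm _ _).trans UnitAddTorus.mFourier_norm.le
      calc _ ≤ 1 * C := mul_le_mul h1 (hC _) (abs_nonneg _) zero_le_one
        _ = C := one_mul C)
    (integrable_const C)
    (Filter.Eventually.of_forall fun t s _ => by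
      simp only [htrans]
      have h1 : HasDerivAt (fun s : ℝ => torusRep t + s • e) e s := by
        simpa using ((hasDerivAt_id s).smul_const e).const_add (torusRep t)
      have h2 := ((V.smooth.differentiable (by simp)) (torusRep t + s • e)).hasFDerivAt
      exact (h2.comp_hasDerivAt s h1).ofReal_comp.const_mul (UnitAddTorus.mFourier (-k) t))
  have hshift : ∀ s : ℝ, ∫ t, UnitAddTorus.mFourier (-k) t • V.torusLift (t + torusMk (s • e)) =
      Complex.exp ((2 * Real.pi * Complex.I * k i) * s) *
        UnitAddTorus.mFourierCoeff V.torusLift k := by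
    intro s
    rw [UnitAddTorus.mFourierCoeff, ← integral_const_mul]
    refine Eq.trans ?_ (integral_add_right_eq_self (fun t =>
      Complex.exp ((2 * Real.pi * Complex.I * k i) * s) *
        (UnitAddTorus.mFourier (-k) t • V.torusLift t)) (torusMk (s • e)))
    refine integral_congr_ae (Filter.Eventually.of_forall fun t => ?_)
    have h1 : UnitAddTorus.mFourier (-k) (t + torusMk (s • e)) =
        UnitAddTorus.mFourier (-k) t * Complex.exp (-((2 * Real.pi * Complex.I * k i) * s)) := by
      conv_lhs => rw [← torusMk_torusRep t, ← torusMk_add]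
      rw [mFourier_torusMk, planeWave_add, ← mFourier_torusMk, torusMk_torusRep, planeWave_eq_exp]
      congr 2
      rw [real_inner_smul_right, he, EuclideanSpace.inner_single_right]
      simp [latticePt]
      ring
    simp only [smul_eq_mul]
    rw [h1]
    have h2 : Complex.exp ((2 * Real.pi * Complex.I * k i) * s) *
        Complex.exp (-((2 * Real.pi * Complex.I * k i) * s)) = 1 := by
      rw [← Complex.exp_add, add_neg_cancel, Complex.exp_zero]
    linear_combination (-(UnitAddTorus.mFourier (-k) t * V.torusLift (t + torusMk (s • e)))) * h2
  have hd2 : HasDerivAt (fun s : ℝ => Complex.exp ((2 * Real.pi * Complex.I * k i) * s) *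
        UnitAddTorus.mFourierCoeff V.torusLift k)
      ((2 * Real.pi * Complex.I * k i) * UnitAddTorus.mFourierCoeff V.torusLift k) 0 := by
    have h1 : HasDerivAt (fun s : ℝ => (2 * Real.pi * Complex.I * k i) * (s : ℂ))
        ((2 * Real.pi * Complex.I * k i) * 1) 0 :=
      Complex.ofRealCLM.hasDerivAt.const_mul _
    have h2 := h1.cexp.mul_const (UnitAddTorus.mFourierCoeff V.torusLift k)
    simpa using h2
  have h3 := hd.2
  simp_rw [hshift] at h3
  have h4 := h3.unique hd2
  rw [← h4, UnitAddTorus.mFourierCoeff]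
  have h0 : torusMk ((0 : ℝ) • e) = 0 := by
    rw [zero_smul]
    rfl
  simp_rw [h0, add_zero]

/-- Repeated differentiation in direction i gains powers of |k_i|; the sup norm of k equals |k_i|
for some i, and the bounds for all directions are added. -/
theorem exists_mFourierCoeff_decay (N : ℕ) : ∃ C : ℝ, 0 ≤ C ∧ ∀ k : Fin n → ℤ,
    ‖k‖ ^ N * ‖UnitAddTorus.mFourierCoeff V.torusLift k‖ ≤ C := by
  have hbound : ∀ W : PeriodicPotential n, ∃ C : ℝ, 0 ≤ C ∧ ∀ k : Fin n → ℤ,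
      ‖UnitAddTorus.mFourierCoeff W.torusLift k‖ ≤ C := by
    intro W
    refine ⟨‖W.torusLift‖, norm_nonneg _, fun k => ?_⟩
    have h := norm_integral_le_of_norm_le_const (μ := (volume : Measure (UnitAddTorus (Fin n))))
      (f := fun t => UnitAddTorus.mFourier (-k) t • W.torusLift t) (C := ‖W.torusLift‖)
      (Filter.Eventually.of_forall fun t => by
        rw [norm_smul]
        have h1 : ‖UnitAddTorus.mFourier (-k) t‖ ≤ 1 :=
          (ContinuousMap.norm_coe_le_norm _ _).trans UnitAddTorus.mFourier_norm.le
        calc _ ≤ 1 * ‖W.torusLift‖ := mul_le_mul h1 (ContinuousMap.norm_coe_le_norm _ _)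
              (norm_nonneg _) zero_le_one
          _ = _ := one_mul _)
    simpa [UnitAddTorus.mFourierCoeff] using h
  have hdir : ∀ (N : ℕ) (W : PeriodicPotential n) (i : Fin n), ∃ C : ℝ, 0 ≤ C ∧
      ∀ k : Fin n → ℤ, |(k i : ℝ)| ^ N * ‖UnitAddTorus.mFourierCoeff W.torusLift k‖ ≤ C := by
    intro N
    induction N with
    | zero => intro W i; simpa using hbound W
    | succ N ih =>
      intro W i
      obtain ⟨C, hC0, hC⟩ := ih (W.partialDeriv i) i
      refine ⟨C, hC0, fun k => le_trans ?_ (hC k)⟩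
      rw [mFourierCoeff_partialDeriv, pow_succ, mul_assoc]
      gcongr
      rw [norm_mul]
      gcongr
      simp only [Complex.norm_mul, Complex.norm_real, Complex.norm_I, Complex.norm_intCast,
        Complex.norm_ofNat, mul_one, Real.norm_of_nonneg Real.pi_pos.le]
      nlinarith [abs_nonneg (k i : ℝ), Real.pi_gt_three]
  choose C hC0 hC using hdir N V
  obtain ⟨C', hC'0, hC'⟩ := hbound V
  refine ⟨∑ i, C i + C', add_nonneg (Finset.sum_nonneg fun i _ => hC0 i) hC'0, fun k => ?_⟩
  rcases isEmpty_or_nonempty (Fin n) with hn | hn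
  · have h0 : ‖k‖ ≤ 1 := by
      rw [Subsingleton.elim k 0, norm_zero]
      exact zero_le_one
    have : ‖k‖ ^ N ≤ 1 := pow_le_one₀ (norm_nonneg _) h0
    have h1 := hC' k
    simp only [Finset.univ_eq_empty, Finset.sum_empty, zero_add]
    nlinarith [norm_nonneg (UnitAddTorus.mFourierCoeff V.torusLift k)]
  · obtain ⟨i, hi⟩ : ∃ i, ‖k i‖ = ‖k‖ := by
      obtain ⟨i, -, hi⟩ := Finset.exists_mem_eq_sup' Finset.univ_nonempty (fun i => ‖k i‖)
      refine ⟨i, le_antisymm (norm_le_pi_norm k i) ?_⟩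
      rw [pi_norm_le_iff_of_nonneg (norm_nonneg _)]
      intro j
      rw [← hi]
      exact Finset.le_sup' (fun i => ‖k i‖) (Finset.mem_univ j)
    have h1 := hC i k
    rw [← hi, Int.norm_eq_abs]
    refine h1.trans ?_
    have := Finset.single_le_sum (fun j _ => hC0 j) (Finset.mem_univ i)
    linarith

theorem summable_norm_pow_mul_of_decay {a : (Fin n → ℤ) → ℝ} (ha0 : ∀ k, 0 ≤ a k)
    (ha : ∀ N : ℕ, ∃ C : ℝ, ∀ k, ‖k‖ ^ N * a k ≤ C) (m : ℕ) :
    Summable fun k => ‖k‖ ^ m * a k := by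
  set b := Pi.basisFun ℝ (Fin n) with hb
  set L := Submodule.span ℤ (Set.range b) with hL
  obtain ⟨C, hC⟩ := ha (m + (Module.finrank ℤ L + 1))
  have hsum := ZLattice.summable_norm_pow_inv L (Module.finrank ℤ L + 1) (Nat.lt_succ_self _)
  have hmem : ∀ k : Fin n → ℤ, (fun i => (k i : ℝ)) ∈ L := by
    intro k
    have : (fun i => (k i : ℝ)) = ∑ i, k i • b i := by
      ext j
      simp [hb, Finset.sum_apply, Pi.single_apply]
    rw [this]
    exact Submodule.sum_mem _ fun i _ => Submodule.smul_mem _ _ (Submodule.subset_span ⟨i, rfl⟩)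
  have hinj : Function.Injective fun k : Fin n → ℤ => (⟨fun i => (k i : ℝ), hmem k⟩ : L) := by
    intro k l hkl
    ext i
    have h1 : (fun i => (k i : ℝ)) = fun i => (l i : ℝ) := congrArg Subtype.val hkl
    exact_mod_cast congrFun h1 i
  have hs2 := (hsum.comp_injective hinj).mul_left C
  have hnorm : ∀ k : Fin n → ℤ, ‖(⟨fun i => (k i : ℝ), hmem k⟩ : L)‖ = ‖k‖ := by
    intro k
    change ‖fun i => (k i : ℝ)‖ = ‖k‖
    simp only [Pi.norm_def]
    congr 2
  -- At k = 0 the comparison series has the junk value `0⁻¹ = 0`, so that single term is replaced by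
  -- the actual one.
  have hfin : Summable (Function.update (fun k : Fin n → ℤ => C *
      ((fun z : L => ‖z‖⁻¹ ^ (Module.finrank ℤ L + 1)) ∘ fun k : Fin n → ℤ =>
        (⟨fun i => (k i : ℝ), hmem k⟩ : L)) k) 0 (‖(0 : Fin n → ℤ)‖ ^ m * a 0)) :=
    hs2.update 0 _
  refine Summable.of_nonneg_of_le (fun k => mul_nonneg (by positivity) (ha0 k)) (fun k => ?_) hfin
  by_cases hk : k = 0
  · subst hk
    rw [Function.update_self]
  · rw [Function.update_of_ne hk, Function.comp_apply, hnorm, inv_pow, ← div_eq_mul_inv,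
      le_div_iff₀ (pow_pos (norm_pos_iff.2 hk) _)]
    calc ‖k‖ ^ m * a k * ‖k‖ ^ (Module.finrank ℤ L + 1)
        = ‖k‖ ^ (m + (Module.finrank ℤ L + 1)) * a k := by rw [pow_add]; ring
      _ ≤ C := hC k

/-- A periodic potential is the sum of a rapidly converging Fourier series. -/
theorem exists_fourier_series : ∃ c : (Fin n → ℤ) → ℂ, Summable (fun k => ‖c k‖) ∧
    Summable (fun k => ‖k‖ ^ 3 * ‖c k‖) ∧
    ∀ x, HasSum (fun k => c k * planeWave (latticePt k) x) (V x : ℂ) := by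
  have h := summable_norm_pow_mul_of_decay
    (a := fun k => ‖UnitAddTorus.mFourierCoeff V.torusLift k‖) (fun k => norm_nonneg _)
    (fun N => by
      obtain ⟨C, -, hC⟩ := V.exists_mFourierCoeff_decay N
      exact ⟨C, hC⟩)
  have h0 : Summable fun k => ‖UnitAddTorus.mFourierCoeff V.torusLift k‖ := by
    simpa using h 0
  refine ⟨UnitAddTorus.mFourierCoeff V.torusLift, h0, h 3, fun x => ?_⟩
  have := UnitAddTorus.hasSum_mFourier_series_apply_of_summable h0.of_norm (torusMk x)
  rw [torusLift_torusMk] at this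
  simpa [mFourier_torusMk] using this

end PeriodicPotential

end FourierSeries

/-! ### Multiplication operators and inner products on L² -/

section BoundedMultiplication

variable {α : Type*} [MeasurableSpace α] {μ : Measure α}

/-- Multiplication by a bounded function on `L²`. -/
noncomputable def boundedMul (m : α → ℂ) (hm : MemLp m ∞ μ) : Lp ℂ 2 μ →L[ℂ] Lp ℂ 2 μ :=
  LinearMap.mkContinuous
    { toFun := fun u => hm.toLp m • u
      map_add' := fun _ _ => Lp.add_smul _ _ _
      map_smul' := fun c u => (Lp.smul_comm c _ u).symm } ‖hm.toLp m‖
    (fun _ => Lp.norm_smul_le _ _)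

theorem boundedMul_coeFn (m : α → ℂ) (hm : MemLp m ∞ μ) (u : Lp ℂ 2 μ) :
    boundedMul m hm u =ᵐ[μ] fun x => m x * u x := by
  filter_upwards [Lp.coeFn_lpSMul (r := 2) (hm.toLp m) u, hm.coeFn_toLp] with x hx hx2
  refine hx.trans ?_
  rw [Pi.smul_apply', hx2, smul_eq_mul]

theorem lp_norm_sq_eq_integral (u : Lp ℂ 2 μ) : ‖u‖ ^ 2 = ∫ x, ‖u x‖ ^ 2 ∂μ := by
  have h := @inner_self_eq_norm_sq ℂ _ _ _ _ u
  rw [← h, L2.inner_def, ← integral_re (L2.integrable_inner u u)]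
  refine integral_congr_ae (Filter.Eventually.of_forall fun x => ?_)
  exact inner_self_eq_norm_sq (𝕜 := ℂ) (u x)

theorem lp_integrable_norm_sq (u : Lp ℂ 2 μ) : Integrable (fun x => ‖u x‖ ^ 2) μ :=
  (memLp_two_iff_integrable_sq_norm (Lp.aestronglyMeasurable u)).1 (Lp.memLp u)

theorem lp_re_inner_eq_integral (u w : Lp ℂ 2 μ) :
    (inner ℂ u w).re = ∫ x, (w x * starRingEnd ℂ (u x)).re ∂μ := by
  rw [L2.inner_def]
  exact (integral_re (L2.integrable_inner (𝕜 := ℂ) u w)).symm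

theorem lp_integrable_re_inner (u w : Lp ℂ 2 μ) :
    Integrable (fun x => (w x * starRingEnd ℂ (u x)).re) μ :=
  (L2.integrable_inner (𝕜 := ℂ) u w).re

end BoundedMultiplication

/-! ### The Fourier transform exchanges translations and modulations -/

section FourierL2

open FourierTransform

variable {n : ℕ}

theorem measurePreserving_add_right_space (a : Space n) :
    MeasurePreserving (fun x : Space n => x + a) volume volume :=
  measurePreserving_add_right volume a

variable (n) in
/-- The Fourier transform as a unitary operator of `L²(ℝⁿ)`. -/
noncomputable abbrev fourierL2 : ContinuousL2 n ≃ₗᵢ[ℂ] ContinuousL2 n :=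
  Lp.fourierTransformₗᵢ (Space n) ℂ

theorem fourierL2_apply (u : ContinuousL2 n) : fourierL2 n u = 𝓕 u := rfl

theorem fourierL2_toLp (f : 𝓢(Space n, ℂ)) : fourierL2 n (f.toLp 2) = (𝓕 f).toLp 2 :=
  SchwartzMap.toLp_fourier_eq f

theorem fourierL2_symm_toLp (f : 𝓢(Space n, ℂ)) :
    (fourierL2 n).symm (f.toLp 2) = (𝓕⁻ f).toLp 2 :=
  SchwartzMap.toLp_fourierInv_eq f

/-- The translation `u ↦ u (· + a)` on `L²(ℝⁿ)`. -/
noncomputable def spaceShift (a : Space n) : ContinuousL2 n →ₗᵢ[ℂ] ContinuousL2 n :=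
  Lp.compMeasurePreservingₗᵢ ℂ (fun x => x + a) (measurePreserving_add_right_space a)

theorem spaceShift_coeFn (a : Space n) (u : ContinuousL2 n) :
    spaceShift a u =ᵐ[volume] fun x => u (x + a) :=
  Lp.coeFn_compMeasurePreserving u (measurePreserving_add_right_space a)

theorem translate_translate_neg (a : Space n) (u : ContinuousL2 n) :
    spaceShift a (spaceShift (-a) u) = u := by
  apply Lp.ext
  filter_upwards [spaceShift_coeFn a (spaceShift (-a) u),
    (measurePreserving_add_right_space a).quasiMeasurePreserving.ae (spaceShift_coeFn (-a) u)]
    with x h1 h2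
  rw [h1, h2, add_neg_cancel_right]

theorem memLp_planeWave (b : Space n) : MemLp (planeWave b) ∞ (volume : Measure (Space n)) :=
  memLp_top_of_bound (continuous_planeWave b).aestronglyMeasurable 1
    (Filter.Eventually.of_forall fun x => (norm_planeWave b x).le)

theorem spaceShift_toLp (a : Space n) (f : 𝓢(Space n, ℂ)) :
    spaceShift a (f.toLp 2) = (SchwartzMap.compSubConstCLM ℂ (-a) f).toLp 2 := by
  apply Lp.ext
  filter_upwards [spaceShift_coeFn a (f.toLp 2),
    (measurePreserving_add_right_space a).quasiMeasurePreserving.ae (f.coeFn_toLp 2 volume),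
    (SchwartzMap.compSubConstCLM ℂ (-a) f).coeFn_toLp 2 volume] with x h1 h2 h3
  rw [h1, h2, h3, SchwartzMap.compSubConstCLM_apply, sub_neg_eq_add]

theorem fourier_compSubConst (a : Space n) (f : 𝓢(Space n, ℂ)) (ξ : Space n) :
    𝓕 (SchwartzMap.compSubConstCLM ℂ (-a) f) ξ = planeWave a ξ * 𝓕 f ξ := by
  rw [SchwartzMap.fourier_coe, SchwartzMap.fourier_coe]
  have h := congrFun (VectorFourier.fourierIntegral_comp_add_right Real.fourierChar volume
    (innerₗ (Space n)) f a) ξ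
  have h2 : (SchwartzMap.compSubConstCLM ℂ (-a) f : Space n → ℂ) = f ∘ fun x => x + a := by
    ext x
    simp [SchwartzMap.compSubConstCLM_apply]
  rw [h2]
  exact h

theorem fourierInv_compSubConst (a : Space n) (f : 𝓢(Space n, ℂ)) (ξ : Space n) :
    𝓕⁻ (SchwartzMap.compSubConstCLM ℂ (-a) f) ξ = planeWave (-a) ξ * 𝓕⁻ f ξ := by
  have h1 : ∀ g : 𝓢(Space n, ℂ), 𝓕⁻ g ξ = 𝓕 g (-ξ) := by
    intro g
    rw [SchwartzMap.fourierInv_coe, SchwartzMap.fourier_coe, Real.fourierInv_eq_fourier_neg]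
  rw [h1, h1, fourier_compSubConst, planeWave_comm a, planeWave_comm (-a), planeWave_neg,
    planeWave_comm, planeWave_neg, planeWave_comm]

/-- Both sides are continuous in u, so it suffices to check Schwartz functions, where the identity
is pointwise. -/
theorem fourier_translate (a : Space n) (u : ContinuousL2 n) :
    fourierL2 n (spaceShift a u) = boundedMul (planeWave a) (memLp_planeWave a) (fourierL2 n u) := by
  refine DenseRange.induction_on
    (p := fun u : ContinuousL2 n =>
      fourierL2 n (spaceShift a u) = boundedMul (planeWave a) (memLp_planeWave a) (fourierL2 n u))
    (SchwartzMap.denseRange_toLpCLM (p := 2) ENNReal.ofNat_ne_top) u ?_ ?_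
  · refine isClosed_eq ?_ ?_
    · exact (fourierL2 n).continuous.comp (spaceShift a).continuous
    · exact (boundedMul _ _).continuous.comp (fourierL2 n).continuous
  · intro f
    simp only [SchwartzMap.toLpCLM_apply]
    rw [spaceShift_toLp, fourierL2_toLp, fourierL2_toLp]
    apply Lp.ext
    filter_upwards [(𝓕 (SchwartzMap.compSubConstCLM ℂ (-a) f)).coeFn_toLp 2 volume,
      (𝓕 f).coeFn_toLp 2 volume, boundedMul_coeFn _ (memLp_planeWave a) ((𝓕 f).toLp 2)]
      with ξ h1 h2 h3
    rw [h1, h3, h2, fourier_compSubConst]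

theorem fourierInv_translate (a : Space n) (u : ContinuousL2 n) :
    (fourierL2 n).symm (spaceShift a u) = boundedMul (planeWave (-a)) (memLp_planeWave (-a)) ((fourierL2 n).symm u) := by
  refine DenseRange.induction_on
    (p := fun u : ContinuousL2 n =>
      (fourierL2 n).symm (spaceShift a u) = boundedMul (planeWave (-a)) (memLp_planeWave (-a)) ((fourierL2 n).symm u))
    (SchwartzMap.denseRange_toLpCLM (p := 2) ENNReal.ofNat_ne_top) u ?_ ?_
  · refine isClosed_eq ?_ ?_
    · exact (fourierL2 n).symm.continuous.comp (spaceShift a).continuous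
    · exact (boundedMul _ _).continuous.comp (fourierL2 n).symm.continuous
  · intro f
    simp only [SchwartzMap.toLpCLM_apply]
    rw [spaceShift_toLp, fourierL2_symm_toLp, fourierL2_symm_toLp]
    apply Lp.ext
    filter_upwards [(𝓕⁻ (SchwartzMap.compSubConstCLM ℂ (-a) f)).coeFn_toLp 2 volume,
      (𝓕⁻ f).coeFn_toLp 2 volume, boundedMul_coeFn _ (memLp_planeWave (-a)) ((𝓕⁻ f).toLp 2)]
      with ξ h1 h2 h3
    rw [h1, h3, h2, fourierInv_compSubConst]

/-- This is the translation rule for the inverse transform, applied to the transform of u. -/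
theorem fourier_boundedMul_planeWave (b : Space n) (u : ContinuousL2 n) :
    fourierL2 n (boundedMul (planeWave b) (memLp_planeWave b) u) =
      spaceShift (-b) (fourierL2 n u) := by
  have h := fourierInv_translate (-b) (fourierL2 n u)
  simp only [neg_neg] at h
  rw [LinearIsometryEquiv.symm_apply_apply] at h
  rw [← h, LinearIsometryEquiv.apply_symm_apply]

end FourierL2

/-! ### The Sobolev space and the Laplacian in Fourier variables -/

section SobolevFourier

open FourierTransform TemperedDistribution

variable {n : ℕ}

theorem coe_toTemperedDistribution_injective {u w : ContinuousL2 n}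
    (h : (u : 𝓢'(Space n, ℂ)) = (w : 𝓢'(Space n, ℂ))) : u = w :=
  toTemperedDistribution_injective h

theorem hasTemperateGrowth_bessel :
    (fun x : Space n => (((1 + ‖x‖ ^ 2) ^ ((2 : ℝ) / 2) : ℝ) : ℂ)).HasTemperateGrowth := by
  fun_prop

theorem hasTemperateGrowth_besselInv :
    (fun x : Space n => (((1 + ‖x‖ ^ 2) ^ (-1 : ℝ) : ℝ) : ℂ)).HasTemperateGrowth := by
  fun_prop

theorem memLp_besselInv :
    MemLp (fun x : Space n => (((1 + ‖x‖ ^ 2) ^ (-1 : ℝ) : ℝ) : ℂ)) ∞ volume := by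
  refine memLp_top_of_bound hasTemperateGrowth_besselInv.1.continuous.aestronglyMeasurable 1
    (Filter.Eventually.of_forall fun x => ?_)
  rw [Complex.norm_real, Real.norm_of_nonneg (by positivity)]
  exact Real.rpow_le_one_of_one_le_of_nonpos (by nlinarith [norm_nonneg x]) (by norm_num)

theorem memLp_laplaceBesselInv :
    MemLp (fun x : Space n => ((‖x‖ ^ 2 * (1 + ‖x‖ ^ 2) ^ (-1 : ℝ) : ℝ) : ℂ)) ∞ volume := by
  have h : (fun x : Space n =>
      ((‖x‖ ^ 2 * (1 + ‖x‖ ^ 2) ^ (-1 : ℝ) : ℝ) : ℂ)).HasTemperateGrowth := by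
    fun_prop
  refine memLp_top_of_bound h.1.continuous.aestronglyMeasurable 1
    (Filter.Eventually.of_forall fun x => ?_)
  rw [Complex.norm_real, Real.norm_of_nonneg (by positivity), Real.rpow_neg_one,
    ← div_eq_mul_inv, div_le_one (by positivity)]
  linarith

/-- Multiplication by the unbounded weight makes sense only for distributions. Moving its bounded
inverse to the other side turns the identity into an almost everywhere equality of L² functions. -/
theorem smulLeftCLM_besselInv_eq_iff {g f : ContinuousL2 n} :
    smulLeftCLM ℂ (fun x : Space n => (((1 + ‖x‖ ^ 2) ^ ((2 : ℝ) / 2) : ℝ) : ℂ))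
      (g : 𝓢'(Space n, ℂ)) = f ↔ g =ᵐ[volume] fun ξ => (((1 + ‖ξ‖ ^ 2) ^ (-1 : ℝ) : ℝ) : ℂ) * f ξ := by
  have hmul : (fun x : Space n => (((1 + ‖x‖ ^ 2) ^ ((2 : ℝ) / 2) : ℝ) : ℂ)) *
      (fun x : Space n => (((1 + ‖x‖ ^ 2) ^ (-1 : ℝ) : ℝ) : ℂ)) = fun _ => 1 := by
    ext x
    rw [Pi.mul_apply, ← Complex.ofReal_mul, ← Real.rpow_add (by positivity)]
    norm_num
  have hcoe := Lp.toTemperedDistribution_smul_eq (r := 2) hasTemperateGrowth_besselInv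
    memLp_besselInv f
  have hiff : g = boundedMul _ memLp_besselInv f ↔
      g =ᵐ[volume] fun ξ => (((1 + ‖ξ‖ ^ 2) ^ (-1 : ℝ) : ℝ) : ℂ) * f ξ := by
    constructor
    · rintro rfl
      exact boundedMul_coeFn _ _ _
    · intro h
      exact Lp.ext (h.trans (boundedMul_coeFn _ _ _).symm)
  rw [← hiff]
  constructor
  · intro h
    apply coe_toTemperedDistribution_injective
    refine Eq.trans ?_ hcoe.symm
    rw [← h, smulLeftCLM_smulLeftCLM_apply hasTemperateGrowth_bessel hasTemperateGrowth_besselInv,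
      hmul, smulLeftCLM_const, one_smul]
  · intro h
    have h2 : (g : 𝓢'(Space n, ℂ)) = smulLeftCLM ℂ
        (fun x : Space n => (((1 + ‖x‖ ^ 2) ^ (-1 : ℝ) : ℝ) : ℂ)) (f : 𝓢'(Space n, ℂ)) := by
      rw [h]
      exact hcoe
    rw [h2, smulLeftCLM_smulLeftCLM_apply hasTemperateGrowth_besselInv hasTemperateGrowth_bessel,
      mul_comm, hmul, smulLeftCLM_const, one_smul]

/-- The Fourier symbol of `-Δ`. -/
noncomputable def kineticSymbol (ξ : Space n) : ℝ := 4 * Real.pi ^ 2 * ‖ξ‖ ^ 2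

theorem kineticSymbol_nonneg (ξ : Space n) : 0 ≤ kineticSymbol ξ := by
  unfold kineticSymbol
  positivity

/-- If f represents (1 + |ξ|²)û, then 4π²(f - û) represents |2πξ|²û, and conversely. This form is
convenient for producing elements of the domain. -/
theorem mem_sobolevH2_iff {u : ContinuousL2 n} : u ∈ sobolevH2 n ↔
    ∃ k : ContinuousL2 n, k =ᵐ[volume] fun ξ => (kineticSymbol ξ : ℂ) * fourierL2 n u ξ := by
  have h0 : u ∈ sobolevH2 n ↔ MemSobolev 2 2 (u : 𝓢'(Space n, ℂ)) := Iff.rfl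
  rw [h0, memSobolev_iff_exists_smulLeftCLM_fourier]
  have hpi : ((4 * Real.pi ^ 2 : ℝ) : ℂ) ≠ 0 :=
    Complex.ofReal_ne_zero.2 (by positivity)
  rw [show 𝓕 (u : 𝓢'(Space n, ℂ)) = (fourierL2 n u : 𝓢'(Space n, ℂ)) from
    Lp.fourier_toTemperedDistribution_eq u]
  constructor
  · rintro ⟨f, hf⟩
    rw [smulLeftCLM_besselInv_eq_iff] at hf
    refine ⟨((4 * Real.pi ^ 2 : ℝ) : ℂ) • (f - fourierL2 n u), ?_⟩
    filter_upwards [hf, Lp.coeFn_smul ((4 * Real.pi ^ 2 : ℝ) : ℂ) (f - fourierL2 n u),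
      Lp.coeFn_sub f (fourierL2 n u)] with ξ h1 h2 h3
    rw [h2, Pi.smul_apply, h3, Pi.sub_apply, h1, Real.rpow_neg_one, smul_eq_mul]
    have : ((1 + ‖ξ‖ ^ 2 : ℝ) : ℂ) ≠ 0 := Complex.ofReal_ne_zero.2 (by positivity)
    unfold kineticSymbol
    push_cast at this ⊢
    field_simp
    ring
  · rintro ⟨k, hk⟩
    refine ⟨fourierL2 n u + ((4 * Real.pi ^ 2 : ℝ) : ℂ)⁻¹ • k, ?_⟩
    rw [smulLeftCLM_besselInv_eq_iff]
    filter_upwards [hk, Lp.coeFn_smul ((4 * Real.pi ^ 2 : ℝ) : ℂ)⁻¹ k,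
      Lp.coeFn_add (fourierL2 n u) (((4 * Real.pi ^ 2 : ℝ) : ℂ)⁻¹ • k)] with ξ h1 h2 h3
    rw [h3, Pi.add_apply, h2, Pi.smul_apply, h1, Real.rpow_neg_one, smul_eq_mul]
    have : ((1 + ‖ξ‖ ^ 2 : ℝ) : ℂ) ≠ 0 := Complex.ofReal_ne_zero.2 (by positivity)
    unfold kineticSymbol
    push_cast at this hpi ⊢
    field_simp

/-- With û = (1 + |ξ|²)⁻¹ f and f in L², the Laplacian acts on f through the bounded multiplier
|ξ|²(1 + |ξ|²)⁻¹, up to -4π². The distributional identity can then be read in L². -/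
theorem fourier_neg_laplacianH2 (u : sobolevH2 n) :
    fourierL2 n (-laplacianH2 n u) =ᵐ[volume]
      fun ξ => (kineticSymbol ξ : ℂ) * fourierL2 n u ξ := by
  obtain ⟨f, hf⟩ := memSobolev_iff_exists_smulLeftCLM_fourier.1 u.2
  rw [show 𝓕 ((u : ContinuousL2 n) : 𝓢'(Space n, ℂ)) =
    (fourierL2 n u : 𝓢'(Space n, ℂ)) from
    Lp.fourier_toTemperedDistribution_eq _, smulLeftCLM_besselInv_eq_iff] at hf
  have h1 : (fourierL2 n (laplacianH2 n u) : 𝓢'(Space n, ℂ)) =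
      ((-(((2 * Real.pi) ^ 2 : ℝ) : ℂ) • boundedMul _ memLp_laplaceBesselInv f : ContinuousL2 n) :
        𝓢'(Space n, ℂ)) := by
    rw [fourierL2_apply, ← Lp.fourier_toTemperedDistribution_eq, laplacianH2_spec,
      laplacian_eq_fourierMultiplierCLM, ← Complex.coe_smul]
    have h2 : ((-(((2 * Real.pi) ^ 2 : ℝ) : ℂ) • boundedMul _ memLp_laplaceBesselInv f :
        ContinuousL2 n) : 𝓢'(Space n, ℂ)) = -(((2 * Real.pi) ^ 2 : ℝ) : ℂ) •
        ((boundedMul _ memLp_laplaceBesselInv f : ContinuousL2 n) : 𝓢'(Space n, ℂ)) := by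
      rw [← Lp.toTemperedDistributionCLM_apply, map_smul, Lp.toTemperedDistributionCLM_apply]
    rw [h2]
    have h3 : ((boundedMul _ memLp_laplaceBesselInv f : ContinuousL2 n) : 𝓢'(Space n, ℂ)) =
        smulLeftCLM ℂ (fun x : Space n => ((‖x‖ ^ 2 * (1 + ‖x‖ ^ 2) ^ (-1 : ℝ) : ℝ) : ℂ))
          (f : 𝓢'(Space n, ℂ)) :=
      Lp.toTemperedDistribution_smul_eq (r := 2) (by fun_prop) memLp_laplaceBesselInv f
    have h4 : (fourierL2 n u : 𝓢'(Space n, ℂ)) =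
        smulLeftCLM ℂ (fun x : Space n => (((1 + ‖x‖ ^ 2) ^ (-1 : ℝ) : ℝ) : ℂ))
          (f : 𝓢'(Space n, ℂ)) := by
      have : fourierL2 n u = boundedMul _ memLp_besselInv f :=
        Lp.ext (hf.trans (boundedMul_coeFn _ _ _).symm)
      rw [this]
      exact Lp.toTemperedDistribution_smul_eq (r := 2) hasTemperateGrowth_besselInv
        memLp_besselInv f
    have h5 : (fun x : Space n => (((1 + ‖x‖ ^ 2) ^ (-1 : ℝ) : ℝ) : ℂ)) *
        (fun x : Space n => Complex.ofReal (‖x‖ ^ 2)) =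
        fun x : Space n => ((‖x‖ ^ 2 * (1 + ‖x‖ ^ 2) ^ (-1 : ℝ) : ℝ) : ℂ) := by
      ext x
      rw [Pi.mul_apply, ← Complex.ofReal_mul, mul_comm]
    rw [h3, fourierMultiplierCLM_apply, FourierTransform.fourier_smul,
      FourierTransform.fourier_fourierInv_eq,
      Lp.fourier_toTemperedDistribution_eq, ← fourierL2_apply, h4,
      smulLeftCLM_smulLeftCLM_apply hasTemperateGrowth_besselInv (by fun_prop), h5,
      Complex.ofReal_neg]
  have h2 := coe_toTemperedDistribution_injective h1
  rw [map_neg, h2, neg_smul, neg_neg]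
  filter_upwards [hf, Lp.coeFn_smul (((2 * Real.pi) ^ 2 : ℝ) : ℂ)
    (boundedMul _ memLp_laplaceBesselInv f), boundedMul_coeFn _ memLp_laplaceBesselInv f]
    with ξ h4 h5 h6
  rw [h5, Pi.smul_apply, h6, h4, smul_eq_mul]
  unfold kineticSymbol
  push_cast
  ring

end SobolevFourier

/-! ### The Brillouin zone as a measurable copy of the dual torus -/

section TorusCell

attribute [local instance] circleMeasureSpace circle_isAddHaarMeasure circle_isProbabilityMeasure

variable {n : ℕ}

/-- The Brillouin zone `[-1/2, 1/2)ⁿ`. -/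
def brillouin (n : ℕ) : Set (Space n) := {ξ | ∀ i, ξ i ∈ Ico (-1 / 2 : ℝ) (1 / 2)}

theorem measurableSet_brillouin : MeasurableSet (brillouin n) := by
  have : brillouin n = ⋂ i, (fun ξ : Space n => ξ i) ⁻¹' Ico (-1 / 2 : ℝ) (1 / 2) := by
    ext ξ
    simp [brillouin]
  rw [this]
  refine MeasurableSet.iInter fun i => measurableSet_Ico.preimage ?_
  exact (EuclideanSpace.proj (𝕜 := ℝ) i).continuous.measurable

/-- The representative of a point of the dual torus in the Brillouin zone; the sign is that of the
convention `v ↦ ∑ γ, v γ exp (-2 π i γ·ξ)`. -/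
noncomputable def cellRep (t : UnitAddTorus (Fin n)) : Space n := -torusRep t

/-- The projection of frequency space to the dual torus. -/
noncomputable def cellMk (ξ : Space n) : UnitAddTorus (Fin n) := torusMk (-ξ)

theorem cellMk_cellRep (t : UnitAddTorus (Fin n)) : cellMk (cellRep t) = t := by
  rw [cellMk, cellRep, neg_neg, torusMk_torusRep]

theorem cellMk_sub (ξ b : Space n) : cellMk (ξ - b) = cellMk ξ + torusMk b := by
  rw [cellMk, cellMk, neg_sub, sub_eq_neg_add, ← torusMk_add]

theorem continuous_cellMk : Continuous (cellMk (n := n)) :=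
  continuous_torusMk.comp continuous_neg

theorem torusRep_mem (t : UnitAddTorus (Fin n)) (i : Fin n) :
    torusRep t i ∈ Ioc (-1 / 2 : ℝ) (1 / 2) := by
  have h := (AddCircle.equivIoc 1 (-1 / 2) (t i) : Ioc (-1 / 2 : ℝ) (-1 / 2 + 1)).2
  have h2 : torusRep t i = (AddCircle.equivIoc 1 (-1 / 2) (t i) : ℝ) := rfl
  rw [h2]
  exact ⟨h.1, h.2.trans (by norm_num)⟩

theorem cellRep_mem (t : UnitAddTorus (Fin n)) : cellRep t ∈ brillouin n := by
  intro i
  have h := torusRep_mem t i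
  have h2 : cellRep t i = -torusRep t i := rfl
  rw [h2]
  exact ⟨by linarith [h.2], by linarith [h.1]⟩

theorem exists_int_cellRep_eq {t : UnitAddTorus (Fin n)} {ξ : Space n} (h : cellMk ξ = t)
    (i : Fin n) : ∃ m : ℤ, cellRep t i = ξ i + m := by
  have h1 : torusMk (-ξ) = torusMk (torusRep t) := by
    rw [torusMk_torusRep]
    exact h
  obtain ⟨γ, hγ⟩ := exists_eq_add_latticePt_of_torusMk_eq h1
  refine ⟨-γ i, ?_⟩
  rw [cellRep, hγ]
  simp [latticePt]
  ring

theorem cellRep_cellMk {ξ : Space n} (hξ : ξ ∈ brillouin n) : cellRep (cellMk ξ) = ξ := by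
  ext i
  obtain ⟨m, hm⟩ := exists_int_cellRep_eq (rfl : cellMk ξ = cellMk ξ) i
  have h1 := cellRep_mem (cellMk ξ) i
  have h2 := hξ i
  rw [hm] at h1
  have h3 : (m : ℝ) < 1 := by linarith [h1.2, h2.1]
  have h4 : (-1 : ℝ) < m := by linarith [h1.1, h2.2]
  have h5 : m < 1 := by exact_mod_cast h3
  have h6 : -1 < m := by exact_mod_cast h4
  have h7 : m = 0 := by omega
  rw [hm, h7]
  simp

/-- The torus is identified with a product of half-open intervals closed on the right; the sign in
`cellRep` reverses them to intervals closed on the left. -/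
theorem measurePreserving_cellRep :
    MeasurePreserving (cellRep (n := n)) volume (volume.restrict (brillouin n)) := by
  set S : Set (Fin n → ℝ) := {x | ∀ i, x i ∈ Ioc (-1 / 2 : ℝ) (-1 / 2 + 1)} with hS
  have hSm : MeasurableSet S := MeasurableSet.univ_pi' fun i => measurableSet_Ioc
  have h1 : MeasurePreserving (UnitAddTorus.measurableEquivPiIoc fun _ : Fin n => (-1 / 2 : ℝ))
      volume (Measure.comap Subtype.val volume) :=
    UnitAddTorus.measurePreserving_equivPiIoc _
  have h2 : MeasurePreserving (Subtype.val : S → (Fin n → ℝ)) (Measure.comap Subtype.val volume)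
      (volume.restrict S) := measurePreserving_subtype_coe hSm
  have h3 : MeasurePreserving (fun x : Fin n → ℝ => -(WithLp.toLp 2 x : Space n)) volume volume :=
    (Measure.measurePreserving_neg volume).comp (PiLp.volume_preserving_toLp (Fin n))
  have h4 := h3.restrict_preimage (measurableSet_brillouin (n := n))
  have h5 : (fun x : Fin n → ℝ => -(WithLp.toLp 2 x : Space n)) ⁻¹' brillouin n = S := by
    ext x
    simp only [brillouin, hS, mem_preimage, mem_ofPred_eq, PiLp.neg_apply, mem_Ico, mem_Ioc]
    refine forall_congr' fun i => ⟨fun h => ⟨by linarith [h.2], by linarith [h.1]⟩,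
      fun h => ⟨by linarith [h.2], by linarith [h.1]⟩⟩
  rw [h5] at h4
  exact h4.comp (h2.comp h1)

theorem measurePreserving_cellMk :
    MeasurePreserving (cellMk (n := n)) (volume.restrict (brillouin n)) volume := by
  refine ⟨continuous_cellMk.measurable, ?_⟩
  rw [← measurePreserving_cellRep.map_eq,
    Measure.map_map continuous_cellMk.measurable measurePreserving_cellRep.measurable]
  have : (cellMk ∘ cellRep : UnitAddTorus (Fin n) → UnitAddTorus (Fin n)) = id :=
    funext cellMk_cellRep
  rw [this, Measure.map_id]

theorem setIntegral_brillouin {F : Type*} [NormedAddCommGroup F] [NormedSpace ℝ F]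
    {f : Space n → F} (hf : StronglyMeasurable f) :
    ∫ ξ in brillouin n, f ξ = ∫ t : UnitAddTorus (Fin n), f (cellRep t) := by
  rw [← measurePreserving_cellRep.map_eq]
  exact integral_map measurePreserving_cellRep.measurable.aemeasurable hf.aestronglyMeasurable

end TorusCell

/-! ### The discrete Fourier transform diagonalizes the lattice Laplacian -/

section TorusFourier

attribute [local instance] circleMeasureSpace circle_isAddHaarMeasure circle_isProbabilityMeasure

variable {n : ℕ}

/-- `L²` of the dual torus. -/
abbrev TorusL2 (n : ℕ) : Type := Lp ℂ 2 (volume : Measure (UnitAddTorus (Fin n)))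

variable (n) in
/-- The discrete Fourier transform. -/
noncomputable def torusFourier : DiscreteL2 n ≃ₗᵢ[ℂ] TorusL2 n :=
  (UnitAddTorus.mFourierBasis (d := Fin n)).repr.symm

theorem mFourierCoeff_torusFourier (v : DiscreteL2 n) (γ : Fin n → ℤ) :
    UnitAddTorus.mFourierCoeff (torusFourier n v) γ = v γ := by
  rw [← UnitAddTorus.mFourierBasis_repr, torusFourier, LinearIsometryEquiv.apply_symm_apply]

theorem torusFourier_eq_of_mFourierCoeff {w : DiscreteL2 n} {ψ : TorusL2 n}
    (h : ∀ γ, UnitAddTorus.mFourierCoeff ψ γ = w γ) : torusFourier n w = ψ := by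
  rw [torusFourier, LinearIsometryEquiv.symm_apply_eq]
  ext γ
  rw [UnitAddTorus.mFourierBasis_repr, h]

theorem measurePreserving_add_torus (β : UnitAddTorus (Fin n)) :
    MeasurePreserving (fun t : UnitAddTorus (Fin n) => t + β) volume volume :=
  measurePreserving_add_right volume β

/-- A change of variables in the Fourier coefficients. Modulation acts here as a genuine translation
of the torus, with wrap-around, whereas on ℝⁿ it translates frequencies without wrapping; this
contrast is the source of aliasing. -/
theorem torusFourier_modulate {b : Space n} {v w : DiscreteL2 n}
    (h : ∀ γ, w γ = planeWave b (latticePt γ) * v γ) :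
    torusFourier n w =ᵐ[volume] fun t => torusFourier n v (t + torusMk b) := by
  have hmp := measurePreserving_add_torus (torusMk b)
  have h1 : torusFourier n w = Lp.compMeasurePreserving _ hmp (torusFourier n v) := by
    refine torusFourier_eq_of_mFourierCoeff fun γ => ?_
    rw [h, ← mFourierCoeff_torusFourier v, UnitAddTorus.mFourierCoeff, UnitAddTorus.mFourierCoeff,
      ← integral_const_mul]
    refine Eq.trans ?_ (integral_add_right_eq_self (fun t => planeWave b (latticePt γ) *
      (UnitAddTorus.mFourier (-γ) t • torusFourier n v t)) (torusMk b))
    refine integral_congr_ae ?_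
    filter_upwards [Lp.coeFn_compMeasurePreserving (torusFourier n v) hmp] with t ht
    rw [ht]
    have h2 : UnitAddTorus.mFourier (-γ) (t + torusMk b) =
        UnitAddTorus.mFourier (-γ) t * starRingEnd ℂ (planeWave b (latticePt γ)) := by
      conv_lhs => rw [← torusMk_torusRep t, ← torusMk_add]
      rw [mFourier_torusMk, planeWave_add, ← mFourier_torusMk, torusMk_torusRep,
        planeWave_comm (latticePt (-γ)), ← planeWave_neg]
      congr 2
      ext i
      simp [latticePt]
    have h3 : planeWave b (latticePt γ) * starRingEnd ℂ (planeWave b (latticePt γ)) = 1 := by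
      rw [Complex.mul_conj, Complex.normSq_eq_norm_sq, norm_planeWave]
      simp
    rw [h2, smul_eq_mul, smul_eq_mul, Function.comp_apply]
    linear_combination (-(UnitAddTorus.mFourier (-γ) t * torusFourier n v (t + torusMk b))) * h3
  rw [h1]
  exact Lp.coeFn_compMeasurePreserving _ hmp

theorem torusFourier_shift {δ : Fin n → ℤ} {v w : DiscreteL2 n} (h : ∀ γ, w γ = v (γ + δ)) :
    torusFourier n w =ᵐ[volume]
      fun t => starRingEnd ℂ (UnitAddTorus.mFourier δ t) * torusFourier n v t := by
  have hm : MemLp (fun t => starRingEnd ℂ (UnitAddTorus.mFourier δ t)) ∞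
      (volume : Measure (UnitAddTorus (Fin n))) := by
    refine memLp_top_of_bound (by fun_prop) 1 (Filter.Eventually.of_forall fun t => ?_)
    rw [RCLike.norm_conj]
    exact (ContinuousMap.norm_coe_le_norm _ _).trans UnitAddTorus.mFourier_norm.le
  have h1 : torusFourier n w = boundedMul _ hm (torusFourier n v) := by
    refine torusFourier_eq_of_mFourierCoeff fun γ => ?_
    rw [h, ← mFourierCoeff_torusFourier v, UnitAddTorus.mFourierCoeff, UnitAddTorus.mFourierCoeff]
    refine integral_congr_ae ?_
    filter_upwards [boundedMul_coeFn _ hm (torusFourier n v)] with t ht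
    rw [ht, neg_add, UnitAddTorus.mFourier_add, UnitAddTorus.mFourier_neg (n := δ), smul_eq_mul,
      smul_eq_mul, mul_assoc]
  rw [h1]
  exact boundedMul_coeFn _ hm _

/-- The discrete negative Laplacian. -/
noncomputable def discreteKinetic (n : ℕ) : DiscreteL2 n →L[ℂ] DiscreteL2 n :=
  ∑ j : Fin n, (2 • ContinuousLinearMap.id ℂ (DiscreteL2 n)
      - weightedShift (fun _ => 1) 1 zero_le_one (by simp) (Equiv.addRight (Pi.single j 1))
      - weightedShift (fun _ => 1) 1 zero_le_one (by simp) (Equiv.subRight (Pi.single j 1)))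

/-- The potential energy of the discrete Schrödinger operator. -/
noncomputable def discretePotential (V : PeriodicPotential n) (h : ℝ) :
    DiscreteL2 n →L[ℂ] DiscreteL2 n :=
  weightedShift (fun γ => (V (h • latticePt γ) : ℂ)) V.exists_bound.choose
        V.exists_bound.choose_spec.1
        (fun γ => by
          rw [Complex.norm_real]
          exact V.exists_bound.choose_spec.2 _) (Equiv.refl _)

theorem discreteOp_eq (V : PeriodicPotential n) (h : ℝ) :
    discreteOp V h = discreteKinetic n + discretePotential V h := rfl

theorem discretePotential_apply (V : PeriodicPotential n) (h : ℝ) (v : DiscreteL2 n)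
    (γ : Fin n → ℤ) : discretePotential V h v γ = (V (h • latticePt γ) : ℂ) * v γ := rfl

/-- The Fourier symbol of the discrete negative Laplacian. -/
noncomputable def discreteSymbol (ξ : Space n) : ℝ :=
  ∑ j, (2 - 2 * Real.cos (2 * Real.pi * ξ j))

theorem discreteSymbol_nonneg (ξ : Space n) : 0 ≤ discreteSymbol ξ :=
  Finset.sum_nonneg fun j _ => by linarith [Real.cos_le_one (2 * Real.pi * ξ j)]

theorem discreteSymbol_le (ξ : Space n) : discreteSymbol ξ ≤ 4 * n := by
  calc discreteSymbol ξ ≤ ∑ _j : Fin n, (4 : ℝ) :=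
        Finset.sum_le_sum fun j _ => by linarith [Real.neg_one_le_cos (2 * Real.pi * ξ j)]
    _ = 4 * n := by simp [mul_comm]

theorem continuous_discreteSymbol : Continuous (discreteSymbol (n := n)) := by
  unfold discreteSymbol
  fun_prop

theorem latticePt_single (j : Fin n) : latticePt (Pi.single j 1) = EuclideanSpace.single j (1 : ℝ) := by
  ext i
  by_cases hij : i = j
  · subst hij; simp [latticePt]
  · simp [latticePt, hij]

theorem mFourier_single_add_conj (j : Fin n) (t : UnitAddTorus (Fin n)) :
    starRingEnd ℂ (UnitAddTorus.mFourier (Pi.single j 1) t) +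
      UnitAddTorus.mFourier (Pi.single j 1) t =
      ((2 * Real.cos (2 * Real.pi * cellRep t j) : ℝ) : ℂ) := by
  have h1 : UnitAddTorus.mFourier (Pi.single j 1) t =
      planeWave (EuclideanSpace.single j 1) (torusRep t) := by
    conv_lhs => rw [← torusMk_torusRep t]
    rw [mFourier_torusMk, latticePt_single]
  rw [h1, add_comm, Complex.add_conj, planeWave_eq_exp, Complex.exp_ofReal_mul_I_re,
    EuclideanSpace.inner_single_left]
  have h2 : cellRep t j = -torusRep t j := rfl
  rw [h2, mul_neg, Real.cos_neg]
  simp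

theorem torusFourier_discreteKinetic (v : DiscreteL2 n) :
    torusFourier n (discreteKinetic n v) =ᵐ[volume]
      fun t => (discreteSymbol (cellRep t) : ℂ) * torusFourier n v t := by
  set A : Fin n → DiscreteL2 n := fun j =>
    weightedShift (fun _ => 1) 1 zero_le_one (by simp) (Equiv.addRight (Pi.single j 1)) v
  set B : Fin n → DiscreteL2 n := fun j =>
    weightedShift (fun _ => 1) 1 zero_le_one (by simp) (Equiv.subRight (Pi.single j 1)) v
  have hK : discreteKinetic n v = ∑ j, ((2 : ℂ) • v - A j - B j) := by
    rw [discreteKinetic, _root_.sum_apply]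
    refine Finset.sum_congr rfl fun j _ => ?_
    rw [_root_.sub_apply, _root_.sub_apply]
    congr 2
    rw [two_smul, two_smul]
    rfl
  have hA : ∀ j, torusFourier n (A j) =ᵐ[volume] fun t =>
      starRingEnd ℂ (UnitAddTorus.mFourier (Pi.single j 1) t) * torusFourier n v t := fun j =>
    torusFourier_shift fun γ => one_mul _
  have hB : ∀ j, torusFourier n (B j) =ᵐ[volume] fun t =>
      UnitAddTorus.mFourier (Pi.single j 1) t * torusFourier n v t := by
    intro j
    have := torusFourier_shift (δ := -Pi.single j 1) (v := v) (w := B j) fun γ => by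
      rw [← sub_eq_add_neg]
      exact one_mul _
    simpa only [UnitAddTorus.mFourier_neg, Complex.conj_conj] using this
  have hterm : ∀ j, torusFourier n ((2 : ℂ) • v - A j - B j) =ᵐ[volume] fun t =>
      ((2 - 2 * Real.cos (2 * Real.pi * cellRep t j) : ℝ) : ℂ) * torusFourier n v t := by
    intro j
    rw [map_sub, map_sub, map_smul]
    filter_upwards [hA j, hB j, Lp.coeFn_sub ((2 : ℂ) • torusFourier n v - torusFourier n (A j))
      (torusFourier n (B j)), Lp.coeFn_sub ((2 : ℂ) • torusFourier n v) (torusFourier n (A j)),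
      Lp.coeFn_smul (2 : ℂ) (torusFourier n v)] with t h1 h2 h3 h4 h5
    rw [h3, Pi.sub_apply, h4, Pi.sub_apply, h5, Pi.smul_apply, h1, h2, smul_eq_mul,
      Complex.ofReal_sub, ← mFourier_single_add_conj]
    push_cast
    ring
  rw [hK, map_sum]
  have hall : ∀ᵐ t, ∀ j, torusFourier n ((2 : ℂ) • v - A j - B j) t =
      ((2 - 2 * Real.cos (2 * Real.pi * cellRep t j) : ℝ) : ℂ) * torusFourier n v t :=
    ae_all_iff.2 hterm
  filter_upwards [hall, Lp.coeFn_finsetSum Finset.univ fun j =>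
    torusFourier n ((2 : ℂ) • v - A j - B j)] with t h1 h2
  rw [h2, Finset.sum_apply, discreteSymbol, Complex.ofReal_sum, Finset.sum_mul]
  exact Finset.sum_congr rfl fun j _ => h1 j

theorem norm_sq_eq_integral_torus (v : DiscreteL2 n) :
    ‖v‖ ^ 2 = ∫ t, ‖torusFourier n v t‖ ^ 2 := by
  rw [← (torusFourier n).norm_map v, lp_norm_sq_eq_integral]

theorem re_inner_discreteKinetic (v : DiscreteL2 n) :
    (inner ℂ v (discreteKinetic n v)).re =
      ∫ t, discreteSymbol (cellRep t) * ‖torusFourier n v t‖ ^ 2 := by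
  rw [← (torusFourier n).inner_map_map, lp_re_inner_eq_integral]
  refine integral_congr_ae ?_
  filter_upwards [torusFourier_discreteKinetic v] with t ht
  rw [ht, mul_assoc, Complex.mul_conj, ← Complex.ofReal_mul, Complex.ofReal_re,
    Complex.normSq_eq_norm_sq]

theorem norm_sq_discreteKinetic (v : DiscreteL2 n) :
    ‖discreteKinetic n v‖ ^ 2 =
      ∫ t, discreteSymbol (cellRep t) ^ 2 * ‖torusFourier n v t‖ ^ 2 := by
  rw [norm_sq_eq_integral_torus]
  refine integral_congr_ae ?_
  filter_upwards [torusFourier_discreteKinetic v] with t ht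
  rw [ht, norm_mul, mul_pow, Complex.norm_real, Real.norm_eq_abs, sq_abs]

theorem integrable_bdd_mul_norm_sq_torus (v : DiscreteL2 n) {f : Space n → ℝ} {C : ℝ}
    (hf : Measurable f) (hC : ∀ ξ ∈ brillouin n, |f ξ| ≤ C) :
    Integrable (fun t => f (cellRep t) * ‖torusFourier n v t‖ ^ 2) := by
  refine (lp_integrable_norm_sq (torusFourier n v)).bdd_mul (c := C)
    (hf.comp measurePreserving_cellRep.measurable).aestronglyMeasurable
    (Filter.Eventually.of_forall fun t => ?_)
  exact hC _ (cellRep_mem t)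

end TorusFourier

/-! ### Band-limited interpolation and aliasing -/

section Interpolation

attribute [local instance] circleMeasureSpace circle_isAddHaarMeasure circle_isProbabilityMeasure

variable {n : ℕ}

/-- A function on the dual torus as a function supported in the Brillouin zone. -/
noncomputable def bandFunction (φ : TorusL2 n) : Space n → ℂ :=
  (brillouin n).indicator fun ξ => φ (cellMk ξ)

theorem stronglyMeasurable_comp_cellMk (φ : TorusL2 n) :
    StronglyMeasurable fun ξ : Space n => φ (cellMk ξ) :=
  (Lp.stronglyMeasurable φ).comp_measurable continuous_cellMk.measurable

theorem stronglyMeasurable_bandFunction (φ : TorusL2 n) : StronglyMeasurable (bandFunction φ) :=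
  (stronglyMeasurable_comp_cellMk φ).indicator measurableSet_brillouin

theorem memLp_bandFunction (φ : TorusL2 n) : MemLp (bandFunction φ) 2 volume := by
  rw [bandFunction, memLp_indicator_iff_restrict measurableSet_brillouin]
  exact (Lp.memLp φ).comp_measurePreserving measurePreserving_cellMk

theorem bandFunction_cellRep (φ : TorusL2 n) (t : UnitAddTorus (Fin n)) :
    bandFunction φ (cellRep t) = φ t := by
  rw [bandFunction, indicator_of_mem (cellRep_mem t), cellMk_cellRep]

/-- The band-limited interpolation of a function on the lattice. -/
noncomputable def interpolate (v : DiscreteL2 n) : ContinuousL2 n :=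
  (fourierL2 n).symm ((memLp_bandFunction (torusFourier n v)).toLp _)

theorem fourierL2_interpolate (v : DiscreteL2 n) :
    fourierL2 n (interpolate v) =ᵐ[volume] bandFunction (torusFourier n v) := by
  rw [interpolate, LinearIsometryEquiv.apply_symm_apply]
  exact MemLp.coeFn_toLp _

theorem integral_mul_norm_sq_interpolate (v : DiscreteL2 n) {f : Space n → ℝ} (hf : Measurable f) :
    ∫ ξ, f ξ * ‖fourierL2 n (interpolate v) ξ‖ ^ 2 =
      ∫ t, f (cellRep t) * ‖torusFourier n v t‖ ^ 2 := by
  have h1 : ∫ ξ, f ξ * ‖fourierL2 n (interpolate v) ξ‖ ^ 2 =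
      ∫ ξ in brillouin n, f ξ * ‖bandFunction (torusFourier n v) ξ‖ ^ 2 := by
    rw [setIntegral_eq_integral_of_forall_compl_eq_zero]
    · refine integral_congr_ae ?_
      filter_upwards [fourierL2_interpolate v] with ξ hξ
      rw [hξ]
    · intro ξ hξ
      rw [bandFunction, indicator_of_notMem hξ]
      simp
  rw [h1, setIntegral_brillouin]
  · simp_rw [bandFunction_cellRep]
  · exact hf.stronglyMeasurable.mul ((stronglyMeasurable_bandFunction _).norm.pow 2)

theorem norm_interpolate (v : DiscreteL2 n) : ‖interpolate v‖ = ‖v‖ := by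
  have h := integral_mul_norm_sq_interpolate v (f := fun _ => 1) measurable_const
  simp only [one_mul] at h
  rw [← lp_norm_sq_eq_integral, ← norm_sq_eq_integral_torus, LinearIsometryEquiv.norm_map] at h
  exact (sq_eq_sq₀ (norm_nonneg _) (norm_nonneg _)).1 h

/-- Every function with frequencies in the Brillouin zone is an interpolation. -/
theorem exists_fourierL2_interpolate_eq (u : ContinuousL2 n) : ∃ v : DiscreteL2 n,
    fourierL2 n (interpolate v) =ᵐ[volume] (brillouin n).indicator (fourierL2 n u) := by
  set g := fourierL2 n u
  have hm : MemLp (g ∘ cellRep) 2 (volume : Measure (UnitAddTorus (Fin n))) :=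
    ((Lp.memLp g).restrict _).comp_measurePreserving measurePreserving_cellRep
  refine ⟨(torusFourier n).symm (hm.toLp _), (fourierL2_interpolate _).trans ?_⟩
  rw [LinearIsometryEquiv.apply_symm_apply]
  have h1 : ∀ᵐ ξ ∂(volume.restrict (brillouin n)),
      hm.toLp _ (cellMk ξ) = (g ∘ cellRep) (cellMk ξ) :=
    measurePreserving_cellMk.quasiMeasurePreserving.ae hm.coeFn_toLp
  rw [ae_restrict_iff' measurableSet_brillouin] at h1
  filter_upwards [h1] with ξ hξ
  by_cases hmem : ξ ∈ brillouin n
  · rw [bandFunction, indicator_of_mem hmem, indicator_of_mem hmem, hξ hmem, Function.comp_apply,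
      cellRep_cellMk hmem]
  · rw [bandFunction, indicator_of_notMem hmem, indicator_of_notMem hmem]

/-- The high frequencies. -/
def highFrequencies (n : ℕ) : Set (Space n) := {ξ | ∃ i, 3 / 8 ≤ |ξ i|}

theorem measurableSet_highFrequencies : MeasurableSet (highFrequencies n) := by
  have : highFrequencies n = ⋃ i, {ξ : Space n | 3 / 8 ≤ |ξ i|} := by
    ext ξ
    simp [highFrequencies]
  rw [this]
  refine MeasurableSet.iUnion fun i => (isClosed_le continuous_const ?_).measurableSet
  fun_prop

/-- A frequency pushed out of the zone by a step of at most 1/8 in each coordinate started within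
1/8 of the boundary, and re-enters by an integer translation within 1/8 of the opposite side. Hence
the threshold 3/8 = 1/2 - 1/8 for both positions. -/
theorem mem_highFrequencies_of_sub_notMem {t : UnitAddTorus (Fin n)} {b : Space n}
    (hb : ∀ i, |b i| ≤ 1 / 8) (h : cellRep t - b ∉ brillouin n) :
    cellRep t ∈ highFrequencies n ∧ cellRep (t + torusMk b) ∈ highFrequencies n := by
  simp only [brillouin, mem_ofPred_eq, not_forall] at h
  obtain ⟨i, hi⟩ := h
  have h1 := cellRep_mem t i
  have h2 := cellRep_mem (t + torusMk b) i
  have h3 := abs_le.1 (hb i)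
  obtain ⟨m, hm⟩ := exists_int_cellRep_eq (ξ := cellRep t - b) (t := t + torusMk b)
    (by rw [cellMk_sub, cellMk_cellRep]) i
  have h4 : (cellRep t - b) i = cellRep t i - b i := rfl
  rw [h4] at hi hm
  rw [mem_Ico, not_and_or, not_le, not_lt] at hi
  refine ⟨⟨i, ?_⟩, ⟨i, ?_⟩⟩
  · rcases hi with hi | hi
    · rw [abs_of_neg (by linarith)]
      linarith
    · rw [abs_of_pos (by linarith)]
      linarith
  · rw [hm] at h2 ⊢
    rcases hi with hi | hi
    · have h5 : (0 : ℝ) < m := by linarith [h2.1]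
      have h6 : 1 ≤ m := by exact_mod_cast h5
      have h7 : (1 : ℝ) ≤ m := by exact_mod_cast h6
      rw [abs_of_pos (by linarith [h1.1])]
      linarith [h1.1]
    · have h5 : (m : ℝ) < 0 := by linarith [h2.2]
      have h6 : m ≤ -1 := by
        have : m < 0 := by exact_mod_cast h5
        omega
      have h7 : (m : ℝ) ≤ -1 := by exact_mod_cast h6
      rw [abs_of_neg (by linarith [h1.2])]
      linarith [h1.2]

/-- The mass of `v` at high frequencies. -/
noncomputable def highMass (v : DiscreteL2 n) : ℝ :=
  ∫ t, (highFrequencies n).indicator (fun _ => (1 : ℝ)) (cellRep t) * ‖torusFourier n v t‖ ^ 2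

theorem integrable_highMass (v : DiscreteL2 n) : Integrable fun t =>
    (highFrequencies n).indicator (fun _ => (1 : ℝ)) (cellRep t) * ‖torusFourier n v t‖ ^ 2 := by
  refine integrable_bdd_mul_norm_sq_torus v (C := 1)
    (measurable_const.indicator measurableSet_highFrequencies) fun ξ _ => ?_
  by_cases h : ξ ∈ highFrequencies n <;> simp [h]

theorem discreteSymbol_ge_of_mem_highFrequencies {ξ : Space n} (hξ : ξ ∈ brillouin n)
    (h : ξ ∈ highFrequencies n) : 1 ≤ discreteSymbol ξ := by
  obtain ⟨i, hi⟩ := h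
  have h1 : 2 - 2 * Real.cos (2 * Real.pi * ξ i) ≤ discreteSymbol ξ :=
    Finset.single_le_sum (f := fun j => 2 - 2 * Real.cos (2 * Real.pi * ξ j))
      (fun j _ => by linarith [Real.cos_le_one (2 * Real.pi * ξ j)]) (Finset.mem_univ i)
  have h2 : Real.cos (2 * Real.pi * ξ i) ≤ 0 := by
    rw [← Real.cos_abs, abs_mul, abs_of_pos (by positivity : (0 : ℝ) < 2 * Real.pi)]
    have h3 : |ξ i| ≤ 1 / 2 := abs_le.2 ⟨by linarith [(hξ i).1], (hξ i).2.le⟩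
    refine Real.cos_nonpos_of_pi_div_two_le_of_le ?_ ?_ <;> nlinarith [Real.pi_pos]
  linarith

/-- Chebyshev's inequality: the discrete symbol is at least 1 on the high frequencies of the zone,
so its square may be inserted into the integral. -/
theorem highMass_le (v : DiscreteL2 n) : highMass v ≤ ‖discreteKinetic n v‖ ^ 2 := by
  rw [norm_sq_discreteKinetic, highMass]
  refine integral_mono (integrable_highMass v) ?_ fun t => ?_
  · refine integrable_bdd_mul_norm_sq_torus v (C := (4 * n) ^ 2)
      (f := fun ξ => discreteSymbol ξ ^ 2) (continuous_discreteSymbol.measurable.pow_const 2)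
      fun ξ _ => ?_
    rw [abs_of_nonneg (by positivity)]
    gcongr
    · exact discreteSymbol_nonneg ξ
    · exact discreteSymbol_le ξ
  · dsimp only
    gcongr
    by_cases h : cellRep t ∈ highFrequencies n
    · rw [indicator_of_mem h]
      have := discreteSymbol_ge_of_mem_highFrequencies (cellRep_mem t) h
      nlinarith
    · rw [indicator_of_notMem h]
      positivity

/-- Modulation on the lattice. -/
noncomputable def discreteModulate (b : Space n) : DiscreteL2 n →L[ℂ] DiscreteL2 n :=
  weightedShift (fun γ => planeWave b (latticePt γ)) 1 zero_le_one
    (fun γ => (norm_planeWave b (latticePt γ)).le) (Equiv.refl _)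

theorem discreteModulate_apply (b : Space n) (v : DiscreteL2 n) (γ : Fin n → ℤ) :
    discreteModulate b v γ = planeWave b (latticePt γ) * v γ := rfl

theorem norm_weightedShift_apply_le {ι : Type} (a : ι → ℂ) (C : ℝ) (hC : 0 ≤ C)
    (ha : ∀ i, ‖a i‖ ≤ C) (e : ι ≃ ι) (v : lp (fun _ : ι => ℂ) 2) :
    ‖weightedShift a C hC ha e v‖ ≤ C * ‖v‖ := by
  refine ContinuousLinearMap.le_of_opNorm_le _ ?_ v
  unfold weightedShift
  exact LinearMap.mkContinuous_norm_le _ hC _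

theorem norm_discreteModulate_apply_le (b : Space n) (v : DiscreteL2 n) :
    ‖discreteModulate b v‖ ≤ ‖v‖ := by
  rw [← one_mul ‖v‖]
  exact norm_weightedShift_apply_le (fun γ => planeWave b (latticePt γ)) 1 zero_le_one
    (fun γ => (norm_planeWave b (latticePt γ)).le) (Equiv.refl _) v

theorem norm_inner_discreteModulate_le (b : Space n) (v : DiscreteL2 n) :
    ‖inner ℂ v (discreteModulate b v)‖ ≤ ‖v‖ ^ 2 := by
  have h1 := norm_discreteModulate_apply_le b v
  calc _ ≤ ‖v‖ * ‖discreteModulate b v‖ := norm_inner_le_norm _ _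
    _ ≤ ‖v‖ * ‖v‖ := by gcongr
    _ = _ := (sq _).symm

theorem norm_boundedMul_planeWave (b : Space n) (u : ContinuousL2 n) :
    ‖boundedMul (planeWave b) (memLp_planeWave b) u‖ = ‖u‖ := by
  rw [← (fourierL2 n).norm_map, fourier_boundedMul_planeWave, LinearIsometry.norm_map,
    LinearIsometryEquiv.norm_map]

theorem norm_inner_boundedMul_planeWave_le (b : Space n) (u : ContinuousL2 n) :
    ‖inner ℂ u (boundedMul (planeWave b) (memLp_planeWave b) u)‖ ≤ ‖u‖ ^ 2 := by
  calc _ ≤ ‖u‖ * ‖boundedMul (planeWave b) (memLp_planeWave b) u‖ := norm_inner_le_norm _ _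
    _ = _ := by rw [norm_boundedMul_planeWave, sq]

/-- Aliasing only concerns high frequencies. -/
theorem norm_inner_modulate_sub_le {b : Space n} (hb : ∀ i, |b i| ≤ 1 / 8) (v : DiscreteL2 n) :
    ‖inner ℂ v (discreteModulate b v) -
      inner ℂ (interpolate v) (boundedMul (planeWave b) (memLp_planeWave b) (interpolate v))‖ ≤
      highMass v := by
  set φ := torusFourier n v with hφ
  have hshift := measurePreserving_add_torus (torusMk b)
  have hmem2 : MemLp (fun t => φ (t + torusMk b)) 2
      (volume : Measure (UnitAddTorus (Fin n))) :=
    (Lp.memLp φ).comp_measurePreserving hshift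
  have hint : Integrable fun t => φ (t + torusMk b) * starRingEnd ℂ (φ t) :=
    hmem2.integrable_mul (Lp.memLp φ).star
  have h1 : inner ℂ v (discreteModulate b v) = ∫ t, φ (t + torusMk b) * starRingEnd ℂ (φ t) := by
    rw [← (torusFourier n).inner_map_map, L2.inner_def]
    refine integral_congr_ae ?_
    filter_upwards [torusFourier_modulate (b := b) (v := v) (w := discreteModulate b v)
      fun γ => discreteModulate_apply b v γ] with t ht
    rw [ht]
    rfl
  -- Z is 1 where the translated frequency stays in the zone. In the continuous pairing the other
  -- frequencies contribute nothing; in the discrete pairing they wrap around.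
  set Z : UnitAddTorus (Fin n) → ℂ := fun t =>
    (brillouin n).indicator (fun _ => (1 : ℂ)) (cellRep t - b) with hZ
  have hZm : Measurable Z :=
    (measurable_const.indicator measurableSet_brillouin).comp
      (measurePreserving_cellRep.measurable.sub_const b)
  have h2 : inner ℂ (interpolate v) (boundedMul (planeWave b) (memLp_planeWave b) (interpolate v))
      = ∫ t, Z t * (φ (t + torusMk b) * starRingEnd ℂ (φ t)) := by
    rw [← (fourierL2 n).inner_map_map, fourier_boundedMul_planeWave, L2.inner_def]
    have h3 : ∫ ξ, inner ℂ (fourierL2 n (interpolate v) ξ)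
        (spaceShift (-b) (fourierL2 n (interpolate v)) ξ) =
        ∫ ξ in brillouin n, bandFunction φ (ξ - b) * starRingEnd ℂ (bandFunction φ ξ) := by
      rw [setIntegral_eq_integral_of_forall_compl_eq_zero]
      · refine integral_congr_ae ?_
        filter_upwards [fourierL2_interpolate v, spaceShift_coeFn (-b) (fourierL2 n (interpolate v)),
          (measurePreserving_add_right_space (-b)).quasiMeasurePreserving.ae
            (fourierL2_interpolate v)] with ξ h4 h5 h6
        rw [h4, h5, h6, ← sub_eq_add_neg]
        rfl
      · intro ξ hξ
        rw [bandFunction, indicator_of_notMem hξ, map_zero, mul_zero]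
    rw [h3, setIntegral_brillouin]
    · refine integral_congr_ae (Filter.Eventually.of_forall fun t => ?_)
      simp only [bandFunction_cellRep, hZ]
      by_cases hmem : cellRep t - b ∈ brillouin n
      · rw [bandFunction, indicator_of_mem hmem, indicator_of_mem hmem, cellMk_sub, cellMk_cellRep,
          one_mul]
      · rw [bandFunction, indicator_of_notMem hmem, indicator_of_notMem hmem, zero_mul, zero_mul]
    · refine ((stronglyMeasurable_bandFunction φ).comp_measurable (measurable_id.sub_const b)).mul ?_
      exact Complex.continuous_conj.comp_stronglyMeasurable (stronglyMeasurable_bandFunction φ)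
  have hint2 : Integrable fun t => Z t * (φ (t + torusMk b) * starRingEnd ℂ (φ t)) := by
    refine hint.bdd_mul (c := 1) hZm.aestronglyMeasurable (Filter.Eventually.of_forall fun t => ?_)
    simp only [hZ]
    by_cases hmem : cellRep t - b ∈ brillouin n <;> simp [hmem]
  set Hi : UnitAddTorus (Fin n) → ℝ := fun t =>
    (highFrequencies n).indicator (fun _ => (1 : ℝ)) (cellRep t) * ‖φ t‖ ^ 2 with hHi
  have hHint : Integrable Hi := integrable_highMass v
  have hHint2 : Integrable fun t => Hi (t + torusMk b) :=
    (hshift.integrable_comp hHint.aestronglyMeasurable).2 hHint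
  rw [h1, h2, ← integral_sub hint hint2]
  -- Where wrapping occurs, both frequencies are high and the product is at most half the sum of the
  -- squares. Translation invariance then makes each half contribute `highMass v / 2`.
  have hbound : ∀ t, ‖φ (t + torusMk b) * starRingEnd ℂ (φ t) -
      Z t * (φ (t + torusMk b) * starRingEnd ℂ (φ t))‖ ≤ (Hi (t + torusMk b) + Hi t) / 2 := by
    intro t
    have hHi0 : ∀ t, 0 ≤ Hi t := fun t => by
      simp only [hHi]
      exact mul_nonneg (indicator_nonneg (fun _ _ => zero_le_one) _) (by positivity)
    by_cases hmem : cellRep t - b ∈ brillouin n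
    · simp only [hZ]
      rw [indicator_of_mem hmem, one_mul, sub_self, norm_zero]
      have := hHi0 t
      have := hHi0 (t + torusMk b)
      linarith
    · obtain ⟨h5, h6⟩ := mem_highFrequencies_of_sub_notMem hb hmem
      simp only [hZ, hHi]
      rw [indicator_of_notMem hmem, indicator_of_mem h5, indicator_of_mem h6, zero_mul, sub_zero,
        norm_mul, RCLike.norm_conj]
      nlinarith [sq_nonneg (‖φ (t + torusMk b)‖ - ‖φ t‖)]
  calc _ ≤ ∫ t, (Hi (t + torusMk b) + Hi t) / 2 :=
        norm_integral_le_of_norm_le ((hHint2.add hHint).div_const 2)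
          (Filter.Eventually.of_forall hbound)
    _ = highMass v := by
      rw [integral_div, integral_add hHint2 hHint, integral_add_right_eq_self Hi]
      have : ∫ t, Hi t = highMass v := rfl
      rw [this]
      ring

end Interpolation

/-! ### Potential energy before and after interpolation -/

section PotentialComparison

variable {n : ℕ}

theorem hasSum_inner_discretePotential {V : PeriodicPotential n} {c : (Fin n → ℤ) → ℂ}
    (hc : Summable fun k => ‖c k‖)
    (hV : ∀ x, HasSum (fun k => c k * planeWave (latticePt k) x) (V x : ℂ)) (h : ℝ)
    (v : DiscreteL2 n) :
    HasSum (fun k => c k * inner ℂ v (discreteModulate (h • latticePt k) v))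
      (inner ℂ v (discretePotential V h v)) := by
  have hsum : Summable fun k => c k • discreteModulate (h • latticePt k) v := by
    refine Summable.of_norm_bounded (g := fun k => ‖c k‖ * ‖v‖) (hc.mul_right _) fun k => ?_
    rw [norm_smul]
    gcongr
    exact norm_discreteModulate_apply_le _ v
  have heq : ∑' k, c k • discreteModulate (h • latticePt k) v = discretePotential V h v := by
    ext γ
    have h1 := (lp.evalCLM ℂ (fun _ : Fin n → ℤ => ℂ) 2 γ).hasSum hsum.hasSum
    have h2 : HasSum (fun k => (c k * planeWave (latticePt k) (h • latticePt γ)) * v γ)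
        ((V (h • latticePt γ) : ℂ) * v γ) := (hV _).mul_right _
    refine h1.unique (HasSum.congr_fun h2 fun k => ?_)
    change c k * (planeWave (h • latticePt k) (latticePt γ) * v γ) = _
    rw [planeWave_smul_right, mul_assoc]
  have h3 := (innerSL ℂ v).hasSum hsum.hasSum
  rw [heq] at h3
  simpa [inner_smul_right] using h3

/-- The series is integrated termwise against |u|², with absolute convergence from ∑ |c_k| ‖u‖². -/
theorem hasSum_inner_potentialMul {V : PeriodicPotential n} {c : (Fin n → ℤ) → ℂ}
    (hc : Summable fun k => ‖c k‖)
    (hV : ∀ x, HasSum (fun k => c k * planeWave (latticePt k) x) (V x : ℂ)) (h : ℝ)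
    (u : ContinuousL2 n) :
    HasSum (fun k => c k * inner ℂ u
        (boundedMul (planeWave (h • latticePt k)) (memLp_planeWave (h • latticePt k)) u))
      (inner ℂ u (potentialMul V h u)) := by
  have hterm : ∀ k, c k * inner ℂ u
        (boundedMul (planeWave (h • latticePt k)) (memLp_planeWave (h • latticePt k)) u) =
      ∫ x, (c k * planeWave (latticePt k) (h • x)) * ((‖u x‖ ^ 2 : ℝ) : ℂ) := by
    intro k
    rw [L2.inner_def, ← integral_const_mul]
    refine integral_congr_ae ?_
    filter_upwards [boundedMul_coeFn _ (memLp_planeWave (h • latticePt k)) u] with x hx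
    rw [hx, planeWave_smul_right]
    change c k * ((_ * u x) * starRingEnd ℂ (u x)) = _
    rw [mul_assoc _ (u x), Complex.mul_conj, Complex.normSq_eq_norm_sq, mul_assoc]
  have htotal : inner ℂ u (potentialMul V h u) =
      ∫ x, ∑' k, (c k * planeWave (latticePt k) (h • x)) * ((‖u x‖ ^ 2 : ℝ) : ℂ) := by
    rw [L2.inner_def]
    refine integral_congr_ae ?_
    filter_upwards [potentialMul_coeFn V h u] with x hx
    rw [hx, ((hV (h • x)).mul_right _).tsum_eq]
    change (_ * u x) * starRingEnd ℂ (u x) = _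
    rw [mul_assoc _ (u x), Complex.mul_conj, Complex.normSq_eq_norm_sq]
  have hint : ∀ k, Integrable fun x =>
      (c k * planeWave (latticePt k) (h • x)) * ((‖u x‖ ^ 2 : ℝ) : ℂ) := by
    intro k
    refine (lp_integrable_norm_sq u).ofReal.bdd_mul (c := ‖c k‖) ?_
      (Filter.Eventually.of_forall fun x => ?_)
    · exact (continuous_const.mul ((continuous_planeWave _).comp
        (continuous_const_smul h))).aestronglyMeasurable
    · rw [norm_mul, norm_planeWave, mul_one]
  rw [htotal]
  simp_rw [hterm]
  refine hasSum_integral_of_summable_integral_norm hint ?_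
  have : ∀ k, ∫ x, ‖(c k * planeWave (latticePt k) (h • x)) * ((‖u x‖ ^ 2 : ℝ) : ℂ)‖ =
      ‖c k‖ * ‖u‖ ^ 2 := by
    intro k
    rw [lp_norm_sq_eq_integral, ← integral_const_mul]
    refine integral_congr_ae (Filter.Eventually.of_forall fun x => ?_)
    simp only [norm_mul, norm_planeWave, mul_one, Complex.norm_real, Real.norm_eq_abs]
    rw [abs_of_nonneg (by positivity)]
  simp_rw [this]
  exact hc.mul_right _

/-- Interpolation changes the potential energy only a little. -/
theorem exists_inner_potential_sub_le (V : PeriodicPotential n) :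
    ∃ C : ℝ, 0 < C ∧ ∀ h : ℝ, 0 < h → ∀ v : DiscreteL2 n,
      |(inner ℂ v (discretePotential V h v)).re -
        (inner ℂ (interpolate v) (potentialMul V h (interpolate v))).re| ≤
        C * (‖discreteKinetic n v‖ ^ 2 + h ^ 3 * ‖v‖ ^ 2) := by
  obtain ⟨c, hc, hc3, hV⟩ := V.exists_fourier_series
  refine ⟨∑' k, ‖c k‖ + 1024 * ∑' k, ‖k‖ ^ 3 * ‖c k‖ + 1, ?_, fun h hh v => ?_⟩
  · have h1 : 0 ≤ ∑' k, ‖c k‖ := tsum_nonneg fun k => norm_nonneg _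
    have h2 : 0 ≤ ∑' k, ‖k‖ ^ 3 * ‖c k‖ := tsum_nonneg fun k => by positivity
    linarith
  set a : (Fin n → ℤ) → ℂ := fun k => inner ℂ v (discreteModulate (h • latticePt k) v) with ha
  set b : (Fin n → ℤ) → ℂ := fun k => inner ℂ (interpolate v)
    (boundedMul (planeWave (h • latticePt k)) (memLp_planeWave (h • latticePt k))
      (interpolate v)) with hb
  have hM0 : 0 ≤ highMass v := integral_nonneg fun t =>
    mul_nonneg (indicator_nonneg (fun _ _ => zero_le_one) _) (by positivity)
  have herr : ∀ k, ‖a k - b k‖ ≤ highMass v + 1024 * h ^ 3 * ‖k‖ ^ 3 * ‖v‖ ^ 2 := by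
    intro k
    -- Low modes translate frequencies by at most 1/8 and cost only the high-frequency mass. For the
    -- others the trivial bound 2‖v‖² is multiplied by (8h‖k‖)³ ≥ 1, whence 1024 = 2 · 8³; the sum
    -- is controlled by the third moment of the coefficients.
    rcases le_total (h * ‖k‖) (1 / 8) with hk | hk
    · have h1 : ‖a k - b k‖ ≤ highMass v := by
        refine norm_inner_modulate_sub_le (fun i => ?_) v
        have h2 : (h • latticePt k) i = h * (k i : ℝ) := rfl
        rw [h2, abs_mul, abs_of_pos hh]
        refine le_trans ?_ hk
        gcongr
        have := norm_le_pi_norm k i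
        rwa [Int.norm_eq_abs] at this
      have : 0 ≤ 1024 * h ^ 3 * ‖k‖ ^ 3 * ‖v‖ ^ 2 := by positivity
      linarith
    · have h1 : ‖a k‖ ≤ ‖v‖ ^ 2 := norm_inner_discreteModulate_le _ v
      have h2 : ‖b k‖ ≤ ‖v‖ ^ 2 := by
        have := norm_inner_boundedMul_planeWave_le (h • latticePt k) (interpolate v)
        rwa [norm_interpolate] at this
      have h3 : (1 : ℝ) ≤ (8 * (h * ‖k‖)) ^ 3 := one_le_pow₀ (by linarith)
      have h4 := norm_sub_le (a k) (b k)
      have h5 : ‖v‖ ^ 2 ≤ (8 * (h * ‖k‖)) ^ 3 * ‖v‖ ^ 2 :=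
        le_mul_of_one_le_left (by positivity) h3
      have h6 : (8 * (h * ‖k‖)) ^ 3 * ‖v‖ ^ 2 = 512 * h ^ 3 * ‖k‖ ^ 3 * ‖v‖ ^ 2 := by ring
      rw [h6] at h5
      linarith
  have hsum := (hasSum_inner_discretePotential hc hV h v).sub
    (hasSum_inner_potentialMul hc hV h (interpolate v))
  have hsumE : Summable fun k => ‖c k‖ * highMass v +
      1024 * h ^ 3 * ‖v‖ ^ 2 * (‖k‖ ^ 3 * ‖c k‖) :=
    (hc.mul_right _).add (hc3.mul_left _)
  have hnorm : ‖inner ℂ v (discretePotential V h v) -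
      inner ℂ (interpolate v) (potentialMul V h (interpolate v))‖ ≤
      (∑' k, ‖c k‖) * highMass v + 1024 * h ^ 3 * ‖v‖ ^ 2 * ∑' k, ‖k‖ ^ 3 * ‖c k‖ := by
    rw [← hsum.tsum_eq]
    refine (tsum_of_norm_bounded hsumE.hasSum fun k => ?_).trans (le_of_eq ?_)
    · rw [← mul_sub, norm_mul]
      calc ‖c k‖ * ‖a k - b k‖ ≤ ‖c k‖ * (highMass v + 1024 * h ^ 3 * ‖k‖ ^ 3 * ‖v‖ ^ 2) := by
            gcongr
            exact herr k
        _ = _ := by ring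
    · rw [(hc.mul_right _).tsum_add (hc3.mul_left _), tsum_mul_right, tsum_mul_left]
  rw [← Complex.sub_re]
  refine (Complex.abs_re_le_norm _).trans (hnorm.trans ?_)
  have h1 : 0 ≤ ∑' k, ‖c k‖ := tsum_nonneg fun k => norm_nonneg _
  have h2 : 0 ≤ ∑' k, ‖k‖ ^ 3 * ‖c k‖ := tsum_nonneg fun k => by positivity
  have h3 := highMass_le v
  have h4 : 0 ≤ h ^ 3 * ‖v‖ ^ 2 := by positivity
  have h5 : 0 ≤ ‖discreteKinetic n v‖ ^ 2 := by positivity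
  have h6 := mul_le_mul_of_nonneg_left h3 h1
  nlinarith [mul_nonneg h1 h4, mul_nonneg h2 h5]

end PotentialComparison

/-! ### Second differences against a nonnegative potential -/

section Commutator

variable {H : Type*} [NormedAddCommGroup H] [InnerProductSpace ℂ H]

/-- Summation by parts: U is isometric and U' is its right inverse, so ⟨u, U'u⟩ = ⟨Uu, u⟩. -/
theorem re_inner_second_difference_self {U U' : H → H}
    (hU : ∀ x y, inner ℂ (U x) (U y) = inner ℂ x y) (hUU : ∀ x, U (U' x) = x) (u : H) :
    (inner ℂ u ((2 : ℂ) • u - U u - U' u)).re = ‖u - U u‖ ^ 2 := by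
  have h1 : inner ℂ u (U' u) = inner ℂ (U u) u := by rw [← hU u (U' u), hUU]
  have h2 : ‖U u‖ ^ 2 = ‖u‖ ^ 2 := by
    rw [← inner_self_eq_norm_sq (𝕜 := ℂ), ← inner_self_eq_norm_sq (𝕜 := ℂ), hU]
  have h3 : (inner ℂ (U u) u).re = (inner ℂ u (U u)).re := by
    rw [← inner_conj_symm, Complex.conj_re]
  rw [@norm_sub_sq ℂ, h2, inner_sub_right, inner_sub_right, inner_smul_right, h1,
    inner_self_eq_norm_sq_to_K]
  simp only [Complex.sub_re, h3, RCLike.re_to_complex]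
  simp [← Complex.ofReal_pow]
  ring

/-- The commutator estimate: a second difference and a nonnegative potential are almost
nonnegatively correlated. -/
theorem re_inner_second_difference_ge {U U' : H → H}
    (hU : ∀ x y, inner ℂ (U x) (U y) = inner ℂ x y) (hUU : ∀ x, U (U' x) = x) {u w : H}
    {W' : H →ₗ[ℂ] H} (hW : U w = W' (U u)) (hW' : ∀ x, 0 ≤ (inner ℂ x (W' x)).re) :
    -(‖u - U u‖ * ‖w - W' u‖) ≤ (inner ℂ ((2 : ℂ) • u - U u - U' u) w).re := by
  have h1 : inner ℂ (U' u) w = inner ℂ u (U w) := by rw [← hU (U' u) w, hUU]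
  -- Summation by parts gives ⟨u - Uu, w - Uw⟩. With w = Wu and Uw = W'(Uu), the second factor
  -- splits as W'(u - Uu) + (W - W')u: a nonnegative term plus one that sees only the variation of
  -- the potential.
  have h2 : inner ℂ ((2 : ℂ) • u - U u - U' u) w =
      inner ℂ (u - U u) (W' (u - U u)) + inner ℂ (u - U u) (w - W' u) := by
    rw [← inner_add_right, map_sub, ← hW]
    have h3 : W' u - U w + (w - W' u) = w - U w := by abel
    rw [h3, inner_sub_left, inner_sub_left, inner_sub_left, inner_sub_right, inner_sub_right,
      inner_smul_left, h1, hU, map_ofNat]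
    ring
  rw [h2, Complex.add_re]
  have h3 := hW' (u - U u)
  have h4 : -(‖u - U u‖ * ‖w - W' u‖) ≤ (inner ℂ (u - U u) (w - W' u)).re := by
    have h5 := norm_inner_le_norm (𝕜 := ℂ) (u - U u) (w - W' u)
    have h6 := (abs_le.1 (Complex.abs_re_le_norm (inner ℂ (u - U u) (w - W' u)))).1
    linarith
  linarith

/-- Regularity of almost eigenvectors of `K + W`. -/
theorem norm_sq_add_norm_sq_le_of_almost_eigenvector {v k w : H} {lam ε B : ℝ} (hv : ‖v‖ = 1)
    (hlam : 0 ≤ lam) (h : ‖k + w - (lam : ℂ) • v‖ ≤ ε) (hB : -B ≤ (inner ℂ k w).re) :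
    ‖k‖ ^ 2 + ‖w‖ ^ 2 ≤ (lam + ε) ^ 2 + 2 * B ∧
      (inner ℂ v k).re + (inner ℂ v w).re ≤ lam + ε := by
  have h1 : ‖k + w‖ ≤ lam + ε := by
    have h2 := norm_le_norm_add_norm_sub' (k + w) ((lam : ℂ) • v)
    rw [norm_smul, Complex.norm_real, Real.norm_of_nonneg hlam, hv, mul_one] at h2
    linarith
  constructor
  · have h2 := @norm_add_sq ℂ H _ _ _ k w
    have h3 : ‖k + w‖ ^ 2 ≤ (lam + ε) ^ 2 := by gcongr
    simp only [RCLike.re_to_complex] at h2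
    linarith
  · rw [← Complex.add_re, ← inner_add_right]
    calc _ ≤ ‖inner ℂ v (k + w)‖ := Complex.re_le_norm _
      _ ≤ ‖v‖ * ‖k + w‖ := norm_inner_le_norm _ _
      _ ≤ lam + ε := by rw [hv, one_mul]; exact h1

end Commutator

/-! ### Quadratic forms and the commutator bound on the lattice -/

section DiscreteEstimates

variable {n : ℕ}

namespace PeriodicPotential

/-- The translate of a periodic potential. -/
def shift (V : PeriodicPotential n) (a : Space n) : PeriodicPotential n where
  toFun x := V (x + a)
  smooth := V.smooth.comp (contDiff_id.add contDiff_const)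
  periodic x γ := by rw [add_right_comm, V.periodic]

theorem shift_apply (V : PeriodicPotential n) (a x : Space n) : V.shift a x = V (x + a) := rfl

end PeriodicPotential

theorem hasSum_norm_sq_discrete (v : DiscreteL2 n) : HasSum (fun γ => ‖v γ‖ ^ 2) (‖v‖ ^ 2) := by
  have h := Complex.hasSum_re (lp.hasSum_inner v v)
  have h2 := @inner_self_eq_norm_sq ℂ _ _ _ _ v
  simp only [RCLike.re_to_complex] at h2
  rw [h2] at h
  refine HasSum.congr_fun h fun γ => ?_
  exact (inner_self_eq_norm_sq (𝕜 := ℂ) (v γ)).symm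

theorem hasSum_re_inner_discretePotential (V : PeriodicPotential n) (h : ℝ) (v : DiscreteL2 n) :
    HasSum (fun γ => V (h • latticePt γ) * ‖v γ‖ ^ 2) (inner ℂ v (discretePotential V h v)).re := by
  refine HasSum.congr_fun (Complex.hasSum_re (lp.hasSum_inner v (discretePotential V h v)))
    fun γ => ?_
  rw [discretePotential_apply]
  change _ = (((V (h • latticePt γ) : ℂ) * v γ) * starRingEnd ℂ (v γ)).re
  rw [mul_assoc, Complex.mul_conj, ← Complex.ofReal_mul, Complex.ofReal_re,
    Complex.normSq_eq_norm_sq]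

theorem re_inner_discretePotential_nonneg {V : PeriodicPotential n} (hV : ∀ x, 0 ≤ V x) (h : ℝ)
    (v : DiscreteL2 n) : 0 ≤ (inner ℂ v (discretePotential V h v)).re :=
  (hasSum_re_inner_discretePotential V h v).nonneg fun γ => mul_nonneg (hV _) (by positivity)

theorem re_inner_discretePotential_le {V : PeriodicPotential n} {C : ℝ} (hV : ∀ x, V x ≤ C) (h : ℝ)
    (v : DiscreteL2 n) : (inner ℂ v (discretePotential V h v)).re ≤ C * ‖v‖ ^ 2 :=
  hasSum_le (fun γ => mul_le_mul_of_nonneg_right (hV _) (by positivity))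
    (hasSum_re_inner_discretePotential V h v) ((hasSum_norm_sq_discrete v).mul_left C)

theorem inner_discretePotential_left (V : PeriodicPotential n) (h : ℝ) (v w : DiscreteL2 n) :
    inner ℂ (discretePotential V h v) w = inner ℂ v (discretePotential V h w) := by
  refine (lp.hasSum_inner _ w).unique (HasSum.congr_fun (lp.hasSum_inner v _) fun γ => ?_)
  rw [discretePotential_apply, discretePotential_apply]
  change _ * starRingEnd ℂ _ = (_ * _) * starRingEnd ℂ (v γ)
  rw [map_mul, Complex.conj_ofReal]
  ring

theorem inner_discreteKinetic_left (v w : DiscreteL2 n) :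
    inner ℂ (discreteKinetic n v) w = inner ℂ v (discreteKinetic n w) := by
  rw [← (torusFourier n).inner_map_map, ← (torusFourier n).inner_map_map v, L2.inner_def,
    L2.inner_def]
  refine integral_congr_ae ?_
  filter_upwards [torusFourier_discreteKinetic v, torusFourier_discreteKinetic w] with t h1 h2
  rw [h1, h2]
  change _ * starRingEnd ℂ _ = (_ * _) * starRingEnd ℂ (torusFourier n v t)
  rw [map_mul, Complex.conj_ofReal]
  ring

theorem isSelfAdjoint_discreteOp (V : PeriodicPotential n) (h : ℝ) :
    IsSelfAdjoint (discreteOp V h) := by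
  rw [ContinuousLinearMap.isSelfAdjoint_iff_isSymmetric]
  intro v w
  change inner ℂ (discreteOp V h v) w = inner ℂ v (discreteOp V h w)
  rw [discreteOp_eq, _root_.add_apply, _root_.add_apply, inner_add_left, inner_add_right,
    inner_discretePotential_left, inner_discreteKinetic_left]

theorem nontrivial_discreteL2 (n : ℕ) : Nontrivial (DiscreteL2 n) := by
  refine ⟨lp.single 2 0 1, 0, fun h => ?_⟩
  have h1 := congrArg (fun v : DiscreteL2 n => v 0) h
  simp at h1

theorem re_inner_discreteKinetic_le (v : DiscreteL2 n) :
    (inner ℂ v (discreteKinetic n v)).re ≤ 4 * n * ‖v‖ ^ 2 := by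
  rw [re_inner_discreteKinetic, norm_sq_eq_integral_torus, ← integral_const_mul]
  refine integral_mono ?_ ((lp_integrable_norm_sq _).const_mul _) fun t => ?_
  · refine integrable_bdd_mul_norm_sq_torus v (C := 4 * n)
      continuous_discreteSymbol.measurable fun ξ _ => ?_
    rw [abs_of_nonneg (discreteSymbol_nonneg ξ)]
    exact discreteSymbol_le ξ
  · exact mul_le_mul_of_nonneg_right (discreteSymbol_le _) (by positivity)

theorem norm_sq_discretePotential_sub_le {V W : PeriodicPotential n} {h A B : ℝ}
    (hVW : ∀ x, (V x - W x) ^ 2 ≤ A * V x + B) (v : DiscreteL2 n) :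
    ‖discretePotential V h v - discretePotential W h v‖ ^ 2 ≤
      A * (inner ℂ v (discretePotential V h v)).re + B * ‖v‖ ^ 2 := by
  refine hasSum_le (fun γ => ?_) (hasSum_norm_sq_discrete _)
    (((hasSum_re_inner_discretePotential V h v).mul_left A).add
      ((hasSum_norm_sq_discrete v).mul_left B))
  rw [lp.coeFn_sub, Pi.sub_apply, discretePotential_apply, discretePotential_apply, ← sub_mul,
    norm_mul, mul_pow, ← Complex.ofReal_sub, Complex.norm_real, Real.norm_eq_abs, sq_abs]
  nlinarith [hVW (h • latticePt γ), sq_nonneg ‖v γ‖]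

/-- Weighted arithmetic-geometric mean: a factor of size h in b comes out as a factor h of the whole
bound. -/
theorem sq_mul_le_of_sq_le {a b h q : ℝ} (hh : 0 < h) (hb : b ^ 2 ≤ h ^ 2 * q) :
    a * b ≤ h * (a ^ 2 + q) := by
  have h1 : (b / h) ^ 2 ≤ q := by
    rw [div_pow, div_le_iff₀ (by positivity)]
    linarith
  have h2 : a * b = h * (a * (b / h)) := by field_simp
  rw [h2]
  refine mul_le_mul_of_nonneg_left ?_ hh.le
  nlinarith [sq_nonneg (a - b / h), sq_nonneg a, sq_nonneg (b / h)]

/-- The translation `v ↦ v (· + δ)` on `ℓ²(ℤⁿ)`. -/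
noncomputable abbrev latticeShift (δ : Fin n → ℤ) : DiscreteL2 n →L[ℂ] DiscreteL2 n :=
  weightedShift (fun _ => 1) 1 zero_le_one (by simp) (Equiv.addRight δ)

theorem latticeShift_apply (δ : Fin n → ℤ) (v : DiscreteL2 n) (γ : Fin n → ℤ) :
    latticeShift δ v γ = v (γ + δ) :=
  one_mul _

theorem inner_latticeShift (δ : Fin n → ℤ) (v w : DiscreteL2 n) :
    inner ℂ (latticeShift δ v) (latticeShift δ w) = inner ℂ v w := by
  refine (lp.hasSum_inner _ _).unique ?_
  refine HasSum.congr_fun ((Equiv.addRight δ).hasSum_iff.2 (lp.hasSum_inner v w)) fun γ => ?_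
  rw [latticeShift_apply, latticeShift_apply]
  rfl

theorem discreteKinetic_apply (v : DiscreteL2 n) :
    discreteKinetic n v = ∑ j : Fin n, ((2 : ℂ) • v - latticeShift (Pi.single j 1) v -
      latticeShift (-Pi.single j 1) v) := by
  ext γ
  simp only [discreteKinetic, _root_.sum_apply, _root_.sub_apply, lp.coeFn_sum, Finset.sum_apply,
    lp.coeFn_sub, Pi.sub_apply]
  refine Finset.sum_congr rfl fun j _ => ?_
  rw [latticeShift_apply, latticeShift_apply]
  congr 1
  · congr 1
    simp [two_smul]
  · exact (one_mul _).trans (by simp [sub_eq_add_neg])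

/-- Each coordinate direction contributes an error ‖v - Uv‖ ‖(W - W')v‖. The first factor is part of
the kinetic energy; the square of the second is at most C h²(⟨v, Wv⟩ + h²‖v‖²), because V varies
slowly where it is small. A bound of the variation by a constant multiple of h alone would not
involve the energy and would be too weak. -/
theorem exists_re_inner_discreteKinetic_discretePotential_ge {V : PeriodicPotential n}
    (hV : ∀ x, 0 ≤ V x) : ∃ C : ℝ, 0 < C ∧ ∀ h : ℝ, 0 < h → ∀ v : DiscreteL2 n,
      -(C * h * ((inner ℂ v (discreteKinetic n v)).re + (inner ℂ v (discretePotential V h v)).re +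
        h ^ 2 * ‖v‖ ^ 2)) ≤ (inner ℂ (discreteKinetic n v) (discretePotential V h v)).re := by
  obtain ⟨C, hC0, hC⟩ := PeriodicPotential.exists_sub_sq_le_of_nonneg hV
  refine ⟨n * C + 1, by positivity, fun h hh v => ?_⟩
  set U : Fin n → DiscreteL2 n →L[ℂ] DiscreteL2 n := fun j => latticeShift (Pi.single j 1)
  set U' : Fin n → DiscreteL2 n →L[ℂ] DiscreteL2 n := fun j => latticeShift (-Pi.single j 1)
  set q := (inner ℂ v (discretePotential V h v)).re with hq
  have hq0 : 0 ≤ q := re_inner_discretePotential_nonneg hV h v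
  have hUU : ∀ j x, U j (U' j x) = x := fun j x => by
    ext γ
    rw [latticeShift_apply, latticeShift_apply, add_neg_cancel_right]
  have hk : (inner ℂ v (discreteKinetic n v)).re = ∑ j, ‖v - U j v‖ ^ 2 := by
    rw [discreteKinetic_apply, inner_sum, Complex.re_sum]
    exact Finset.sum_congr rfl fun j _ =>
      re_inner_second_difference_self (inner_latticeShift _) (hUU j) v
  have hk0 : 0 ≤ (inner ℂ v (discreteKinetic n v)).re := by
    rw [hk]
    positivity
  have hterm : ∀ j, -(h * (‖v - U j v‖ ^ 2 + C * (q + h ^ 2 * ‖v‖ ^ 2))) ≤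
      (inner ℂ ((2 : ℂ) • v - U j v - U' j v) (discretePotential V h v)).re := by
    intro j
    -- One lattice step moves the argument of V by h, so conjugating by the shift replaces V by its
    -- translate by h e_j.
    set W' := discretePotential (V.shift (h • latticePt (Pi.single j 1))) h
    have h1 := re_inner_second_difference_ge (U := U j) (U' := U' j) (u := v)
      (w := discretePotential V h v) (W' := W'.toLinearMap) (inner_latticeShift _) (hUU j) (by
        ext γ
        change _ = W' (U j v) γ
        rw [latticeShift_apply, discretePotential_apply, discretePotential_apply,
          latticeShift_apply, PeriodicPotential.shift_apply, ← smul_add]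
        congr 4
        ext i
        simp [latticePt])
      (re_inner_discretePotential_nonneg (V := V.shift _) (fun x => hV _) h)
    refine le_trans (neg_le_neg ?_) h1
    refine sq_mul_le_of_sq_le hh ?_
    have hn : ‖h • latticePt (Pi.single j 1 : Fin n → ℤ)‖ = h := by
      rw [latticePt_single, norm_smul]
      simp [hh.le]
    have h2 := norm_sq_discretePotential_sub_le (V := V)
      (W := V.shift (h • latticePt (Pi.single j 1))) (h := h) (A := C * h ^ 2) (B := C * h ^ 4)
      (fun x => by
        have h3 := hC x (h • latticePt (Pi.single j 1))
        rw [hn] at h3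
        rw [PeriodicPotential.shift_apply]
        nlinarith [h3]) v
    refine h2.trans (le_of_eq ?_)
    rw [← hq]
    ring
  have hsum : ∑ j, -(h * (‖v - U j v‖ ^ 2 + C * (q + h ^ 2 * ‖v‖ ^ 2))) ≤
      (inner ℂ (discreteKinetic n v) (discretePotential V h v)).re := by
    conv_rhs => rw [discreteKinetic_apply, sum_inner, Complex.re_sum]
    exact Finset.sum_le_sum fun j _ => hterm j
  refine le_trans ?_ hsum
  rw [Finset.sum_neg_distrib, ← Finset.mul_sum, Finset.sum_add_distrib, ← hk]
  simp only [Finset.sum_const, Finset.card_univ, Fintype.card_fin, nsmul_eq_mul]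
  have h5 : 0 ≤ (n : ℝ) * C * (inner ℂ v (discreteKinetic n v)).re := by positivity
  have h6 : 0 ≤ q + h ^ 2 * ‖v‖ ^ 2 := by positivity
  nlinarith [mul_nonneg hh.le h5, mul_nonneg hh.le h6]

end DiscreteEstimates

/-! ### Quadratic forms and the commutator bound on Euclidean space -/

section ContinuousEstimates

variable {n : ℕ}

theorem integrable_potential_mul_norm_sq (V : PeriodicPotential n) (h : ℝ) (u : ContinuousL2 n) :
    Integrable fun x => V (h • x) * ‖u x‖ ^ 2 := by
  obtain ⟨C, -, hC⟩ := V.exists_bound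
  exact (lp_integrable_norm_sq u).bdd_mul (c := C)
    (V.smooth.continuous.comp (continuous_const_smul h)).aestronglyMeasurable
    (Filter.Eventually.of_forall fun x => hC _)

theorem re_inner_potentialMul (V : PeriodicPotential n) (h : ℝ) (u : ContinuousL2 n) :
    (inner ℂ u (potentialMul V h u)).re = ∫ x, V (h • x) * ‖u x‖ ^ 2 := by
  rw [lp_re_inner_eq_integral]
  refine integral_congr_ae ?_
  filter_upwards [potentialMul_coeFn V h u] with x hx
  rw [hx, mul_assoc, Complex.mul_conj, ← Complex.ofReal_mul, Complex.ofReal_re,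
    Complex.normSq_eq_norm_sq]

theorem re_inner_potentialMul_nonneg {V : PeriodicPotential n} (hV : ∀ x, 0 ≤ V x) (h : ℝ)
    (u : ContinuousL2 n) : 0 ≤ (inner ℂ u (potentialMul V h u)).re := by
  rw [re_inner_potentialMul]
  exact integral_nonneg fun x => mul_nonneg (hV _) (by positivity)

theorem re_inner_potentialMul_le {V : PeriodicPotential n} {C : ℝ} (hV : ∀ x, V x ≤ C) (h : ℝ)
    (u : ContinuousL2 n) : (inner ℂ u (potentialMul V h u)).re ≤ C * ‖u‖ ^ 2 := by
  rw [re_inner_potentialMul, lp_norm_sq_eq_integral, ← integral_const_mul]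
  exact integral_mono (integrable_potential_mul_norm_sq V h u)
    ((lp_integrable_norm_sq u).const_mul C)
    fun x => mul_le_mul_of_nonneg_right (hV _) (by positivity)

theorem inner_potentialMul_left (V : PeriodicPotential n) (h : ℝ) (u w : ContinuousL2 n) :
    inner ℂ (potentialMul V h u) w = inner ℂ u (potentialMul V h w) := by
  rw [L2.inner_def, L2.inner_def]
  refine integral_congr_ae ?_
  filter_upwards [potentialMul_coeFn V h u, potentialMul_coeFn V h w] with x h1 h2
  rw [h1, h2]
  change _ * starRingEnd ℂ _ = (_ * _) * starRingEnd ℂ (u x)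
  rw [map_mul, Complex.conj_ofReal]
  ring

theorem norm_sq_potentialMul_sub_le {V W : PeriodicPotential n} {h A B : ℝ}
    (hVW : ∀ x, (V x - W x) ^ 2 ≤ A * V x + B) (u : ContinuousL2 n) :
    ‖potentialMul V h u - potentialMul W h u‖ ^ 2 ≤
      A * (inner ℂ u (potentialMul V h u)).re + B * ‖u‖ ^ 2 := by
  rw [re_inner_potentialMul, lp_norm_sq_eq_integral, lp_norm_sq_eq_integral u,
    ← integral_const_mul, ← integral_const_mul,
    ← integral_add ((integrable_potential_mul_norm_sq V h u).const_mul A)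
      ((lp_integrable_norm_sq u).const_mul B)]
  refine integral_mono_ae (lp_integrable_norm_sq _)
    (((integrable_potential_mul_norm_sq V h u).const_mul A).add
      ((lp_integrable_norm_sq u).const_mul B)) ?_
  filter_upwards [Lp.coeFn_sub (potentialMul V h u) (potentialMul W h u),
    potentialMul_coeFn V h u, potentialMul_coeFn W h u] with x h1 h2 h3
  rw [h1, Pi.sub_apply, h2, h3, ← sub_mul, norm_mul, mul_pow, ← Complex.ofReal_sub,
    Complex.norm_real, Real.norm_eq_abs, sq_abs]
  change _ ≤ A * (V (h • x) * ‖u x‖ ^ 2) + B * ‖u x‖ ^ 2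
  nlinarith [hVW (h • x), sq_nonneg ‖u x‖]

theorem spaceShift_potentialMul (V : PeriodicPotential n) (h : ℝ) (a : Space n)
    (u : ContinuousL2 n) :
    spaceShift a (potentialMul V h u) = potentialMul (V.shift (h • a)) h (spaceShift a u) := by
  apply Lp.ext
  filter_upwards [spaceShift_coeFn a (potentialMul V h u),
    (measurePreserving_add_right_space a).quasiMeasurePreserving.ae (potentialMul_coeFn V h u),
    potentialMul_coeFn (V.shift (h • a)) h (spaceShift a u), spaceShift_coeFn a u]
    with x h1 h2 h3 h4
  rw [h1, h2, h3, h4, PeriodicPotential.shift_apply, smul_add]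

/-! ### Kinetic energy -/

theorem re_inner_neg_laplacianH2_left (u : sobolevH2 n) (w : ContinuousL2 n) :
    (inner ℂ (-laplacianH2 n u) w).re =
      ∫ ξ, kineticSymbol ξ * (fourierL2 n w ξ * starRingEnd ℂ (fourierL2 n u ξ)).re := by
  rw [← (fourierL2 n).inner_map_map, lp_re_inner_eq_integral]
  refine integral_congr_ae ?_
  filter_upwards [fourier_neg_laplacianH2 u] with ξ h1
  rw [h1, map_mul, Complex.conj_ofReal, mul_left_comm, Complex.re_ofReal_mul]

theorem integrable_kineticSymbol_mul (u : sobolevH2 n) (w : ContinuousL2 n) :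
    Integrable fun ξ =>
      kineticSymbol ξ * (fourierL2 n w ξ * starRingEnd ℂ (fourierL2 n u ξ)).re := by
  refine (lp_integrable_re_inner (fourierL2 n (-laplacianH2 n u)) (fourierL2 n w)).congr ?_
  filter_upwards [fourier_neg_laplacianH2 u] with ξ h1
  rw [h1, map_mul, Complex.conj_ofReal, mul_left_comm, Complex.re_ofReal_mul]

theorem inner_neg_laplacianH2_left (u w : sobolevH2 n) :
    inner ℂ (-laplacianH2 n u) (w : ContinuousL2 n) =
      inner ℂ (u : ContinuousL2 n) (-laplacianH2 n w) := by
  rw [← (fourierL2 n).inner_map_map, ← (fourierL2 n).inner_map_map (u : ContinuousL2 n),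
    L2.inner_def, L2.inner_def]
  refine integral_congr_ae ?_
  filter_upwards [fourier_neg_laplacianH2 u, fourier_neg_laplacianH2 w] with ξ h1 h2
  rw [h1, h2]
  change _ * starRingEnd ℂ _ = (_ * _) * starRingEnd ℂ _
  rw [map_mul, Complex.conj_ofReal]
  ring

theorem integrable_kineticSymbol_mul_norm_sq (u : sobolevH2 n) :
    Integrable fun ξ => kineticSymbol ξ * ‖fourierL2 n (u : ContinuousL2 n) ξ‖ ^ 2 := by
  refine (integrable_kineticSymbol_mul u u).congr (Filter.Eventually.of_forall fun ξ => ?_)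
  simp only [Complex.mul_conj, Complex.normSq_eq_norm_sq, Complex.ofReal_re]

theorem re_inner_neg_laplacianH2 (u : sobolevH2 n) :
    (inner ℂ (u : ContinuousL2 n) (-laplacianH2 n u)).re =
      ∫ ξ, kineticSymbol ξ * ‖fourierL2 n (u : ContinuousL2 n) ξ‖ ^ 2 := by
  rw [← inner_neg_laplacianH2_left, re_inner_neg_laplacianH2_left]
  refine integral_congr_ae (Filter.Eventually.of_forall fun ξ => ?_)
  simp only [Complex.mul_conj, Complex.normSq_eq_norm_sq, Complex.ofReal_re]

theorem re_inner_neg_laplacianH2_nonneg (u : sobolevH2 n) :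
    0 ≤ (inner ℂ (u : ContinuousL2 n) (-laplacianH2 n u)).re := by
  rw [re_inner_neg_laplacianH2]
  exact integral_nonneg fun ξ => mul_nonneg (kineticSymbol_nonneg ξ) (by positivity)

theorem norm_sq_neg_laplacianH2 (u : sobolevH2 n) :
    ‖-laplacianH2 n u‖ ^ 2 =
      ∫ ξ, kineticSymbol ξ ^ 2 * ‖fourierL2 n (u : ContinuousL2 n) ξ‖ ^ 2 := by
  rw [← (fourierL2 n).norm_map, lp_norm_sq_eq_integral]
  refine integral_congr_ae ?_
  filter_upwards [fourier_neg_laplacianH2 u] with ξ h1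
  rw [h1, norm_mul, mul_pow, Complex.norm_real, Real.norm_eq_abs, sq_abs]

theorem integrable_kineticSymbol_sq_mul_norm_sq (u : sobolevH2 n) :
    Integrable fun ξ => kineticSymbol ξ ^ 2 * ‖fourierL2 n (u : ContinuousL2 n) ξ‖ ^ 2 := by
  refine (lp_integrable_norm_sq (fourierL2 n (-laplacianH2 n u))).congr ?_
  filter_upwards [fourier_neg_laplacianH2 u] with ξ h1
  rw [h1, norm_mul, mul_pow, Complex.norm_real, Real.norm_eq_abs, sq_abs]

theorem norm_sq_one_sub_planeWave_le (y ξ : Space n) :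
    ‖1 - planeWave y ξ‖ ^ 2 ≤ ‖y‖ ^ 2 * kineticSymbol ξ := by
  rw [norm_one_sub_planeWave_sq]
  have h1 := Real.one_sub_sq_div_two_le_cos (x := 2 * Real.pi * inner ℝ y ξ)
  have h2 : (inner ℝ y ξ) ^ 2 ≤ (‖y‖ * ‖ξ‖) ^ 2 := by
    rw [← sq_abs]
    exact pow_le_pow_left₀ (abs_nonneg _) (abs_real_inner_le_norm y ξ) 2
  unfold kineticSymbol
  nlinarith [mul_le_mul_of_nonneg_left h2 (sq_nonneg Real.pi)]

theorem norm_sq_sub_spaceShift_eq (y : Space n) (u : ContinuousL2 n) :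
    ‖u - spaceShift y u‖ ^ 2 = ∫ ξ, ‖1 - planeWave y ξ‖ ^ 2 * ‖fourierL2 n u ξ‖ ^ 2 := by
  rw [← (fourierL2 n).norm_map, map_sub, fourier_translate, lp_norm_sq_eq_integral]
  refine integral_congr_ae ?_
  filter_upwards [Lp.coeFn_sub (fourierL2 n u)
    (boundedMul (planeWave y) (memLp_planeWave y) (fourierL2 n u)),
    boundedMul_coeFn (planeWave y) (memLp_planeWave y) (fourierL2 n u)] with ξ h1 h2
  rw [h1, Pi.sub_apply, h2, ← one_sub_mul, norm_mul, mul_pow]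

theorem norm_sq_sub_spaceShift_le (y : Space n) (u : sobolevH2 n) :
    ‖(u : ContinuousL2 n) - spaceShift y (u : ContinuousL2 n)‖ ^ 2 ≤
      ‖y‖ ^ 2 * (inner ℂ (u : ContinuousL2 n) (-laplacianH2 n u)).re := by
  rw [norm_sq_sub_spaceShift_eq, re_inner_neg_laplacianH2, ← integral_const_mul]
  refine integral_mono_of_nonneg (Filter.Eventually.of_forall fun ξ => by positivity)
    ((integrable_kineticSymbol_mul_norm_sq u).const_mul _)
    (Filter.Eventually.of_forall fun ξ => ?_)
  change _ ≤ ‖y‖ ^ 2 * (kineticSymbol ξ * _)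
  rw [← mul_assoc]
  exact mul_le_mul_of_nonneg_right (norm_sq_one_sub_planeWave_le y ξ) (by positivity)

theorem re_inner_second_difference_spaceShift (y : Space n) (u w : ContinuousL2 n) :
    (inner ℂ ((2 : ℂ) • u - spaceShift y u - spaceShift (-y) u) w).re =
      ∫ ξ, (2 - 2 * Real.cos (2 * Real.pi * inner ℝ y ξ)) *
        (fourierL2 n w ξ * starRingEnd ℂ (fourierL2 n u ξ)).re := by
  rw [← (fourierL2 n).inner_map_map, lp_re_inner_eq_integral]
  refine integral_congr_ae ?_
  rw [map_sub, map_sub, map_smul, fourier_translate, fourier_translate]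
  filter_upwards [Lp.coeFn_sub ((2 : ℂ) • fourierL2 n u -
      boundedMul (planeWave y) (memLp_planeWave y) (fourierL2 n u))
      (boundedMul (planeWave (-y)) (memLp_planeWave (-y)) (fourierL2 n u)),
    Lp.coeFn_sub ((2 : ℂ) • fourierL2 n u)
      (boundedMul (planeWave y) (memLp_planeWave y) (fourierL2 n u)),
    Lp.coeFn_smul (2 : ℂ) (fourierL2 n u),
    boundedMul_coeFn (planeWave y) (memLp_planeWave y) (fourierL2 n u),
    boundedMul_coeFn (planeWave (-y)) (memLp_planeWave (-y)) (fourierL2 n u)] with ξ h1 h2 h3 h4 h5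
  rw [h1, Pi.sub_apply, h2, Pi.sub_apply, h3, Pi.smul_apply, h4, h5, smul_eq_mul]
  have hs : (2 : ℂ) * fourierL2 n u ξ - planeWave y ξ * fourierL2 n u ξ -
      planeWave (-y) ξ * fourierL2 n u ξ =
      ((2 - 2 * Real.cos (2 * Real.pi * inner ℝ y ξ) : ℝ) : ℂ) * fourierL2 n u ξ := by
    rw [← sub_mul, ← sub_mul]
    congr 1
    rw [planeWave_comm (-y), planeWave_neg, planeWave_comm ξ, sub_sub, Complex.add_conj,
      planeWave_eq_exp, Complex.exp_ofReal_mul_I_re]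
    push_cast
    ring
  rw [hs, map_mul, Complex.conj_ofReal, mul_left_comm, Complex.re_ofReal_mul]

theorem tendsto_two_sub_two_mul_cos_div_sq (a : ℝ) :
    Filter.Tendsto (fun t : ℝ => (2 - 2 * Real.cos (a * t)) / t ^ 2) (nhdsWithin 0 (Ioi 0))
      (nhds (a ^ 2)) := by
  have h1 : HasDerivAt (fun t : ℝ => 2 * Real.sin (a / 2 * t)) a 0 := by
    have h2 := ((hasDerivAt_id (0 : ℝ)).const_mul (a / 2)).sin.const_mul 2
    simpa [mul_div_cancel₀] using h2
  have h3 := (hasDerivAt_iff_tendsto_slope.1 h1).mono_left (nhdsGT_le_nhdsNE 0)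
  refine (h3.pow 2).congr' ?_
  filter_upwards [self_mem_nhdsWithin] with t ht
  have ht0 : t ≠ 0 := ne_of_gt ht
  rw [slope_def_field]
  simp only [mul_zero, Real.sin_zero, sub_zero, div_pow]
  congr 1
  have h4 := Real.cos_two_mul' (a / 2 * t)
  have h5 := Real.sin_sq_add_cos_sq (a / 2 * t)
  rw [show 2 * (a / 2 * t) = a * t by ring] at h4
  rw [h4]
  nlinarith

theorem tendsto_discreteSymbol_smul_div_sq (ξ : Space n) :
    Filter.Tendsto (fun t : ℝ => discreteSymbol (t • ξ) / t ^ 2) (nhdsWithin 0 (Ioi 0))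
      (nhds (kineticSymbol ξ)) := by
  have h1 : kineticSymbol ξ = ∑ j, (2 * Real.pi * ξ j) ^ 2 := by
    rw [kineticSymbol, EuclideanSpace.norm_sq_eq, Finset.mul_sum]
    refine Finset.sum_congr rfl fun j _ => ?_
    rw [Real.norm_eq_abs, sq_abs]
    ring
  rw [h1]
  simp_rw [discreteSymbol, Finset.sum_div]
  refine tendsto_finsetSum _ fun j _ => ?_
  refine (tendsto_two_sub_two_mul_cos_div_sq (2 * Real.pi * ξ j)).congr fun t => ?_
  rw [PiLp.smul_apply, smul_eq_mul]
  ring_nf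

theorem discreteSymbol_le_kineticSymbol (ξ : Space n) : discreteSymbol ξ ≤ kineticSymbol ξ := by
  rw [discreteSymbol, kineticSymbol, EuclideanSpace.norm_sq_eq, Finset.mul_sum]
  refine Finset.sum_le_sum fun j _ => ?_
  rw [Real.norm_eq_abs, sq_abs]
  nlinarith [Real.one_sub_sq_div_two_le_cos (x := 2 * Real.pi * ξ j)]

theorem kineticSymbol_smul (t : ℝ) (ξ : Space n) :
    kineticSymbol (t • ξ) = t ^ 2 * kineticSymbol ξ := by
  rw [kineticSymbol, kineticSymbol, norm_smul, mul_pow, Real.norm_eq_abs, sq_abs]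
  ring

theorem continuous_kineticSymbol : Continuous (kineticSymbol (n := n)) := by
  unfold kineticSymbol
  fun_prop

/-- The Laplacian as a limit of second differences of step t, tested against w. Dominated
convergence applies because d(tξ)/t² ≤ k(ξ). In this way no derivative of V u is ever taken. -/
theorem tendsto_integral_discreteSymbol (u : sobolevH2 n) (w : ContinuousL2 n) :
    Filter.Tendsto (fun t : ℝ => ∫ ξ, discreteSymbol (t • ξ) / t ^ 2 *
        (fourierL2 n w ξ * starRingEnd ℂ (fourierL2 n (u : ContinuousL2 n) ξ)).re)
      (nhdsWithin 0 (Ioi 0)) (nhds (inner ℂ (-laplacianH2 n u) w).re) := by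
  rw [re_inner_neg_laplacianH2_left]
  refine tendsto_integral_filter_of_dominated_convergence
    (fun ξ => ‖kineticSymbol ξ *
      (fourierL2 n w ξ * starRingEnd ℂ (fourierL2 n (u : ContinuousL2 n) ξ)).re‖) ?_ ?_
    (integrable_kineticSymbol_mul u w).norm ?_
  · refine Filter.Eventually.of_forall fun t => ?_
    refine AEStronglyMeasurable.mul ?_ (lp_integrable_re_inner (fourierL2 n u)
      (fourierL2 n w)).aestronglyMeasurable
    exact ((continuous_discreteSymbol.comp (continuous_const_smul t)).div_const
      _).aestronglyMeasurable
  · filter_upwards [self_mem_nhdsWithin] with t ht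
    have ht0 : 0 < t := ht
    refine Filter.Eventually.of_forall fun ξ => ?_
    rw [norm_mul, norm_mul]
    refine mul_le_mul_of_nonneg_right ?_ (norm_nonneg _)
    rw [Real.norm_of_nonneg (kineticSymbol_nonneg ξ),
      Real.norm_of_nonneg (div_nonneg (discreteSymbol_nonneg _) (sq_nonneg t)),
      div_le_iff₀ (by positivity), mul_comm, ← kineticSymbol_smul]
    exact discreteSymbol_le_kineticSymbol _
  · refine Filter.Eventually.of_forall fun ξ => ?_
    exact (tendsto_discreteSymbol_smul_div_sq ξ).mul_const _

theorem sum_re_inner_second_difference (t : ℝ) (u w : ContinuousL2 n) :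
    ∑ j : Fin n, (inner ℂ ((2 : ℂ) • u - spaceShift (t • EuclideanSpace.single j 1) u -
        spaceShift (-(t • EuclideanSpace.single j 1)) u) w).re =
      ∫ ξ, discreteSymbol (t • ξ) *
        (fourierL2 n w ξ * starRingEnd ℂ (fourierL2 n u ξ)).re := by
  simp_rw [re_inner_second_difference_spaceShift]
  rw [← integral_finsetSum]
  · refine integral_congr_ae (Filter.Eventually.of_forall fun ξ => ?_)
    simp only [discreteSymbol, Finset.sum_mul]
    refine Finset.sum_congr rfl fun j _ => ?_
    rw [real_inner_smul_left, EuclideanSpace.inner_single_left, PiLp.smul_apply, smul_eq_mul]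
    simp
  · intro j _
    refine (lp_integrable_re_inner (fourierL2 n u) (fourierL2 n w)).bdd_mul (c := 4) ?_
      (Filter.Eventually.of_forall fun ξ => ?_)
    · exact Continuous.aestronglyMeasurable (by fun_prop)
    · rw [Real.norm_eq_abs, abs_le]
      constructor <;> nlinarith [Real.neg_one_le_cos (2 * Real.pi *
        inner ℝ (t • EuclideanSpace.single j (1 : ℝ)) ξ), Real.cos_le_one (2 * Real.pi *
        inner ℝ (t • EuclideanSpace.single j (1 : ℝ)) ξ)]

/-- The same commutator argument for second differences of step t, divided by t² before letting t
tend to 0. Both factors of the error are of size t, so the bound survives the limit. -/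
theorem exists_re_inner_neg_laplacianH2_potentialMul_ge {V : PeriodicPotential n}
    (hV : ∀ x, 0 ≤ V x) : ∃ C : ℝ, 0 < C ∧ ∀ h : ℝ, 0 < h → ∀ u : sobolevH2 n,
      -(C * h * ((inner ℂ (u : ContinuousL2 n) (-laplacianH2 n u)).re +
        (inner ℂ (u : ContinuousL2 n) (potentialMul V h u)).re +
        h ^ 2 * ‖(u : ContinuousL2 n)‖ ^ 2)) ≤
        (inner ℂ (-laplacianH2 n u) (potentialMul V h u)).re := by
  obtain ⟨C, hC0, hC⟩ := PeriodicPotential.exists_sub_sq_le_of_nonneg hV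
  refine ⟨n * (C + 1) + 1, by positivity, fun h hh u => ?_⟩
  have hq0 : 0 ≤ (inner ℂ (u : ContinuousL2 n) (potentialMul V h u)).re :=
    re_inner_potentialMul_nonneg hV h u
  have hk0 := re_inner_neg_laplacianH2_nonneg u
  set q := (inner ℂ (u : ContinuousL2 n) (potentialMul V h u)).re with hq
  set k := (inner ℂ (u : ContinuousL2 n) (-laplacianH2 n u)).re with hk
  have hm0 : 0 ≤ h ^ 2 * ‖(u : ContinuousL2 n)‖ ^ 2 := by positivity
  refine ge_of_tendsto (tendsto_integral_discreteSymbol u (potentialMul V h u)) ?_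
  -- The restriction t ≤ 1 serves to replace t⁴ by t² in the variation of V.
  filter_upwards [Ioc_mem_nhdsGT (zero_lt_one' ℝ)] with t ht
  obtain ⟨ht0, ht1⟩ := ht
  have hterm : ∀ j : Fin n, -(t ^ 2 * (h * (k + C * (q + h ^ 2 * ‖(u : ContinuousL2 n)‖ ^ 2)))) ≤
      (inner ℂ ((2 : ℂ) • (u : ContinuousL2 n) - spaceShift (t • EuclideanSpace.single j 1) u -
        spaceShift (-(t • EuclideanSpace.single j 1)) u) (potentialMul V h u)).re := by
    intro j
    set y : Space n := t • EuclideanSpace.single j 1 with hy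
    have hyn : ‖y‖ = t := by
      rw [hy, norm_smul]
      simp [ht0.le]
    have h1 := re_inner_second_difference_ge (U := spaceShift y) (U' := spaceShift (-y))
      (u := (u : ContinuousL2 n)) (w := potentialMul V h u) (W' := potentialMul (V.shift (h • y)) h)
      (spaceShift y).inner_map_map (translate_translate_neg y)
      (spaceShift_potentialMul V h y u)
      (re_inner_potentialMul_nonneg (V := V.shift _) (fun x => hV _) h)
    refine le_trans (neg_le_neg ?_) h1
    set a := ‖(u : ContinuousL2 n) - spaceShift y u‖
    set b := ‖potentialMul V h u - potentialMul (V.shift (h • y)) h u‖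
    have ha : a ^ 2 ≤ t ^ 2 * k := by
      have := norm_sq_sub_spaceShift_le y u
      rwa [hyn] at this
    have hb : b ^ 2 ≤ C * (h ^ 2 * t ^ 2) * q + C * (h ^ 4 * t ^ 4) * ‖(u : ContinuousL2 n)‖ ^ 2 := by
      refine norm_sq_potentialMul_sub_le (V := V) (W := V.shift (h • y)) (h := h) (fun x => ?_) u
      have h3 := hC x (h • y)
      rw [norm_smul, hyn, Real.norm_of_nonneg hh.le] at h3
      rw [PeriodicPotential.shift_apply]
      nlinarith [h3]
    have hb2 : b ^ 2 ≤ h ^ 2 * (t ^ 2 * (C * (q + h ^ 2 * ‖(u : ContinuousL2 n)‖ ^ 2))) := by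
      have h4 : t ^ 4 ≤ t ^ 2 := pow_le_pow_of_le_one ht0.le ht1 (by norm_num)
      have h5 : 0 ≤ C * h ^ 4 * ‖(u : ContinuousL2 n)‖ ^ 2 := by positivity
      nlinarith [mul_le_mul_of_nonneg_left h4 h5]
    have h6 := sq_mul_le_of_sq_le (a := a) hh hb2
    nlinarith [mul_le_mul_of_nonneg_left ha hh.le]
  have hsum := Finset.sum_le_sum fun j (_ : j ∈ Finset.univ) => hterm j
  rw [sum_re_inner_second_difference] at hsum
  simp only [Finset.sum_const, Finset.card_univ, Fintype.card_fin, nsmul_eq_mul] at hsum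
  have hint : ∫ ξ, discreteSymbol (t • ξ) / t ^ 2 * (fourierL2 n (potentialMul V h u) ξ *
      starRingEnd ℂ (fourierL2 n (u : ContinuousL2 n) ξ)).re =
      (∫ ξ, discreteSymbol (t • ξ) * (fourierL2 n (potentialMul V h u) ξ *
      starRingEnd ℂ (fourierL2 n (u : ContinuousL2 n) ξ)).re) / t ^ 2 := by
    rw [← integral_div]
    refine integral_congr_ae (Filter.Eventually.of_forall fun ξ => ?_)
    simp only []
    ring
  rw [hint, le_div_iff₀ (by positivity)]
  refine le_trans ?_ hsum
  have h7 : h * (n * (k + C * (q + h ^ 2 * ‖(u : ContinuousL2 n)‖ ^ 2))) ≤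
      h * ((n * (C + 1) + 1) * (k + q + h ^ 2 * ‖(u : ContinuousL2 n)‖ ^ 2)) := by
    refine mul_le_mul_of_nonneg_left ?_ hh.le
    have h8 : 0 ≤ (n : ℝ) * C * k := by positivity
    have h9 : 0 ≤ (n : ℝ) * (q + h ^ 2 * ‖(u : ContinuousL2 n)‖ ^ 2) := by positivity
    nlinarith
  nlinarith [mul_le_mul_of_nonneg_left h7 (sq_nonneg t)]

end ContinuousEstimates

/-! ### Self-adjointness and bottom of the spectrum of the continuous operator -/

section ContinuousSpectrum

variable {n : ℕ}

theorem memLp_freeResolventSymbol {c : ℝ} (hc : 0 < c) :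
    MemLp (fun ξ : Space n => (((kineticSymbol ξ + c)⁻¹ : ℝ) : ℂ)) ∞ volume := by
  refine memLp_top_of_bound ?_ c⁻¹ (Filter.Eventually.of_forall fun ξ => ?_)
  · refine (Complex.continuous_ofReal.comp ?_).aestronglyMeasurable
    exact (continuous_kineticSymbol.add_const c).inv₀ fun ξ =>
      (add_pos_of_nonneg_of_pos (kineticSymbol_nonneg ξ) hc).ne'
  · have h1 := kineticSymbol_nonneg ξ
    rw [Complex.norm_real, Real.norm_of_nonneg (by positivity)]
    exact inv_anti₀ hc (by linarith)

/-- The resolvent `(-Δ + c)⁻¹` of the free Laplacian. -/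
noncomputable def freeResolvent (n : ℕ) {c : ℝ} (hc : 0 < c) : ContinuousL2 n →L[ℂ] ContinuousL2 n :=
  (fourierL2 n).symm.toContinuousLinearEquiv.toContinuousLinearMap ∘L
    boundedMul _ (memLp_freeResolventSymbol hc) ∘L
    (fourierL2 n).toContinuousLinearEquiv.toContinuousLinearMap

theorem fourierL2_freeResolvent {c : ℝ} (hc : 0 < c) (f : ContinuousL2 n) :
    fourierL2 n (freeResolvent n hc f) =ᵐ[volume]
      fun ξ => (((kineticSymbol ξ + c)⁻¹ : ℝ) : ℂ) * fourierL2 n f ξ := by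
  have h : fourierL2 n (freeResolvent n hc f) =
      boundedMul _ (memLp_freeResolventSymbol hc) (fourierL2 n f) :=
    (fourierL2 n).apply_symm_apply _
  rw [h]
  exact boundedMul_coeFn _ _ _

theorem norm_freeResolvent_apply_le {c : ℝ} (hc : 0 < c) (f : ContinuousL2 n) :
    ‖freeResolvent n hc f‖ ≤ c⁻¹ * ‖f‖ := by
  rw [← (fourierL2 n).norm_map, ← (fourierL2 n).norm_map f]
  refine Lp.norm_le_mul_norm_of_ae_le_mul ?_
  filter_upwards [fourierL2_freeResolvent hc f] with ξ h1
  have h2 := kineticSymbol_nonneg ξ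
  rw [h1, norm_mul, Complex.norm_real, Real.norm_of_nonneg (by positivity)]
  exact mul_le_mul_of_nonneg_right (inv_anti₀ hc (by linarith)) (norm_nonneg _)

theorem freeResolvent_mem {c : ℝ} (hc : 0 < c) (f : ContinuousL2 n) :
    freeResolvent n hc f ∈ sobolevH2 n := by
  refine mem_sobolevH2_iff.2 ⟨fourierL2 n f - (c : ℂ) • fourierL2 n (freeResolvent n hc f), ?_⟩
  filter_upwards [fourierL2_freeResolvent hc f,
    Lp.coeFn_sub (fourierL2 n f) ((c : ℂ) • fourierL2 n (freeResolvent n hc f)),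
    Lp.coeFn_smul (c : ℂ) (fourierL2 n (freeResolvent n hc f))] with ξ h1 h2 h3
  have h4 : ((kineticSymbol ξ + c : ℝ) : ℂ) ≠ 0 :=
    Complex.ofReal_ne_zero.2 (add_pos_of_nonneg_of_pos (kineticSymbol_nonneg ξ) hc).ne'
  rw [h2, Pi.sub_apply, h3, Pi.smul_apply, h1, smul_eq_mul, Complex.ofReal_inv]
  field_simp
  push_cast
  ring

theorem neg_laplacianH2_freeResolvent {c : ℝ} (hc : 0 < c) (f : ContinuousL2 n) :
    -laplacianH2 n ⟨freeResolvent n hc f, freeResolvent_mem hc f⟩ +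
      (c : ℂ) • freeResolvent n hc f = f := by
  apply (fourierL2 n).injective
  rw [map_add, map_smul]
  apply Lp.ext
  filter_upwards [fourierL2_freeResolvent hc f,
    fourier_neg_laplacianH2 (⟨freeResolvent n hc f, freeResolvent_mem hc f⟩ : sobolevH2 n),
    Lp.coeFn_add (fourierL2 n (-laplacianH2 n ⟨freeResolvent n hc f, freeResolvent_mem hc f⟩))
      ((c : ℂ) • fourierL2 n (freeResolvent n hc f)),
    Lp.coeFn_smul (c : ℂ) (fourierL2 n (freeResolvent n hc f))] with ξ h1 h2 h3 h4
  have h5 : ((kineticSymbol ξ + c : ℝ) : ℂ) ≠ 0 :=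
    Complex.ofReal_ne_zero.2 (add_pos_of_nonneg_of_pos (kineticSymbol_nonneg ξ) hc).ne'
  rw [h3, Pi.add_apply, h2, h4, Pi.smul_apply, h1, smul_eq_mul, Complex.ofReal_inv, ← add_mul,
    ← mul_assoc, ← Complex.ofReal_add, mul_inv_cancel₀ h5, one_mul]

theorem freeResolvent_neg_laplacianH2 {c : ℝ} (hc : 0 < c) (u : sobolevH2 n) :
    freeResolvent n hc (-laplacianH2 n u + (c : ℂ) • (u : ContinuousL2 n)) = u := by
  apply (fourierL2 n).injective
  apply Lp.ext
  have h0 : fourierL2 n (-laplacianH2 n u + (c : ℂ) • (u : ContinuousL2 n)) =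
      fourierL2 n (-laplacianH2 n u) + (c : ℂ) • fourierL2 n (u : ContinuousL2 n) := by
    rw [map_add, map_smul]
  filter_upwards [fourierL2_freeResolvent hc (-laplacianH2 n u + (c : ℂ) • (u : ContinuousL2 n)),
    fourier_neg_laplacianH2 u,
    Lp.coeFn_add (fourierL2 n (-laplacianH2 n u)) ((c : ℂ) • fourierL2 n (u : ContinuousL2 n)),
    Lp.coeFn_smul (c : ℂ) (fourierL2 n (u : ContinuousL2 n))] with ξ h1 h2 h3 h4
  have h5 : ((kineticSymbol ξ + c : ℝ) : ℂ) ≠ 0 :=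
    Complex.ofReal_ne_zero.2 (add_pos_of_nonneg_of_pos (kineticSymbol_nonneg ξ) hc).ne'
  rw [h1, h0, h3, Pi.add_apply, h2, h4, Pi.smul_apply, smul_eq_mul, Complex.ofReal_inv, ← add_mul,
    ← mul_assoc, ← Complex.ofReal_add, inv_mul_cancel₀ h5, one_mul]

theorem nontrivial_continuousL2 (n : ℕ) : Nontrivial (ContinuousL2 n) := by
  obtain ⟨v, hv⟩ := @exists_ne _ (nontrivial_discreteL2 n) (0 : DiscreteL2 n)
  refine ⟨interpolate v, 0, fun h => hv ?_⟩
  rw [← norm_eq_zero, ← norm_interpolate, h, norm_zero]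

theorem norm_potentialMul_le {V : PeriodicPotential n} {C : ℝ} (hV : ∀ x, |V x| ≤ C) (h : ℝ)
    (u : ContinuousL2 n) : ‖potentialMul V h u‖ ≤ C * ‖u‖ := by
  refine Lp.norm_le_mul_norm_of_ae_le_mul ?_
  filter_upwards [potentialMul_coeFn V h u] with x hx
  rw [hx, norm_mul, Complex.norm_real]
  exact mul_le_mul_of_nonneg_right (hV _) (norm_nonneg _)

/-- A Neumann series inverts the operator shifted by a large constant, and symmetry with a
nonnegative shifted form makes this inverse positive; the abstract result then applies. -/
theorem exists_isMinOfSpectrum_continuousOp (V : PeriodicPotential n) (h : ℝ) :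
    ∃ E : ℝ, IsMinOfSpectrum (unboundedSpectrum (continuousOp V h)) E ∧
      (∀ u : sobolevH2 n, E * ‖(u : ContinuousL2 n)‖ ^ 2 ≤
        (inner ℂ (u : ContinuousL2 n) (-laplacianH2 n u + potentialMul V h u)).re) ∧
      ∀ ε : ℝ, 0 < ε → ∃ u : sobolevH2 n, ‖(u : ContinuousL2 n)‖ = 1 ∧
        ‖-laplacianH2 n u + potentialMul V h u - (E : ℂ) • (u : ContinuousL2 n)‖ ≤ ε := by
  obtain ⟨C, hC0, hC⟩ := V.exists_bound
  -- With shift C + 1 the perturbation V(-Δ + C + 1)⁻¹ has norm at most C/(C + 1) < 1, and the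
  -- shifted form is nonnegative.
  have hc : 0 < C + 1 := by linarith
  set R₀ := freeResolvent n hc
  set B : ContinuousL2 n →L[ℂ] ContinuousL2 n := boundedMul _ (V.memLp_top h)
  have hB : ∀ u, B u = potentialMul V h u := fun u => rfl
  have hnorm : ‖-(B ∘L R₀)‖ < 1 := by
    have h1 : ‖-(B ∘L R₀)‖ ≤ C * (C + 1)⁻¹ := by
      rw [norm_neg]
      refine ContinuousLinearMap.opNorm_le_bound _ (by positivity) fun f => ?_
      change ‖potentialMul V h (R₀ f)‖ ≤ _
      calc _ ≤ C * ‖R₀ f‖ := norm_potentialMul_le hC h _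
        _ ≤ C * ((C + 1)⁻¹ * ‖f‖) := by
          gcongr
          exact norm_freeResolvent_apply_le hc f
        _ = _ := by ring
    refine h1.trans_lt ?_
    rw [← div_eq_mul_inv, div_lt_one hc]
    linarith
  obtain ⟨S, hS⟩ := isUnit_one_sub_of_norm_lt_one hnorm
  rw [sub_neg_eq_add] at hS
  have hS1 : ∀ f, (↑S⁻¹ : ContinuousL2 n →L[ℂ] ContinuousL2 n) (f + B (R₀ f)) = f := fun f => by
    have h1 := congrArg (fun A : ContinuousL2 n →L[ℂ] ContinuousL2 n => A f) S.inv_mul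
    rw [hS] at h1
    exact h1
  have hS2 : ∀ f, (↑S⁻¹ : ContinuousL2 n →L[ℂ] ContinuousL2 n) f +
      B (R₀ ((↑S⁻¹ : ContinuousL2 n →L[ℂ] ContinuousL2 n) f)) = f := fun f => by
    have h1 := congrArg (fun A : ContinuousL2 n →L[ℂ] ContinuousL2 n => A f) S.mul_inv
    rw [hS] at h1
    exact h1
  set R := R₀ ∘L (↑S⁻¹ : ContinuousL2 n →L[ℂ] ContinuousL2 n)
  have hdom : ∀ f, R f ∈ (continuousOp V h).domain := fun f => freeResolvent_mem hc _
  have hTR : ∀ f, continuousOp V h ⟨R f, hdom f⟩ + ((C + 1 : ℝ) : ℂ) • R f = f := fun f => by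
    have h1 := neg_laplacianH2_freeResolvent hc ((↑S⁻¹ : ContinuousL2 n →L[ℂ] ContinuousL2 n) f)
    have h2 : continuousOp V h ⟨R f, hdom f⟩ =
      -laplacianH2 n ⟨R₀ ((↑S⁻¹ : ContinuousL2 n →L[ℂ] ContinuousL2 n) f),
        freeResolvent_mem hc _⟩ +
      B (R₀ ((↑S⁻¹ : ContinuousL2 n →L[ℂ] ContinuousL2 n) f)) := rfl
    rw [h2, add_right_comm]
    have h3 : R f = freeResolvent n hc ((↑S⁻¹ : ContinuousL2 n →L[ℂ] ContinuousL2 n) f) := rfl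
    rw [h3, h1]
    exact hS2 f
  have hR0 : ∀ u : sobolevH2 n, R (-laplacianH2 n u + potentialMul V h u +
      ((C + 1 : ℝ) : ℂ) • (u : ContinuousL2 n)) = u := fun u => by
    have h1 := freeResolvent_neg_laplacianH2 hc u
    have h2 : -laplacianH2 n u + potentialMul V h u + ((C + 1 : ℝ) : ℂ) • (u : ContinuousL2 n) =
        (-laplacianH2 n u + ((C + 1 : ℝ) : ℂ) • (u : ContinuousL2 n)) +
          B (R₀ (-laplacianH2 n u + ((C + 1 : ℝ) : ℂ) • (u : ContinuousL2 n))) := by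
      rw [h1, hB]
      abel
    change R₀ ((↑S⁻¹ : ContinuousL2 n →L[ℂ] ContinuousL2 n) _) = _
    rw [h2, hS1]
    exact h1
  have hsymm : ∀ u w : sobolevH2 n,
      inner ℂ (-laplacianH2 n u + potentialMul V h u) (w : ContinuousL2 n) =
        inner ℂ (u : ContinuousL2 n) (-laplacianH2 n w + potentialMul V h w) := fun u w => by
    rw [inner_add_left, inner_add_right, inner_neg_laplacianH2_left, inner_potentialMul_left]
  have hform : ∀ u : sobolevH2 n, 0 ≤ (inner ℂ (u : ContinuousL2 n)
      (-laplacianH2 n u + potentialMul V h u)).re + (C + 1) * ‖(u : ContinuousL2 n)‖ ^ 2 := by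
    intro u
    have h2 := re_inner_neg_laplacianH2_nonneg u
    have h3 := Complex.abs_re_le_norm (inner ℂ (u : ContinuousL2 n) (potentialMul V h u))
    have h4 := norm_inner_le_norm (𝕜 := ℂ) (u : ContinuousL2 n) (potentialMul V h u)
    have h5 := norm_potentialMul_le hC h u
    have h6 := (abs_le.1 h3).1
    rw [inner_add_right, Complex.add_re]
    nlinarith [mul_le_mul_of_nonneg_left h5 (norm_nonneg (u : ContinuousL2 n)),
      sq_nonneg ‖(u : ContinuousL2 n)‖]
  have hpos : R.IsPositive :=
    isPositive_inverse_of_symmetric (T := continuousOp V h) (c := C + 1) hsymm hform hdom hTR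
  have := nontrivial_continuousL2 n
  exact exists_isMinOfSpectrum_of_isPositive_inverse (T := continuousOp V h) hpos hR0 hdom hTR

end ContinuousSpectrum

/-! ### A priori bounds on the ground state energy: order h² from below, order h from above -/

section GroundStateBounds

variable {n : ℕ}

/-- Compactness of a ball meeting every class modulo the lattice: finitely many translates of the
open set where V > V(x₁)/2 cover it, and periodicity extends this to all x. -/
theorem exists_finset_sum_shift_ge {V : PeriodicPotential n} (hV : ∀ x, 0 ≤ V x) {x₁ : Space n}
    (hx₁ : 0 < V x₁) : ∃ t : Finset (Space n), ∀ x, V x₁ / 2 ≤ ∑ y ∈ t, V (x + y) := by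
  classical
  have hcont : Continuous V := V.smooth.continuous
  obtain ⟨t, -, ht⟩ := (isCompact_closedBall (0 : Space n) (Real.sqrt n)).elim_nhds_subcover
    (fun y => {z | V x₁ / 2 < V (z + (x₁ - y))}) (fun y _ => by
      refine (isOpen_lt continuous_const (hcont.comp (continuous_add_const _))).mem_nhds ?_
      change V x₁ / 2 < V (y + (x₁ - y))
      rw [add_sub_cancel]
      linarith)
  refine ⟨t.image fun y => x₁ - y, fun x => ?_⟩
  have hball : x + latticePt (fun i => -⌊x i⌋) ∈ Metric.closedBall (0 : Space n) (Real.sqrt n) := by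
    rw [mem_closedBall_zero_iff, EuclideanSpace.norm_eq]
    refine Real.sqrt_le_sqrt ?_
    calc ∑ i, ‖(x + latticePt (fun i => -⌊x i⌋)) i‖ ^ 2 ≤ ∑ _i : Fin n, (1 : ℝ) := by
          refine Finset.sum_le_sum fun i _ => ?_
          have : (x + latticePt (fun i => -⌊x i⌋)) i = Int.fract (x i) := by
            simp [latticePt, Int.fract, sub_eq_add_neg]
          rw [this, Real.norm_eq_abs, sq_abs]
          nlinarith [Int.fract_nonneg (x i), (Int.fract_lt_one (x i)).le]
      _ = n := by simp
  obtain ⟨y, hy, hy2⟩ := mem_iUnion₂.1 (ht hball)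
  have h1 : V x₁ / 2 < V (x + (x₁ - y)) := by
    rw [← V.periodic (x + (x₁ - y)) (fun i => -⌊x i⌋), add_right_comm]
    exact hy2
  exact h1.le.trans (Finset.single_le_sum (f := fun y => V (x + y)) (fun y _ => hV _)
    (Finset.mem_image_of_mem _ hy))

/-- The form of W at 2u - w is nonnegative, and it equals the right side minus the left side. -/
theorem re_inner_potentialMul_le_two_mul {V : PeriodicPotential n} (hV : ∀ x, 0 ≤ V x) (h : ℝ)
    (u w : ContinuousL2 n) : (inner ℂ w (potentialMul V h w)).re ≤
      2 * (inner ℂ u (potentialMul V h u)).re +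
        2 * (inner ℂ (w - u) (potentialMul V h (w - u))).re := by
  have h1 := re_inner_potentialMul_nonneg hV h ((2 : ℂ) • u - w)
  simp only [map_sub, map_smul, inner_sub_left, inner_sub_right, inner_smul_left,
    inner_smul_right, Complex.sub_re, map_ofNat, Complex.mul_re, Complex.re_ofNat,
    Complex.im_ofNat, zero_mul, sub_zero] at h1 ⊢
  linarith

/-- The lower bound on the energy for a potential which is not identically zero. -/
theorem exists_sq_mul_norm_sq_le_energy {V : PeriodicPotential n} (hV : ∀ x, 0 ≤ V x)
    {x₁ : Space n} (hx₁ : 0 < V x₁) : ∃ c : ℝ, 0 < c ∧ ∀ h : ℝ, 0 < h → h ≤ 1 →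
      ∀ u : sobolevH2 n, c * h ^ 2 * ‖(u : ContinuousL2 n)‖ ^ 2 ≤
        (inner ℂ (u : ContinuousL2 n) (-laplacianH2 n u)).re +
          (inner ℂ (u : ContinuousL2 n) (potentialMul V h u)).re := by
  obtain ⟨t, ht⟩ := exists_finset_sum_shift_ge hV hx₁
  obtain ⟨C, hC0, hC⟩ := V.exists_bound
  set D := ∑ y ∈ t, (2 + 2 * C * ‖y‖ ^ 2) with hD
  have hD0 : 0 ≤ D := Finset.sum_nonneg fun y _ => by positivity
  refine ⟨V x₁ / 2 / (D + 1), by positivity, fun h hh hh1 u => ?_⟩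
  have hk := re_inner_neg_laplacianH2_nonneg u
  have hq := re_inner_potentialMul_nonneg hV h (u : ContinuousL2 n)
  set k := (inner ℂ (u : ContinuousL2 n) (-laplacianH2 n u)).re
  set q := (inner ℂ (u : ContinuousL2 n) (potentialMul V h u)).re
  have h1 : V x₁ / 2 * ‖(u : ContinuousL2 n)‖ ^ 2 ≤
      ∑ y ∈ t, (inner ℂ (u : ContinuousL2 n) (potentialMul (V.shift y) h u)).re := by
    simp_rw [re_inner_potentialMul]
    rw [lp_norm_sq_eq_integral, ← integral_const_mul,
      ← integral_finsetSum _ fun y _ => integrable_potential_mul_norm_sq (V.shift y) h _]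
    refine integral_mono ((lp_integrable_norm_sq _).const_mul _)
      (integrable_finsetSum _ fun y _ => integrable_potential_mul_norm_sq (V.shift y) h _)
      fun x => ?_
    change _ ≤ ∑ y ∈ t, V (h • x + y) * ‖(u : ContinuousL2 n) x‖ ^ 2
    rw [← Finset.sum_mul]
    exact mul_le_mul_of_nonneg_right (ht _) (by positivity)
  -- Translating V by y amounts to translating u by h⁻¹y. This costs at most (|y|/h)² times the
  -- kinetic energy, which the factor h² absorbs; summing over the finitely many y bounds the total
  -- mass by h⁻² times the energy.
  have h2 : ∀ y, h ^ 2 * (inner ℂ (u : ContinuousL2 n) (potentialMul (V.shift y) h u)).re ≤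
      (2 + 2 * C * ‖y‖ ^ 2) * (k + q) := by
    intro y
    set w := spaceShift (-(h⁻¹ • y)) (u : ContinuousL2 n)
    have hu : (u : ContinuousL2 n) = spaceShift (h⁻¹ • y) w :=
      (translate_translate_neg (h⁻¹ • y) (u : ContinuousL2 n)).symm
    have h3 : (inner ℂ (u : ContinuousL2 n) (potentialMul (V.shift y) h u)).re =
        (inner ℂ w (potentialMul V h w)).re := by
      have h4 := spaceShift_potentialMul V h (h⁻¹ • y) w
      rw [smul_inv_smul₀ hh.ne'] at h4
      rw [hu, ← h4, LinearIsometry.inner_map_map]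
    have h5 := re_inner_potentialMul_le_two_mul hV h (u : ContinuousL2 n) w
    have h6 := re_inner_potentialMul_le (V := V) (fun x => (abs_le.1 (hC x)).2) h (w - u)
    have h7 : ‖w - u‖ ^ 2 ≤ ‖y‖ ^ 2 / h ^ 2 * k := by
      have h8 := norm_sq_sub_spaceShift_le (-(h⁻¹ • y)) u
      rw [norm_sub_rev, norm_neg, norm_smul, mul_pow, norm_inv, Real.norm_of_nonneg hh.le,
        inv_pow, inv_mul_eq_div] at h8
      exact h8
    rw [h3]
    have h9 : h ^ 2 * ‖w - u‖ ^ 2 ≤ ‖y‖ ^ 2 * k := by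
      have := mul_le_mul_of_nonneg_left h7 (sq_nonneg h)
      refine this.trans (le_of_eq ?_)
      field_simp
    have h10 : h ^ 2 * q ≤ q := mul_le_of_le_one_left hq (by nlinarith)
    have h11 : 0 ≤ C * ‖y‖ ^ 2 * q := by positivity
    nlinarith [mul_le_mul_of_nonneg_left h9 hC0, mul_le_mul_of_nonneg_left h5 (sq_nonneg h),
      mul_le_mul_of_nonneg_left h6 (sq_nonneg h)]
  have h3 : h ^ 2 * (V x₁ / 2 * ‖(u : ContinuousL2 n)‖ ^ 2) ≤ D * (k + q) := by
    refine (mul_le_mul_of_nonneg_left h1 (sq_nonneg h)).trans ?_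
    rw [Finset.mul_sum, hD, Finset.sum_mul]
    exact Finset.sum_le_sum fun y _ => h2 y
  rw [div_mul_eq_mul_div, div_mul_eq_mul_div, div_le_iff₀ (by positivity)]
  nlinarith

/-- Near a lattice point V is at most quadratic, and 2 - 2 cos 2πs ≥ 16 s² for |s| ≤ 1/2. The
majorant equals M ∑ |1 - exp(2πi x_j)|², so its energy can be read off from frequency translations.
-/
theorem exists_le_sum_one_sub_cos {V : PeriodicPotential n} (hV : ∀ x, 0 ≤ V x) (h0 : V 0 = 0) :
    ∃ M : ℝ, 0 < M ∧ ∀ x, V x ≤ M * ∑ j, (2 - 2 * Real.cos (2 * Real.pi * x j)) := by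
  obtain ⟨M, hM0, hM⟩ := PeriodicPotential.exists_le_norm_sq_of_zero hV h0
  refine ⟨M, hM0, fun x => ?_⟩
  rw [← V.periodic x (fun i => -round (x i))]
  refine (hM _).trans (mul_le_mul_of_nonneg_left ?_ hM0.le)
  rw [EuclideanSpace.norm_sq_eq]
  refine Finset.sum_le_sum fun j _ => ?_
  have h1 : (x + latticePt (fun i => -round (x i)) - 0) j = x j - round (x j) := by
    simp [latticePt, sub_eq_add_neg]
  rw [h1, Real.norm_eq_abs, sq_abs]
  have h2 := abs_sub_round (x j)
  have h3 : Real.cos (2 * Real.pi * x j) = Real.cos (2 * Real.pi * (x j - round (x j))) := by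
    rw [mul_sub, ← Real.cos_sub_int_mul_two_pi _ (round (x j))]
    congr 1
    ring
  rw [h3]
  set s := x j - round (x j)
  have h4 := Real.cos_le_one_sub_mul_cos_sq (x := 2 * Real.pi * s) (by
    rw [abs_mul, abs_of_pos Real.two_pi_pos]
    nlinarith [Real.pi_pos])
  have h5 : 2 / Real.pi ^ 2 * (2 * Real.pi * s) ^ 2 = 8 * s ^ 2 := by
    field_simp
    ring
  rw [h5] at h4
  nlinarith [sq_nonneg s]

/-- The tent function of radius `R`. -/
noncomputable def tent (R : ℝ) (ξ : Space n) : ℝ := max 0 (1 - ‖ξ‖ / R)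

theorem continuous_tent (R : ℝ) : Continuous (tent (n := n) R) := by
  unfold tent
  fun_prop

theorem tent_nonneg (R : ℝ) (ξ : Space n) : 0 ≤ tent R ξ := le_max_left _ _

theorem tent_eq_zero {R : ℝ} (hR : 0 < R) {ξ : Space n} (hξ : R ≤ ‖ξ‖) : tent R ξ = 0 := by
  refine max_eq_left ?_
  rw [sub_nonpos, le_div_iff₀ hR]
  linarith

theorem abs_tent_sub_le {R : ℝ} (hR : 0 < R) (ξ η : Space n) :
    |tent R ξ - tent R η| ≤ ‖ξ - η‖ / R := by
  unfold tent
  rw [max_comm 0, max_comm 0]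
  refine (abs_max_sub_max_le_abs _ _ _).trans ?_
  rw [sub_sub_sub_cancel_left, ← sub_div, abs_div, abs_of_pos hR]
  gcongr
  rw [abs_sub_comm]
  exact abs_norm_sub_norm_le ξ η

theorem hasCompactSupport_tent {R : ℝ} (hR : 0 < R) : HasCompactSupport (tent (n := n) R) := by
  refine HasCompactSupport.intro (isCompact_closedBall (0 : Space n) R) fun ξ hξ => ?_
  rw [mem_closedBall_zero_iff, not_le] at hξ
  exact tent_eq_zero hR hξ.le

theorem memLp_tent {R : ℝ} (hR : 0 < R) :
    MemLp (fun ξ : Space n => (tent R ξ : ℂ)) 2 volume :=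
  (Complex.continuous_ofReal.comp (continuous_tent R)).memLp_of_hasCompactSupport
    ((hasCompactSupport_tent hR).comp_left Complex.ofReal_zero)

theorem memLp_kineticSymbol_mul_tent {R : ℝ} (hR : 0 < R) :
    MemLp (fun ξ : Space n => (kineticSymbol ξ : ℂ) * (tent R ξ : ℂ)) 2 volume :=
  ((Complex.continuous_ofReal.comp continuous_kineticSymbol).mul
    (Complex.continuous_ofReal.comp (continuous_tent R))).memLp_of_hasCompactSupport
    (((hasCompactSupport_tent hR).comp_left Complex.ofReal_zero).mul_left)

/-- The tent function of radius `R` as an element of `L²`. -/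
noncomputable def tentL2 {R : ℝ} (hR : 0 < R) : ContinuousL2 n := (memLp_tent hR).toLp _

theorem tentL2_coeFn {R : ℝ} (hR : 0 < R) :
    tentL2 (n := n) hR =ᵐ[volume] fun ξ => (tent R ξ : ℂ) := MemLp.coeFn_toLp _

theorem norm_sq_tentL2_ge {R : ℝ} (hR : 0 < R) :
    volume.real (Metric.closedBall (0 : Space n) (R / 2)) / 4 ≤ ‖tentL2 (n := n) hR‖ ^ 2 := by
  rw [lp_norm_sq_eq_integral]
  have h1 : volume.real (Metric.closedBall (0 : Space n) (R / 2)) / 4 =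
      ∫ ξ, (Metric.closedBall (0 : Space n) (R / 2)).indicator (fun _ => (1 / 4 : ℝ)) ξ := by
    rw [integral_indicator_const _ Metric.isClosed_closedBall.measurableSet, smul_eq_mul]
    ring
  rw [h1]
  refine integral_mono_of_nonneg
    (Filter.Eventually.of_forall fun ξ => indicator_nonneg (fun _ _ => by norm_num) ξ)
    (lp_integrable_norm_sq _) ?_
  filter_upwards [tentL2_coeFn (n := n) hR] with ξ hξ
  by_cases h : ξ ∈ Metric.closedBall (0 : Space n) (R / 2)
  · rw [indicator_of_mem h, hξ, Complex.norm_real, Real.norm_of_nonneg (tent_nonneg _ _)]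
    rw [mem_closedBall_zero_iff] at h
    have h2 : 1 / 2 ≤ tent R ξ := by
      refine le_max_of_le_right ?_
      have : ‖ξ‖ / R ≤ 1 / 2 := by
        rw [div_le_iff₀ hR]
        linarith
      linarith
    nlinarith
  · rw [indicator_of_notMem h]
    positivity

/-- The tent has Lipschitz constant 1/R, and for |b| ≤ R both the tent and its translate vanish
outside the ball of radius 2R. -/
theorem norm_sq_tentL2_sub_spaceShift_le {R : ℝ} (hR : 0 < R) {b : Space n} (hb : ‖b‖ ≤ R) :
    ‖tentL2 hR - spaceShift b (tentL2 hR)‖ ^ 2 ≤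
      (‖b‖ / R) ^ 2 * volume.real (Metric.closedBall (0 : Space n) (2 * R)) := by
  rw [lp_norm_sq_eq_integral]
  have h1 : (‖b‖ / R) ^ 2 * volume.real (Metric.closedBall (0 : Space n) (2 * R)) =
      ∫ ξ, (Metric.closedBall (0 : Space n) (2 * R)).indicator (fun _ => (‖b‖ / R) ^ 2) ξ := by
    rw [integral_indicator_const _ Metric.isClosed_closedBall.measurableSet, smul_eq_mul]
    ring
  rw [h1]
  refine integral_mono_ae (lp_integrable_norm_sq _)
    ((integrable_indicator_iff Metric.isClosed_closedBall.measurableSet).2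
      (integrableOn_const measure_closedBall_lt_top.ne)) ?_
  filter_upwards [tentL2_coeFn (n := n) hR, spaceShift_coeFn b (tentL2 hR),
    (measurePreserving_add_right_space b).quasiMeasurePreserving.ae (tentL2_coeFn (n := n) hR),
    Lp.coeFn_sub (tentL2 hR) (spaceShift b (tentL2 hR))] with ξ h2 h3 h4 h5
  rw [h5, Pi.sub_apply, h2, h3, h4, ← Complex.ofReal_sub, Complex.norm_real, Real.norm_eq_abs]
  by_cases h : ξ ∈ Metric.closedBall (0 : Space n) (2 * R)
  · rw [indicator_of_mem h]
    have h6 := abs_tent_sub_le hR ξ (ξ + b)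
    rw [sub_add_cancel_left, norm_neg] at h6
    gcongr
  · rw [indicator_of_notMem h]
    rw [mem_closedBall_zero_iff, not_le] at h
    have h6 : R ≤ ‖ξ + b‖ := by
      have := norm_sub_le (ξ + b) b
      rw [add_sub_cancel_right] at this
      linarith
    rw [tent_eq_zero hR (by linarith : R ≤ ‖ξ‖), tent_eq_zero hR h6]
    simp

theorem measureReal_closedBall_two_mul {R : ℝ} (hR : 0 < R) :
    volume.real (Metric.closedBall (0 : Space n) (2 * R)) =
      4 ^ n * volume.real (Metric.closedBall (0 : Space n) (R / 2)) := by
  rw [Measure.addHaar_real_closedBall _ _ (by positivity),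
    Measure.addHaar_real_closedBall _ _ (by positivity), finrank_euclideanSpace_fin, ← mul_assoc,
    ← mul_pow]
  congr 2
  ring

/-- The trial function has a tent of radius √h as Fourier transform. Its kinetic energy is O(R²) =
O(h), and its potential energy is controlled by frequency translations of length h, which cost
O((h/R)²) = O(h). -/
theorem exists_energy_le_of_zero {V : PeriodicPotential n} (hV : ∀ x, 0 ≤ V x) (h0 : V 0 = 0) :
    ∃ C : ℝ, 0 < C ∧ ∀ h : ℝ, 0 < h → h ≤ 1 → ∃ u : sobolevH2 n, 0 < ‖(u : ContinuousL2 n)‖ ∧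
      (inner ℂ (u : ContinuousL2 n) (-laplacianH2 n u)).re +
        (inner ℂ (u : ContinuousL2 n) (potentialMul V h u)).re ≤
          C * h * ‖(u : ContinuousL2 n)‖ ^ 2 := by
  obtain ⟨M, hM0, hM⟩ := exists_le_sum_one_sub_cos hV h0
  refine ⟨4 * Real.pi ^ 2 + M * (n * (4 * 4 ^ n)), by positivity, fun h hh hh1 => ?_⟩
  have hR : 0 < Real.sqrt h := Real.sqrt_pos.2 hh
  have hR2 : Real.sqrt h ^ 2 = h := Real.sq_sqrt hh.le
  set R := Real.sqrt h
  set u : ContinuousL2 n := (fourierL2 n).symm (tentL2 hR) with hu_def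
  have hu : fourierL2 n u = tentL2 hR := (fourierL2 n).apply_symm_apply _
  have hmem : u ∈ sobolevH2 n := by
    refine mem_sobolevH2_iff.2 ⟨(memLp_kineticSymbol_mul_tent hR).toLp _, ?_⟩
    rw [hu]
    filter_upwards [(memLp_kineticSymbol_mul_tent (n := n) hR).coeFn_toLp, tentL2_coeFn hR]
      with ξ h1 h2
    rw [h1, h2]
  have hnorm : ‖u‖ = ‖tentL2 (n := n) hR‖ := by rw [← (fourierL2 n).norm_map, hu]
  have hvol := norm_sq_tentL2_ge (n := n) hR
  have hball : 0 < volume.real (Metric.closedBall (0 : Space n) (R / 2)) :=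
    ENNReal.toReal_pos (Metric.measure_closedBall_pos _ _ (by positivity)).ne'
      measure_closedBall_lt_top.ne
  refine ⟨⟨u, hmem⟩, ?_, ?_⟩
  · change 0 < ‖u‖
    rw [hnorm]
    by_contra hcon
    have h1 : ‖tentL2 (n := n) hR‖ = 0 := le_antisymm (not_lt.1 hcon) (norm_nonneg _)
    rw [h1] at hvol
    norm_num at hvol
    linarith
  have hk : (inner ℂ u (-laplacianH2 n ⟨u, hmem⟩)).re ≤ 4 * Real.pi ^ 2 * h * ‖u‖ ^ 2 := by
    have h1 := re_inner_neg_laplacianH2 ⟨u, hmem⟩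
    have h2 := integrable_kineticSymbol_mul_norm_sq ⟨u, hmem⟩
    rw [h1, hnorm, lp_norm_sq_eq_integral, ← integral_const_mul]
    refine integral_mono_ae h2 ((lp_integrable_norm_sq _).const_mul _) ?_
    rw [hu]
    filter_upwards [tentL2_coeFn (n := n) hR] with ξ hξ
    rcases le_total R ‖ξ‖ with h3 | h3
    · rw [hξ, tent_eq_zero hR h3]
      simp
    · refine mul_le_mul_of_nonneg_right ?_ (by positivity)
      rw [kineticSymbol, ← hR2]
      gcongr
  have hq : (inner ℂ u (potentialMul V h u)).re ≤ M * (n * (4 * 4 ^ n)) * h * ‖u‖ ^ 2 := by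
    have hy : ∀ j : Fin n, ‖h • EuclideanSpace.single j (1 : ℝ)‖ = h := fun j => by
      rw [norm_smul]
      simp [hh.le]
    have hbd : ∀ y : Space n, Integrable fun x => ‖1 - planeWave y x‖ ^ 2 * ‖u x‖ ^ 2 := by
      intro y
      refine (lp_integrable_norm_sq u).bdd_mul (c := 4) ?_ (Filter.Eventually.of_forall fun x => ?_)
      · exact ((continuous_const.sub (continuous_planeWave y)).norm.pow 2).aestronglyMeasurable
      · rw [Real.norm_of_nonneg (by positivity), norm_one_sub_planeWave_sq]
        linarith [Real.neg_one_le_cos (2 * Real.pi * inner ℝ y x)]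
    -- The Fourier transform turns multiplication by 1 - `planeWave y` into a difference of the tent
    -- with its translate.
    have hint : ∀ y : Space n, ∫ x, ‖1 - planeWave y x‖ ^ 2 * ‖u x‖ ^ 2 =
        ‖tentL2 hR - spaceShift (-y) (tentL2 hR)‖ ^ 2 := by
      intro y
      rw [← hu, ← fourier_boundedMul_planeWave, ← map_sub, LinearIsometryEquiv.norm_map,
        lp_norm_sq_eq_integral]
      refine integral_congr_ae ?_
      filter_upwards [Lp.coeFn_sub u (boundedMul (planeWave y) (memLp_planeWave y) u),
        boundedMul_coeFn (planeWave y) (memLp_planeWave y) u] with x h1 h2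
      rw [h1, Pi.sub_apply, h2, ← one_sub_mul, norm_mul, mul_pow]
    have hterm : ∀ j : Fin n,
        ∫ x, ‖1 - planeWave (h • EuclideanSpace.single j 1) x‖ ^ 2 * ‖u x‖ ^ 2 ≤
          4 * 4 ^ n * h * ‖u‖ ^ 2 := by
      intro j
      rw [hint]
      refine (norm_sq_tentL2_sub_spaceShift_le hR ?_).trans ?_
      · rw [norm_neg, hy]
        exact Real.le_sqrt_of_sq_le (by nlinarith)
      · rw [norm_neg, hy, div_pow, hR2, measureReal_closedBall_two_mul hR, hnorm, sq h,
          mul_div_assoc, div_self hh.ne', mul_one]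
        have h1 : 0 ≤ 4 ^ n * h := by positivity
        nlinarith [mul_le_mul_of_nonneg_left hvol h1]
    rw [re_inner_potentialMul]
    calc ∫ x, V (h • x) * ‖u x‖ ^ 2
        ≤ ∫ x, M * ∑ j : Fin n,
            ‖1 - planeWave (h • EuclideanSpace.single j 1) x‖ ^ 2 * ‖u x‖ ^ 2 := by
          refine integral_mono (integrable_potential_mul_norm_sq V h u)
            ((integrable_finsetSum _ fun j _ => hbd _).const_mul M) fun x => ?_
          change _ ≤ M * ∑ j : Fin n, _
          rw [← Finset.sum_mul, ← mul_assoc]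
          refine mul_le_mul_of_nonneg_right ((hM _).trans (le_of_eq ?_)) (by positivity)
          congr 1
          refine Finset.sum_congr rfl fun j _ => ?_
          rw [norm_one_sub_planeWave_sq, real_inner_smul_left, EuclideanSpace.inner_single_left,
            PiLp.smul_apply]
          simp
      _ = M * ∑ j : Fin n,
            ∫ x, ‖1 - planeWave (h • EuclideanSpace.single j 1) x‖ ^ 2 * ‖u x‖ ^ 2 := by
          rw [integral_const_mul, integral_finsetSum _ fun j _ => hbd _]
      _ ≤ M * ∑ _j : Fin n, 4 * 4 ^ n * h * ‖u‖ ^ 2 := by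
          gcongr with j
          exact hterm j
      _ = _ := by
          simp only [Finset.sum_const, Finset.card_univ, Fintype.card_fin, nsmul_eq_mul]
          ring
  change (inner ℂ u (-laplacianH2 n ⟨u, hmem⟩)).re + (inner ℂ u (potentialMul V h u)).re ≤
    _ * ‖u‖ ^ 2
  linarith

theorem spaceShift_mem {a : Space n} {u : ContinuousL2 n} (hu : u ∈ sobolevH2 n) :
    spaceShift a u ∈ sobolevH2 n := by
  obtain ⟨k, hk⟩ := mem_sobolevH2_iff.1 hu
  refine mem_sobolevH2_iff.2 ⟨boundedMul (planeWave a) (memLp_planeWave a) k, ?_⟩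
  rw [fourier_translate]
  filter_upwards [hk, boundedMul_coeFn (planeWave a) (memLp_planeWave a) k,
    boundedMul_coeFn (planeWave a) (memLp_planeWave a) (fourierL2 n u)] with ξ h1 h2 h3
  rw [h2, h3, h1]
  ring

theorem re_inner_neg_laplacianH2_spaceShift (a : Space n) (u : sobolevH2 n) :
    (inner ℂ (spaceShift a (u : ContinuousL2 n))
      (-laplacianH2 n ⟨spaceShift a u, spaceShift_mem u.2⟩)).re =
      (inner ℂ (u : ContinuousL2 n) (-laplacianH2 n u)).re := by
  have h1 := re_inner_neg_laplacianH2 ⟨spaceShift a (u : ContinuousL2 n), spaceShift_mem u.2⟩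
  rw [h1, re_inner_neg_laplacianH2]
  refine integral_congr_ae ?_
  rw [fourier_translate]
  filter_upwards [boundedMul_coeFn (planeWave a) (memLp_planeWave a) (fourierL2 n u)] with ξ h2
  rw [h2, norm_mul, norm_planeWave, one_mul]

/-- The upper bound on the ground state energy for a nonnegative potential with a zero. -/
theorem exists_energy_le {V : PeriodicPotential n} (hV : ∀ x, 0 ≤ V x) {x₀ : Space n}
    (h0 : V x₀ = 0) :
    ∃ C : ℝ, 0 < C ∧ ∀ h : ℝ, 0 < h → h ≤ 1 → ∃ u : sobolevH2 n, 0 < ‖(u : ContinuousL2 n)‖ ∧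
      (inner ℂ (u : ContinuousL2 n) (-laplacianH2 n u)).re +
        (inner ℂ (u : ContinuousL2 n) (potentialMul V h u)).re ≤
          C * h * ‖(u : ContinuousL2 n)‖ ^ 2 := by
  -- The zero of V is moved to the origin; the trial function is translated back by h⁻¹x₀, which
  -- leaves the kinetic energy unchanged.
  obtain ⟨C, hC0, hC⟩ := exists_energy_le_of_zero (V := V.shift x₀) (fun x => hV _)
    (by rw [PeriodicPotential.shift_apply, zero_add, h0])
  refine ⟨C, hC0, fun h hh hh1 => ?_⟩
  obtain ⟨u, hu0, hu⟩ := hC h hh hh1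
  set a : Space n := h⁻¹ • x₀
  set w := spaceShift (-a) (u : ContinuousL2 n) with hw
  have hnorm : ‖w‖ = ‖(u : ContinuousL2 n)‖ := (spaceShift (-a)).norm_map _
  have h1 := spaceShift_potentialMul V h a w
  have h2 : spaceShift a w = u := translate_translate_neg a u
  rw [smul_inv_smul₀ hh.ne', h2] at h1
  have h3 : (inner ℂ w (potentialMul V h w)).re =
      (inner ℂ (u : ContinuousL2 n) (potentialMul (V.shift x₀) h u)).re := by
    rw [← h1, ← (spaceShift a).inner_map_map, h2]
  have h4 := re_inner_neg_laplacianH2_spaceShift (-a) u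
  refine ⟨⟨w, spaceShift_mem u.2⟩, ?_, ?_⟩
  · change 0 < ‖w‖
    rwa [hnorm]
  · change (inner ℂ w (-laplacianH2 n ⟨w, spaceShift_mem u.2⟩)).re +
      (inner ℂ w (potentialMul V h w)).re ≤ _ * ‖w‖ ^ 2
    rw [hnorm, h3, h4]
    exact hu

end GroundStateBounds

/-! ### Cutting off to the Brillouin zone and comparing the kinetic symbols -/

section BandLimiting

attribute [local instance] circleMeasureSpace circle_isAddHaarMeasure circle_isProbabilityMeasure

variable {n : ℕ}

theorem one_le_kineticSymbol_of_notMem {ξ : Space n} (hξ : ξ ∉ brillouin n) :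
    1 ≤ kineticSymbol ξ := by
  simp only [brillouin, mem_ofPred_eq, not_forall] at hξ
  obtain ⟨i, hi⟩ := hξ
  have h1 : 1 / 2 ≤ |ξ i| := by
    by_contra hcon
    rw [not_le, abs_lt] at hcon
    exact hi ⟨by linarith [hcon.1], hcon.2⟩
  have h2 : |ξ i| ≤ ‖ξ‖ := PiLp.norm_apply_le ξ i
  unfold kineticSymbol
  have h3 : 1 / 4 ≤ ‖ξ‖ ^ 2 := by nlinarith
  nlinarith [Real.pi_gt_three]

/-- The remainder carries only frequencies outside the zone, where the kinetic symbol is at least 1.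
-/
theorem norm_sq_sub_interpolate_le {u : sobolevH2 n} {v : DiscreteL2 n}
    (hv : fourierL2 n (interpolate v) =ᵐ[volume]
      (brillouin n).indicator (fourierL2 n (u : ContinuousL2 n))) :
    ‖(u : ContinuousL2 n) - interpolate v‖ ^ 2 ≤ ‖-laplacianH2 n u‖ ^ 2 := by
  rw [norm_sq_neg_laplacianH2, ← (fourierL2 n).norm_map, map_sub, lp_norm_sq_eq_integral]
  refine integral_mono_ae (lp_integrable_norm_sq _) (integrable_kineticSymbol_sq_mul_norm_sq u) ?_
  filter_upwards [hv, Lp.coeFn_sub (fourierL2 n (u : ContinuousL2 n)) (fourierL2 n (interpolate v))]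
    with ξ h1 h2
  rw [h2, Pi.sub_apply, h1]
  by_cases h : ξ ∈ brillouin n
  · rw [indicator_of_mem h, sub_self, norm_zero, zero_pow two_ne_zero]
    exact mul_nonneg (sq_nonneg _) (sq_nonneg _)
  · rw [indicator_of_notMem h, sub_zero]
    refine le_mul_of_one_le_left (by positivity) ?_
    exact one_le_pow₀ (one_le_kineticSymbol_of_notMem h)

theorem norm_sq_interpolate_add_norm_sq_sub {u : ContinuousL2 n} {v : DiscreteL2 n}
    (hv : fourierL2 n (interpolate v) =ᵐ[volume] (brillouin n).indicator (fourierL2 n u)) :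
    ‖v‖ ^ 2 + ‖u - interpolate v‖ ^ 2 = ‖u‖ ^ 2 := by
  rw [← norm_interpolate, ← (fourierL2 n).norm_map, ← (fourierL2 n).norm_map u,
    ← (fourierL2 n).norm_map (u - interpolate v), map_sub, lp_norm_sq_eq_integral,
    lp_norm_sq_eq_integral, lp_norm_sq_eq_integral,
    ← integral_add (lp_integrable_norm_sq _) (lp_integrable_norm_sq _)]
  refine integral_congr_ae ?_
  filter_upwards [hv, Lp.coeFn_sub (fourierL2 n u) (fourierL2 n (interpolate v))] with ξ h1 h2
  rw [h2, Pi.sub_apply, h1]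
  by_cases h : ξ ∈ brillouin n
  · simp [indicator_of_mem h]
  · simp [indicator_of_notMem h]

/-- Two monotonicities: cutting off frequencies lowers |û|, and the discrete symbol lies below the
continuous one. -/
theorem re_inner_discreteKinetic_le_of_interpolate {u : sobolevH2 n} {v : DiscreteL2 n}
    (hv : fourierL2 n (interpolate v) =ᵐ[volume]
      (brillouin n).indicator (fourierL2 n (u : ContinuousL2 n))) :
    (inner ℂ v (discreteKinetic n v)).re ≤
      (inner ℂ (u : ContinuousL2 n) (-laplacianH2 n u)).re := by
  rw [re_inner_discreteKinetic, re_inner_neg_laplacianH2,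
    ← integral_mul_norm_sq_interpolate v continuous_discreteSymbol.measurable]
  refine integral_mono_of_nonneg (Filter.Eventually.of_forall fun ξ =>
    mul_nonneg (discreteSymbol_nonneg ξ) (by positivity)) (integrable_kineticSymbol_mul_norm_sq u) ?_
  filter_upwards [hv] with ξ h1
  rw [h1]
  exact mul_le_mul (discreteSymbol_le_kineticSymbol ξ)
    (pow_le_pow_left₀ (norm_nonneg _) (norm_indicator_le_norm_self _ _) 2) (by positivity)
    (kineticSymbol_nonneg ξ)

theorem norm_sq_discreteKinetic_le_of_interpolate {u : sobolevH2 n} {v : DiscreteL2 n}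
    (hv : fourierL2 n (interpolate v) =ᵐ[volume]
      (brillouin n).indicator (fourierL2 n (u : ContinuousL2 n))) :
    ‖discreteKinetic n v‖ ^ 2 ≤ ‖-laplacianH2 n u‖ ^ 2 := by
  rw [norm_sq_discreteKinetic, norm_sq_neg_laplacianH2,
    ← integral_mul_norm_sq_interpolate v (f := fun ξ => discreteSymbol ξ ^ 2)
      (continuous_discreteSymbol.measurable.pow_const 2)]
  refine integral_mono_of_nonneg (Filter.Eventually.of_forall fun ξ => by positivity)
    (integrable_kineticSymbol_sq_mul_norm_sq u) ?_
  filter_upwards [hv] with ξ h1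
  rw [h1]
  exact mul_le_mul (pow_le_pow_left₀ (discreteSymbol_nonneg ξ) (discreteSymbol_le_kineticSymbol ξ) 2)
    (pow_le_pow_left₀ (norm_nonneg _) (norm_indicator_le_norm_self _ _) 2) (by positivity)
    (by positivity)

theorem exists_kineticSymbol_le (n : ℕ) : ∃ C : ℝ, ∀ ξ ∈ brillouin n, kineticSymbol ξ ≤ C := by
  refine ⟨4 * Real.pi ^ 2 * n, fun ξ hξ => ?_⟩
  unfold kineticSymbol
  refine mul_le_mul_of_nonneg_left ?_ (by positivity)
  rw [EuclideanSpace.norm_sq_eq]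
  calc ∑ i, ‖ξ i‖ ^ 2 ≤ ∑ _i : Fin n, (1 : ℝ) := by
        refine Finset.sum_le_sum fun i _ => ?_
        rw [Real.norm_eq_abs, sq_abs]
        nlinarith [(hξ i).1, (hξ i).2]
    _ = n := by simp

theorem interpolate_mem (v : DiscreteL2 n) : interpolate v ∈ sobolevH2 n := by
  obtain ⟨C, hC⟩ := exists_kineticSymbol_le n
  have hm : MemLp (fun ξ => (((brillouin n).indicator kineticSymbol ξ : ℝ) : ℂ)) ∞
      (volume : Measure (Space n)) := by
    refine memLp_top_of_bound ?_ |C| (Filter.Eventually.of_forall fun ξ => ?_)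
    · exact (Complex.measurable_ofReal.comp (continuous_kineticSymbol.measurable.indicator
        measurableSet_brillouin)).aestronglyMeasurable
    · rw [Complex.norm_real]
      by_cases h : ξ ∈ brillouin n
      · rw [indicator_of_mem h, Real.norm_of_nonneg (kineticSymbol_nonneg ξ)]
        exact (hC ξ h).trans (le_abs_self C)
      · rw [indicator_of_notMem h, norm_zero]
        positivity
  refine mem_sobolevH2_iff.2 ⟨boundedMul _ hm (fourierL2 n (interpolate v)), ?_⟩
  filter_upwards [boundedMul_coeFn _ hm (fourierL2 n (interpolate v)),
    fourierL2_interpolate v] with ξ h1 h2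
  rw [h1, h2]
  by_cases h : ξ ∈ brillouin n
  · rw [indicator_of_mem h]
  · simp [bandFunction, indicator_of_notMem h]

/-- With D = 2 - 2 cos t, concavity on [-π, π] gives t² ≤ (5/2) D, so t⁴ ≤ 7D². It remains to see
that t² ≤ D + t⁴: for |t| ≤ 1 this is Taylor's formula for the cosine, and for |t| ≥ 1 already t² ≤
t⁴. -/
theorem sq_le_two_sub_two_mul_cos {t : ℝ} (ht : |t| ≤ Real.pi) :
    t ^ 2 ≤ (2 - 2 * Real.cos t) + 7 * (2 - 2 * Real.cos t) ^ 2 := by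
  have h1 := Real.cos_le_one_sub_mul_cos_sq ht
  have h2 := Real.cos_le_one t
  set D := 2 - 2 * Real.cos t with hD
  have hD0 : 0 ≤ D := by linarith
  have h3 : t ^ 2 ≤ 5 / 2 * D := by
    have h4 : 2 / Real.pi ^ 2 * t ^ 2 ≤ D / 2 := by linarith
    rw [div_mul_eq_mul_div, div_le_iff₀ (by positivity)] at h4
    have h5 : Real.pi ^ 2 ≤ 10 := by nlinarith [Real.pi_lt_d2, Real.pi_pos]
    nlinarith [mul_le_mul_of_nonneg_left h5 hD0]
  have h4 : t ^ 2 * t ^ 2 ≤ 7 * D ^ 2 := by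
    nlinarith [mul_le_mul h3 h3 (sq_nonneg t) (by positivity)]
  rcases le_total |t| 1 with h5 | h5
  · have h6 := (abs_le.1 (Real.cos_bound h5)).2
    rw [show |t| ^ 4 = t ^ 2 * t ^ 2 by rw [← sq_abs]; ring] at h6
    nlinarith
  · have h6 : 1 ≤ t ^ 2 := by
      rw [← sq_abs]
      nlinarith
    nlinarith

theorem kineticSymbol_le_of_mem {ξ : Space n} (hξ : ξ ∈ brillouin n) :
    kineticSymbol ξ ≤ discreteSymbol ξ + 7 * discreteSymbol ξ ^ 2 := by
  have h1 : kineticSymbol ξ = ∑ j, (2 * Real.pi * ξ j) ^ 2 := by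
    rw [kineticSymbol, EuclideanSpace.norm_sq_eq, Finset.mul_sum]
    refine Finset.sum_congr rfl fun j _ => ?_
    rw [Real.norm_eq_abs, sq_abs]
    ring
  have h0 : ∀ j ∈ Finset.univ, 0 ≤ 2 - 2 * Real.cos (2 * Real.pi * ξ j) := fun j _ => by
    linarith [Real.cos_le_one (2 * Real.pi * ξ j)]
  calc kineticSymbol ξ ≤ ∑ j, ((2 - 2 * Real.cos (2 * Real.pi * ξ j)) +
        7 * (2 - 2 * Real.cos (2 * Real.pi * ξ j)) ^ 2) := by
        rw [h1]
        refine Finset.sum_le_sum fun j _ => sq_le_two_sub_two_mul_cos ?_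
        rw [abs_mul, abs_of_pos Real.two_pi_pos]
        have h2 : |ξ j| ≤ 1 / 2 := abs_le.2 ⟨by linarith [(hξ j).1], (hξ j).2.le⟩
        nlinarith [Real.pi_pos]
    _ = discreteSymbol ξ + 7 * ∑ j, (2 - 2 * Real.cos (2 * Real.pi * ξ j)) ^ 2 := by
        rw [Finset.sum_add_distrib, Finset.mul_sum]
        rfl
    _ ≤ _ := by
        have h3 := Finset.sum_sq_le_sq_sum_of_nonneg h0
        unfold discreteSymbol
        linarith

theorem re_inner_neg_laplacianH2_interpolate_le (v : DiscreteL2 n) :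
    (inner ℂ (interpolate v) (-laplacianH2 n ⟨interpolate v, interpolate_mem v⟩)).re ≤
      (inner ℂ v (discreteKinetic n v)).re + 7 * ‖discreteKinetic n v‖ ^ 2 := by
  have h1 := re_inner_neg_laplacianH2 ⟨interpolate v, interpolate_mem v⟩
  obtain ⟨C, hC⟩ := exists_kineticSymbol_le n
  have hi1 := integrable_bdd_mul_norm_sq_torus v (C := 4 * n)
      continuous_discreteSymbol.measurable fun ξ _ => by
    rw [abs_of_nonneg (discreteSymbol_nonneg ξ)]
    exact discreteSymbol_le ξ
  have hi2 := integrable_bdd_mul_norm_sq_torus v (f := fun ξ => discreteSymbol ξ ^ 2)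
      (C := (4 * n) ^ 2) (continuous_discreteSymbol.measurable.pow_const 2) fun ξ _ => by
    rw [abs_of_nonneg (by positivity)]
    exact pow_le_pow_left₀ (discreteSymbol_nonneg ξ) (discreteSymbol_le ξ) 2
  rw [h1, re_inner_discreteKinetic, norm_sq_discreteKinetic, ← integral_const_mul,
    ← integral_add hi1 (hi2.const_mul 7),
    integral_mul_norm_sq_interpolate v continuous_kineticSymbol.measurable]
  refine integral_mono (integrable_bdd_mul_norm_sq_torus v (C := C)
    continuous_kineticSymbol.measurable fun ξ hξ => ?_) (hi1.add (hi2.const_mul 7)) fun t => ?_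
  · rw [abs_of_nonneg (kineticSymbol_nonneg ξ)]
    exact hC ξ hξ
  · change _ ≤ discreteSymbol (cellRep t) * ‖torusFourier n v t‖ ^ 2 +
      7 * (discreteSymbol (cellRep t) ^ 2 * ‖torusFourier n v t‖ ^ 2)
    have h2 := mul_le_mul_of_nonneg_right (kineticSymbol_le_of_mem (cellRep_mem t))
      (sq_nonneg ‖torusFourier n v t‖)
    linarith

end BandLimiting

/-! ### The two one-sided comparisons of ground state energies -/

section Comparison

variable {n : ℕ}

/-- The cross term keeps ‖Wu‖ instead of bounding V by its supremum: for an almost eigenvector both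
‖Wu‖² and ‖u - z‖² are O(hE), hence so is the product of the norms. The cruder bound would give only
the square root. -/
theorem re_inner_potentialMul_le_of_sub (V : PeriodicPotential n) {S : ℝ} (hS : ∀ x, V x ≤ S)
    (h : ℝ) (u z : ContinuousL2 n) : (inner ℂ z (potentialMul V h z)).re ≤
      (inner ℂ u (potentialMul V h u)).re + 2 * (‖potentialMul V h u‖ * ‖u - z‖) +
        S * ‖u - z‖ ^ 2 := by
  have h1 : z = u - (u - z) := (sub_sub_cancel u z).symm
  have h2 := re_inner_potentialMul_le hS h (u - z)
  set w := u - z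
  have h3 := norm_inner_le_norm (𝕜 := ℂ) (potentialMul V h u) w
  have h4 := (abs_le.1 (Complex.abs_re_le_norm (inner ℂ (potentialMul V h u) w))).1
  have h5 : (inner ℂ w (potentialMul V h u)).re = (inner ℂ (potentialMul V h u) w).re := by
    rw [← inner_conj_symm, Complex.conj_re]
  rw [h1, map_sub, inner_sub_left, inner_sub_right, inner_sub_right,
    ← inner_potentialMul_left V h u w]
  simp only [Complex.sub_re, h5]
  linarith

/-- The discrete ground state energy is at most the continuous one, up to a relative error
of order `h`. -/
theorem exists_discrete_le_continuous {V : PeriodicPotential n} (hV : ∀ x, 0 ≤ V x) {c A : ℝ}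
    (hc : 0 < c) (hA : 0 < A) : ∃ C : ℝ, 0 < C ∧ ∀ h : ℝ, 0 < h → h ≤ 1 → ∀ Ed Ec : ℝ,
      (∀ v : DiscreteL2 n, Ed * ‖v‖ ^ 2 ≤ (inner ℂ v (discreteKinetic n v)).re +
        (inner ℂ v (discretePotential V h v)).re) →
      (∀ ε : ℝ, 0 < ε → ∃ u : sobolevH2 n, ‖(u : ContinuousL2 n)‖ = 1 ∧
        ‖-laplacianH2 n u + potentialMul V h u - (Ec : ℂ) • (u : ContinuousL2 n)‖ ≤ ε) →
      c * h ^ 2 ≤ Ec → Ec ≤ A * h → Ed ≤ Ec + C * h * Ec := by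
  obtain ⟨C₁, hC₁, hcomm⟩ := exists_re_inner_neg_laplacianH2_potentialMul_ge hV
  obtain ⟨C₂, hC₂, hpot⟩ := exists_inner_potential_sub_le V
  obtain ⟨S, hS0, hS⟩ := V.exists_bound
  set C₃ := 4 * A + 2 * C₁ * (2 + 1 / c) with hC₃
  have hC₃0 : 0 < C₃ := by positivity
  refine ⟨1 + (2 + S + C₂ + (4 * n + S)) * C₃ + C₂ / c, by positivity,
    fun h hh hh1 Ed Ec hEd hEc hEc1 hEc2 => ?_⟩
  have hEc0 : 0 < Ec := lt_of_lt_of_le (by positivity) hEc1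
  -- An accuracy of h Ec is affordable, being the size of the error allowed in the conclusion.
  obtain ⟨u, hu1, hu⟩ := hEc (h * Ec) (by positivity)
  obtain ⟨v, hv⟩ := exists_fourierL2_interpolate_eq (u : ContinuousL2 n)
  have h1 := hcomm h hh u
  obtain ⟨h2, h3⟩ := norm_sq_add_norm_sq_le_of_almost_eigenvector hu1 hEc0.le hu h1
  have h4 := norm_sq_sub_interpolate_le hv
  have h5 := norm_sq_interpolate_add_norm_sq_sub hv
  have h6 := re_inner_discreteKinetic_le_of_interpolate hv
  have h7 := norm_sq_discreteKinetic_le_of_interpolate hv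
  have h8 := (abs_le.1 (hpot h hh v)).2
  have h9 := hEd v
  -- An a priori bound from any nonzero vector, needed because the cut-off v is not normalized and
  -- Ed(1 - ‖v‖²) has to be estimated.
  have h10 : Ed ≤ 4 * n + S := by
    obtain ⟨w, hw⟩ := @exists_ne _ (nontrivial_discreteL2 n) (0 : DiscreteL2 n)
    have h11 := hEd w
    have h12 := re_inner_discreteKinetic_le w
    have h13 := re_inner_discretePotential_le (V := V) (fun x => (abs_le.1 (hS x)).2) h w
    refine le_of_mul_le_mul_right (?_ : Ed * ‖w‖ ^ 2 ≤ (4 * n + S) * ‖w‖ ^ 2)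
      (by have := norm_pos_iff.2 hw; positivity)
    linarith
  rw [hu1] at h1 h2 h5
  set w := (u : ContinuousL2 n) - interpolate v
  have h11 := re_inner_potentialMul_le_of_sub V (fun x => (abs_le.1 (hS x)).2) h
    (u : ContinuousL2 n) (interpolate v)
  -- N bounds the sum of ‖Ku‖² and ‖Wu‖²: the part 4A comes from (Ec + hEc)² with Ec ≤ A h, the rest
  -- from the commutator bound, where c h² ≤ Ec absorbs the term h².
  set N := C₃ * (h * Ec) with hN
  have hh2 : h ^ 2 ≤ Ec / c := by
    rw [le_div_iff₀ hc]
    linarith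
  have hhE : 0 < h * Ec := by positivity
  have h12 : ‖-laplacianH2 n u‖ ^ 2 + ‖potentialMul V h (u : ContinuousL2 n)‖ ^ 2 ≤ N := by
    refine h2.trans ?_
    have h13 : C₁ * h * ((inner ℂ (u : ContinuousL2 n) (-laplacianH2 n u)).re +
        (inner ℂ (u : ContinuousL2 n) (potentialMul V h u)).re + h ^ 2 * 1 ^ 2) ≤
        C₁ * h * ((2 + 1 / c) * Ec) := by
      refine mul_le_mul_of_nonneg_left ?_ (by positivity)
      have h15 : (2 + 1 / c) * Ec = 2 * Ec + Ec / c := by ring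
      have h16 : h * Ec ≤ Ec := mul_le_of_le_one_left hEc0.le hh1
      linarith
    have h14 : (Ec + h * Ec) ^ 2 ≤ 4 * A * (h * Ec) := by
      have h15 : Ec + h * Ec ≤ 2 * Ec := by
        linarith [mul_le_of_le_one_left hEc0.le hh1]
      calc (Ec + h * Ec) ^ 2 ≤ (2 * Ec) ^ 2 := by gcongr
        _ = 4 * (Ec * Ec) := by ring
        _ ≤ 4 * (A * h * Ec) := by gcongr
        _ = _ := by ring
    have : N = 4 * A * (h * Ec) + 2 * (C₁ * h * ((2 + 1 / c) * Ec)) := by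
      rw [hN, hC₃]
      ring
    rw [this]
    linarith
  have hN1 : ‖-laplacianH2 n u‖ ^ 2 ≤ N := by
    linarith [sq_nonneg ‖potentialMul V h (u : ContinuousL2 n)‖]
  have hN2 : ‖potentialMul V h (u : ContinuousL2 n)‖ ^ 2 ≤ N := by
    linarith [sq_nonneg ‖-laplacianH2 n u‖]
  have hw2 : ‖w‖ ^ 2 ≤ N := h4.trans hN1
  have h13 : ‖potentialMul V h (u : ContinuousL2 n)‖ * ‖w‖ ≤ N := by
    linarith [two_mul_le_add_sq ‖potentialMul V h (u : ContinuousL2 n)‖ ‖w‖]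
  have hv1 : ‖v‖ ^ 2 ≤ 1 := by linarith [sq_nonneg ‖w‖]
  have h14 : h ^ 3 * ‖v‖ ^ 2 ≤ h * Ec / c := by
    have h15 : h ^ 3 ≤ h * (Ec / c) := by
      rw [show h ^ 3 = h * h ^ 2 by ring]
      exact mul_le_mul_of_nonneg_left hh2 hh.le
    rw [mul_div_assoc]
    exact (mul_le_of_le_one_right (by positivity) hv1).trans h15
  have h15 : Ed * (1 - ‖v‖ ^ 2) ≤ (4 * n + S) * N := by
    have h16 : 0 ≤ 1 - ‖v‖ ^ 2 := by linarith
    have h17 : 1 - ‖v‖ ^ 2 ≤ N := by linarith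
    calc Ed * (1 - ‖v‖ ^ 2) ≤ (4 * n + S) * (1 - ‖v‖ ^ 2) := by gcongr
      _ ≤ _ := by gcongr
  have h16 : C₂ * (‖discreteKinetic n v‖ ^ 2 + h ^ 3 * ‖v‖ ^ 2) ≤ C₂ * (N + h * Ec / c) :=
    mul_le_mul_of_nonneg_left (add_le_add (h7.trans hN1) h14) hC₂.le
  have h17 : S * ‖w‖ ^ 2 ≤ S * N := mul_le_mul_of_nonneg_left hw2 hS0
  have h18 : Ec + (1 + (2 + S + C₂ + (4 * n + S)) * C₃ + C₂ / c) * h * Ec =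
      Ec + h * Ec + (2 * N + S * N + (4 * n + S) * N + C₂ * (N + h * Ec / c)) := by
    rw [hN]
    ring
  rw [h18]
  linarith

/-- The continuous ground state energy is at most the discrete one, up to an error
of order `h`. -/
theorem exists_continuous_le_discrete {V : PeriodicPotential n} (hV : ∀ x, 0 ≤ V x) {A : ℝ}
    (hA : 0 < A) : ∃ C : ℝ, 0 < C ∧ ∀ h : ℝ, 0 < h → h ≤ 1 → ∀ Ed Ec : ℝ,
      (∀ u : sobolevH2 n, Ec * ‖(u : ContinuousL2 n)‖ ^ 2 ≤
        (inner ℂ (u : ContinuousL2 n) (-laplacianH2 n u)).re +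
        (inner ℂ (u : ContinuousL2 n) (potentialMul V h u)).re) →
      (∀ ε : ℝ, 0 < ε → ∃ v : DiscreteL2 n, ‖v‖ = 1 ∧
        ‖discreteKinetic n v + discretePotential V h v - (Ed : ℂ) • v‖ ≤ ε) →
      0 ≤ Ed → Ed ≤ A * h → Ec ≤ Ed + C * h * (Ed + h ^ 2) := by
  obtain ⟨C₁, hC₁, hcomm⟩ := exists_re_inner_discreteKinetic_discretePotential_ge hV
  obtain ⟨C₂, hC₂, hpot⟩ := exists_inner_potential_sub_le V
  refine ⟨1 + (7 + C₂) * (A + 1 + 4 * C₁) + C₂, by positivity,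
    fun h hh hh1 Ed Ec hEc hEd hEd0 hEd1 => ?_⟩
  -- No positive lower bound on Ed is available here, so the accuracy is h³ rather than h Ed; this
  -- is why the conclusion contains Ed + h².
  obtain ⟨v, hv1, hv⟩ := hEd (h ^ 3) (by positivity)
  have h1 := hcomm h hh v
  obtain ⟨h2, h3⟩ := norm_sq_add_norm_sq_le_of_almost_eigenvector hv1 hEd0 hv h1
  have h4 := re_inner_neg_laplacianH2_interpolate_le v
  have h5 := (abs_le.1 (hpot h hh v)).1
  have h6 := hEc ⟨interpolate v, interpolate_mem v⟩
  change Ec * ‖interpolate v‖ ^ 2 ≤ (inner ℂ (interpolate v)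
    (-laplacianH2 n ⟨interpolate v, interpolate_mem v⟩)).re +
    (inner ℂ (interpolate v) (potentialMul V h (interpolate v))).re at h6
  rw [norm_interpolate, hv1] at h6
  rw [hv1] at h1 h2 h5
  set m := h * (Ed + h ^ 2) with hm
  have hm0 : 0 ≤ m := by positivity
  have hh3 : h ^ 3 ≤ m := by
    rw [hm]
    nlinarith [mul_nonneg hh.le hEd0]
  have hh32 : h ^ 3 ≤ h ^ 2 := pow_le_pow_of_le_one hh.le hh1 (by norm_num)
  have h7 : (Ed + h ^ 3) ^ 2 ≤ (A + 1) * m := by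
    have h8 : Ed + h ^ 3 ≤ (A + 1) * h := by nlinarith
    have h9 : Ed + h ^ 3 ≤ Ed + h ^ 2 := by linarith
    calc (Ed + h ^ 3) ^ 2 = (Ed + h ^ 3) * (Ed + h ^ 3) := sq _
      _ ≤ ((A + 1) * h) * (Ed + h ^ 2) := mul_le_mul h8 h9 (by positivity) (by positivity)
      _ = _ := by rw [hm]; ring
  have h8 : ‖discreteKinetic n v‖ ^ 2 ≤ (A + 1 + 4 * C₁) * m := by
    have h9 : C₁ * h * ((inner ℂ v (discreteKinetic n v)).re +
        (inner ℂ v (discretePotential V h v)).re + h ^ 2 * 1 ^ 2) ≤ C₁ * h * (2 * (Ed + h ^ 2)) :=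
      mul_le_mul_of_nonneg_left (by linarith) (by positivity)
    have h10 : C₁ * h * (2 * (Ed + h ^ 2)) = 2 * C₁ * m := by
      rw [hm]
      ring
    nlinarith [sq_nonneg ‖discretePotential V h v‖]
  have h9 : (7 + C₂) * ‖discreteKinetic n v‖ ^ 2 ≤ (7 + C₂) * ((A + 1 + 4 * C₁) * m) :=
    mul_le_mul_of_nonneg_left h8 (by positivity)
  have h10 : C₂ * h ^ 3 ≤ C₂ * m := mul_le_mul_of_nonneg_left hh3 hC₂.le
  have h11 : Ed + (1 + (7 + C₂) * (A + 1 + 4 * C₁) + C₂) * h * (Ed + h ^ 2) =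
      Ed + m + (7 + C₂) * ((A + 1 + 4 * C₁) * m) + C₂ * m := by
    rw [hm]
    ring
  rw [h11]
  linarith

end Comparison

/-! ### From the two comparisons to the ratio -/

section GroundStateRatio

variable {n : ℕ}

/-- By connectedness a set without boundary is empty or everything. The first contradicts covering;
the second contradicts disjointness of the translates, since n ≥ 1 provides a nonzero lattice
vector. -/
theorem IsLatticeFundamentalDomain.frontier_nonempty (hn : 1 ≤ n) {F : Set (Space n)}
    (hF : IsLatticeFundamentalDomain F) : (frontier F).Nonempty := by
  rw [nonempty_iff_ne_empty]
  intro h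
  rcases isClopen_iff.1 (isClopen_iff_frontier_eq_empty.2 h) with h1 | h1
  · obtain ⟨γ, hγ⟩ := hF.covers 0
    simp [h1] at hγ
  · have h2 := hF.disjoint (Pi.single ⟨0, hn⟩ 1) 0 (by simp [h1]) (by simp [h1])
    have h3 := congrFun h2 ⟨0, hn⟩
    simp at h3

theorem re_inner_le_of_norm_sub_smul_le {H : Type*} [NormedAddCommGroup H] [InnerProductSpace ℂ H]
    {u x : H} {lam ε : ℝ} (hu : ‖u‖ = 1) (h : ‖x - (lam : ℂ) • u‖ ≤ ε) :
    (inner ℂ u x).re ≤ lam + ε := by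
  have h1 : (inner ℂ u (x - (lam : ℂ) • u)).re ≤ ε := by
    calc _ ≤ ‖inner ℂ u (x - (lam : ℂ) • u)‖ := Complex.re_le_norm _
      _ ≤ ‖u‖ * ‖x - (lam : ℂ) • u‖ := norm_inner_le_norm _ _
      _ ≤ ε := by rw [hu, one_mul]; exact h
  rw [inner_sub_right, inner_smul_right, inner_self_eq_norm_sq_to_K, hu] at h1
  simp at h1
  linarith

theorem discretePotential_subConst (V : PeriodicPotential n) (a h : ℝ) (v : DiscreteL2 n) :
    discretePotential V h v = discretePotential (V.subConst a) h v + (a : ℂ) • v := by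
  ext γ
  rw [lp.coeFn_add, Pi.add_apply, lp.coeFn_smul, Pi.smul_apply, discretePotential_apply,
    discretePotential_apply, PeriodicPotential.subConst_apply, smul_eq_mul]
  push_cast
  ring

theorem potentialMul_subConst (V : PeriodicPotential n) (a h : ℝ) (u : ContinuousL2 n) :
    potentialMul V h u = potentialMul (V.subConst a) h u + (a : ℂ) • u := by
  apply Lp.ext
  filter_upwards [potentialMul_coeFn V h u, potentialMul_coeFn (V.subConst a) h u,
    Lp.coeFn_add (potentialMul (V.subConst a) h u) ((a : ℂ) • u), Lp.coeFn_smul (a : ℂ) u]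
    with x h1 h2 h3 h4
  rw [h1, h3, Pi.add_apply, h2, h4, Pi.smul_apply, PeriodicPotential.subConst_apply, smul_eq_mul]
  push_cast
  ring

theorem re_inner_discreteKinetic_nonneg (v : DiscreteL2 n) :
    0 ≤ (inner ℂ v (discreteKinetic n v)).re := by
  rw [re_inner_discreteKinetic]
  exact integral_nonneg fun t => mul_nonneg (discreteSymbol_nonneg _) (by positivity)

/-- Both ground state energies for a nonnegative potential with a zero, not identically zero. -/
theorem exists_abs_ground_energy_sub_le {V : PeriodicPotential n} (hV : ∀ x, 0 ≤ V x)
    {x₀ x₁ : Space n} (hx₀ : V x₀ = 0) (hx₁ : 0 < V x₁) :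
    ∃ A C : ℝ, 0 < A ∧ 0 < C ∧ ∀ h : ℝ, 0 < h → h ≤ 1 → ∀ Ed Ec : ℝ,
      (∀ v : DiscreteL2 n, Ed * ‖v‖ ^ 2 ≤ (inner ℂ v (discreteKinetic n v)).re +
        (inner ℂ v (discretePotential V h v)).re) →
      (∀ ε : ℝ, 0 < ε → ∃ v : DiscreteL2 n, ‖v‖ = 1 ∧
        ‖discreteKinetic n v + discretePotential V h v - (Ed : ℂ) • v‖ ≤ ε) →
      (∀ u : sobolevH2 n, Ec * ‖(u : ContinuousL2 n)‖ ^ 2 ≤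
        (inner ℂ (u : ContinuousL2 n) (-laplacianH2 n u)).re +
        (inner ℂ (u : ContinuousL2 n) (potentialMul V h u)).re) →
      (∀ ε : ℝ, 0 < ε → ∃ u : sobolevH2 n, ‖(u : ContinuousL2 n)‖ = 1 ∧
        ‖-laplacianH2 n u + potentialMul V h u - (Ec : ℂ) • (u : ContinuousL2 n)‖ ≤ ε) →
      0 < Ec ∧ Ec ≤ A * h ∧ |Ed - Ec| ≤ C * h * Ec := by
  obtain ⟨c, hc, hlow⟩ := exists_sq_mul_norm_sq_le_energy hV hx₁
  obtain ⟨A, hA, hup⟩ := exists_energy_le hV hx₀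
  obtain ⟨C₂, hC₂, hdc⟩ := exists_discrete_le_continuous hV hc hA
  -- The upper bound on Ed required here is inherited from Ec through the first comparison: Ed ≤ (1
  -- + C₂) Ec ≤ (1 + C₂) A h.
  obtain ⟨C₁, hC₁, hcd⟩ := exists_continuous_le_discrete hV (A := (1 + C₂) * A) (by positivity)
  refine ⟨A, C₂ + C₁ * (1 + C₂ + 1 / c), hA, by positivity,
    fun h hh hh1 Ed Ec hd hd' hc1 hc' => ?_⟩
  have h1 : c * h ^ 2 ≤ Ec := by
    refine le_of_forall_pos_le_add fun ε hε => ?_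
    obtain ⟨u, hu, hu2⟩ := hc' ε hε
    have h2 := re_inner_le_of_norm_sub_smul_le hu hu2
    have h3 := hlow h hh hh1 u
    rw [hu, one_pow, mul_one] at h3
    rw [inner_add_right, Complex.add_re] at h2
    exact h3.trans h2
  have hEc : 0 < Ec := lt_of_lt_of_le (by positivity) h1
  have h2 : Ec ≤ A * h := by
    obtain ⟨u, hu, hu2⟩ := hup h hh hh1
    exact le_of_mul_le_mul_right ((hc1 u).trans hu2) (by positivity)
  have h3 : 0 ≤ Ed := by
    refine le_of_forall_pos_le_add fun ε hε => ?_
    obtain ⟨v, hv, hv2⟩ := hd' ε hε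
    have h4 := re_inner_le_of_norm_sub_smul_le hv hv2
    rw [inner_add_right, Complex.add_re] at h4
    linarith [re_inner_discreteKinetic_nonneg v, re_inner_discretePotential_nonneg hV h v]
  have h4 := hdc h hh hh1 Ed Ec hd hc' h1 h2
  have h5 : Ed ≤ (1 + C₂) * Ec := by
    have : C₂ * h * Ec ≤ C₂ * Ec := by
      rw [mul_assoc]
      exact mul_le_mul_of_nonneg_left (mul_le_of_le_one_left hEc.le hh1) hC₂.le
    linarith
  have h6 : Ed ≤ (1 + C₂) * A * h := by
    rw [mul_assoc]
    exact h5.trans (mul_le_mul_of_nonneg_left h2 (by positivity))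
  have h7 := hcd h hh hh1 Ed Ec hc1 hd' h3 h6
  have h8 : Ed + h ^ 2 ≤ (1 + C₂ + 1 / c) * Ec := by
    have : h ^ 2 ≤ 1 / c * Ec := by
      rw [one_div, inv_mul_eq_div, le_div_iff₀ hc]
      linarith
    linarith
  have h9 : C₁ * h * (Ed + h ^ 2) ≤ C₁ * h * ((1 + C₂ + 1 / c) * Ec) :=
    mul_le_mul_of_nonneg_left h8 (by positivity)
  refine ⟨hEc, h2, abs_le.2 ⟨?_, ?_⟩⟩
  · have : 0 ≤ C₂ * h * Ec := by positivity
    linarith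
  · have : 0 ≤ C₁ * h * ((1 + C₂ + 1 / c) * Ec) := by positivity
    linarith

/-- The lower bound m on the denominator is left free: it is Ec itself when min V = 0, and a fixed
fraction of |min V| otherwise. -/
theorem abs_div_sub_one_le {Ed Ec B m : ℝ} (hm : 0 < m) (hEc : m ≤ |Ec|) (h : |Ed - Ec| ≤ B * m) :
    Ec ≠ 0 ∧ |Ed / Ec - 1| ≤ B := by
  have h0 : 0 < |Ec| := hm.trans_le hEc
  have h1 : Ec ≠ 0 := abs_pos.1 h0
  refine ⟨h1, ?_⟩
  rw [div_sub_one h1, abs_div, div_le_iff₀ h0]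
  have hB : 0 ≤ B := by
    by_contra hcon
    have := abs_nonneg (Ed - Ec)
    nlinarith
  exact h.trans (mul_le_mul_of_nonneg_left hEc hB)

end GroundStateRatio

theorem theorem1 (n : ℕ) (hn : 1 ≤ n) (V : PeriodicPotential n)
    (hV : ∃ F : Set (EuclideanSpace ℝ (Fin n)),
      IsLatticeFundamentalDomain F ∧ HasBarrier V F) :
    ∃ C : ℝ, ∃ h₀ : ℝ, 0 < h₀ ∧ ∀ h : ℝ, 0 < h → h < h₀ →
      ∃ Ed Ec : ℝ,
        IsMinOfSpectrum (spectrum ℂ (discreteOp V h)) Ed ∧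
        IsMinOfSpectrum (unboundedSpectrum (continuousOp V h)) Ec ∧
        Ec ≠ 0 ∧
        |Ed / Ec - 1| ≤ C * h := by
  obtain ⟨F, hF, hbar⟩ := hV
  obtain ⟨x₁, hx₁⟩ := hF.frontier_nonempty hn
  obtain ⟨x₀, hx₀⟩ := V.exists_isMinOn
  -- A boundary point of F witnesses that V is not constant; nothing more is extracted from the
  -- barrier.
  have hlt : V x₀ < V x₁ := (le_ciInf hx₀).trans_lt (hbar x₁ hx₁)
  set a := V x₀
  obtain ⟨A, C, hA, hC, hmain⟩ := exists_abs_ground_energy_sub_le (V := V.subConst a)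
    (x₀ := x₀) (x₁ := x₁) (fun x => sub_nonneg.2 (hx₀ x)) (sub_self _) (sub_pos.2 hlt)
  have hpair : ∀ h : ℝ, 0 < h → h ≤ 1 → ∃ Ed Ec : ℝ,
      IsMinOfSpectrum (spectrum ℂ (discreteOp V h)) Ed ∧
      IsMinOfSpectrum (unboundedSpectrum (continuousOp V h)) Ec ∧
      0 < Ec - a ∧ Ec - a ≤ A * h ∧ |Ed - Ec| ≤ C * h * (Ec - a) := by
    intro h hh hh1
    have := nontrivial_discreteL2 n
    obtain ⟨Ed, hEd, hd1, hd2⟩ := exists_isMinOfSpectrum_of_isSelfAdjoint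
      (isSelfAdjoint_discreteOp V h)
    obtain ⟨Ec, hEc, hc1, hc2⟩ := exists_isMinOfSpectrum_continuousOp V h
    have hinner : ∀ {H : Type} [NormedAddCommGroup H] [InnerProductSpace ℂ H] (u x y : H) (E : ℝ),
        E * ‖u‖ ^ 2 ≤ (inner ℂ u (x + (y + (a : ℂ) • u))).re →
        (E - a) * ‖u‖ ^ 2 ≤ (inner ℂ u x).re + (inner ℂ u y).re := by
      intro H _ _ u x y E hE
      rw [inner_add_right, inner_add_right, inner_smul_right, inner_self_eq_norm_sq_to_K,
        Complex.add_re, Complex.add_re, Complex.re_ofReal_mul] at hE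
      have h1 : (((‖u‖ : ℝ) : ℂ) ^ 2).re = ‖u‖ ^ 2 := by
        rw [← Complex.ofReal_pow, Complex.ofReal_re]
      change E * ‖u‖ ^ 2 ≤ _ + (_ + a * (((‖u‖ : ℝ) : ℂ) ^ 2).re) at hE
      rw [h1] at hE
      linarith
    have hvec : ∀ {H : Type} [NormedAddCommGroup H] [InnerProductSpace ℂ H] (u x y : H) (E : ℝ),
        x + (y + (a : ℂ) • u) - (E : ℂ) • u = x + y - ((E - a : ℝ) : ℂ) • u := by
      intro H _ _ u x y E
      rw [Complex.ofReal_sub, sub_smul]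
      abel
    obtain ⟨h1, h2, h3⟩ := hmain h hh hh1 (Ed - a) (Ec - a)
      (fun v => by
        have h4 := hd1 v
        rw [discreteOp_eq, _root_.add_apply, discretePotential_subConst V a] at h4
        exact hinner _ _ _ _ h4)
      (fun ε hε => by
        obtain ⟨v, hv, hv2⟩ := hd2 ε hε
        rw [discreteOp_eq, _root_.add_apply, discretePotential_subConst V a, hvec] at hv2
        exact ⟨v, hv, hv2⟩)
      (fun u => by
        have h4 := hc1 u
        rw [potentialMul_subConst V a] at h4
        exact hinner _ _ _ _ h4)
      (fun ε hε => by
        obtain ⟨u, hu, hu2⟩ := hc2 ε hε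
        rw [potentialMul_subConst V a, hvec] at hu2
        exact ⟨u, hu, hu2⟩)
    rw [sub_sub_sub_cancel_right] at h3
    exact ⟨Ed, Ec, hEd, hEc, h1, h2, h3⟩
  rcases eq_or_ne a 0 with ha | ha
  · refine ⟨C, 1, one_pos, fun h hh hh1 => ?_⟩
    obtain ⟨Ed, Ec, hEd, hEc, h1, h2, h3⟩ := hpair h hh hh1.le
    rw [ha, sub_zero] at h1 h3
    exact ⟨Ed, Ec, hEd, hEc, abs_div_sub_one_le h1 (le_abs_self Ec) h3⟩
  -- When min V ≠ 0, h₀ is chosen so that A h < |a|/2, which gives |Ec| ≥ |a|/2. The difference of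
  -- the energies is at most C A h², and one factor h is discarded using h ≤ 1.
  · have ha0 : 0 < |a| := abs_pos.2 ha
    refine ⟨2 * C * A / |a|, min 1 (|a| / (2 * A)), by positivity, fun h hh hh1 => ?_⟩
    obtain ⟨hh2, hh3⟩ := lt_min_iff.1 hh1
    obtain ⟨Ed, Ec, hEd, hEc, h1, h2, h3⟩ := hpair h hh hh2.le
    rw [lt_div_iff₀ (by positivity)] at hh3
    refine ⟨Ed, Ec, hEd, hEc, abs_div_sub_one_le (m := |a| / 2) (by positivity) ?_ ?_⟩
    · have h4 := abs_sub_abs_le_abs_sub a Ec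
      rw [abs_sub_comm, abs_of_pos h1] at h4
      linarith
    · refine h3.trans ((mul_le_mul_of_nonneg_left h2 (by positivity)).trans ?_)
      have h4 : 2 * C * A / |a| * h * (|a| / 2) = C * A * h := by
        field_simp
      rw [h4]
      have : C * h * (A * h) = C * A * h * h := by ring
      rw [this]
      exact mul_le_of_le_one_right (by positivity) hh2.le
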